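/- **Setting.** Write $e(x)=e^{2\pi i x}$. For $M\ge 0$ let $V_M=\mathrm{span}\{e(kt):|k|\le M\}$; let $\mathcal F(g)(k)=\int_0^1 g(t)e(-kt)\,dt$, $\|\mathcal F(g)\|_1=\sum_{k\in\mathbb Z}|\mathcal F(g)(k)|$, and let $P_{V_M}g=\sum_{|k|\le M}\mathcal F(g)(k)e(kt)$. For a phase function $\vartheta$ put $L_\vartheta=\frac{\vartheta(1)-\vartheta(0)}{2\pi}$ and $\overline\vartheta=\frac{\vartheta-\vartheta(0)}{2\pi L_\vartheta}$. **The signal.** $f(t)=f_0(t)+f_1(t)\cos\theta(t)$ is $1$-periodic, where $\theta$ is differentiable, $\theta'>0$ and $\theta'\in V_{M_0}$; $f_0,f_1$ are real, continuous and $1$-periodic, $f_1>0$, and $\int_0^1 f_i\,e(-k\overline\theta)\,d\overline\theta=0$ for all $|k|>M_1$, $i=0,1$. Let $L=L_\theta$. **The algorithm.** Given are sample points $t_1,\dots,t_{N_s}\in[0,1]$, an even number $N_b$ of Fourier modes $k=-N_b/2+1,\dots,N_b/2$, and a normalizing constant $\nu>0$ (for instance the number $N_f$ of points of a uniform grid from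 which the $t_j$ are taken, or $N_s$). For a phase function $\vartheta$ put $$\Phi_\vartheta(j,k)=\sqrt{\overline\vartheta'(t_j)/\nu}\;e\big(k\overline\vartheta(t_j)\big),\qquad \widetilde f_j=\sqrt{\overline\vartheta'(t_j)/\nu}\;f(t_j).$$ From $\theta^m$ one obtains $\theta^{m+1}$ as follows, with $L^m=L_{\theta^m}$. 1. Let $x\in\mathbb C^{N_b}$ be a minimizer of $\|x\|_1$ subject to $\Phi_{\theta^m}x=\widetilde f$. 2. Let $\chi$ be the indicator function of $(-\frac12,\frac12)$ and let $$X_\pm(t)=\sum_k x_k\,\chi\Big(\frac{k\mp L^m}{L^m}\Big)\,e\big((k\mp L^m)\overline{\theta^m}(t)\big),\qquad a=\mathrm{Re}(X_++X_-),\quad b=\mathrm{Re}\big(-i(X_+-X_-)\big).$$ 3. Let $\Delta\theta(t)=\int_0^t P_{V_{M_0}}\big(\tfrac{d}{ds}\arctan\tfrac ba\big)(s)\,ds$, where $\arctan\frac ba$ is taken along a continuous branch, so that its derivative is $\frac{ab'-ba'}{a^2+b^2}$. Then $\theta^{m+1}=\theta^m+\beta\Delta\theta$ with the largest $\beta\in[0,1]$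 such that $(\theta^m+\beta\Delta\theta)'\ge0$ on $[0,1]$. For a matrix $A$, $\delta_S(A)$ is its $S$-restricted isometry constant: the smallest $\delta\ge0$ with $(1-\delta)\|c\|_2^2\le\|A_Tc\|_2^2\le(1+\delta)\|c\|_2^2$ for every set $T$ of at most $S$ columns and all $c\in\mathbb C^T$. Let $S_m$ be the largest integer $S$ with $\delta_{3S}(\Phi_{\theta^m})+3\delta_{4S}(\Phi_{\theta^m})<2$. **Theorem.** There are constants $\eta_0,\eta_1,\eta_2>0$, depending only on $M_0$, $M_1$, the normalized phase function $\overline\theta$, a positive lower bound for $f_1$ and an upper bound for $|f_0|$ and $f_1$ (but not on $L$, $\nu$, $N_s$, $N_b$, the sample points, $\theta^0$ or $m$), such that the following holds. Let $L\ge\eta_0$ and $N_b\ge\eta_2(L+N_s)$. Let $\theta^0$ be differentiable with $(\theta^0)'\in V_{M_0}$ and $$\|\mathcal F((\theta^0-\theta)')\|_1\le \pi M_0/2 ,$$ and let $\theta^0,\dots,\theta^{m+1}$ be produced by the algorithm, with $S_i\ge\eta_1$ for all $i\le m$. Then $$\|\mathcal F((\theta^{m+1}-\theta)')\|_1\le\tfrac12\,\|\mathcal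 F((\theta^{m}-\theta)')\|_1 .$$ -/

import Mathlib

open Set

noncomputable section

namespace SparseTF

/-- The character `e(x) = exp(2πix)`. -/
def e (x : ℝ) : ℂ := Complex.exp (2 * Real.pi * x * Complex.I)

/-- `V_M = span {e^{2πikt} : |k| ≤ M}`, the trigonometric polynomials of degree at most `M`. -/
def trigSpace (M : ℕ) : Submodule ℂ (ℝ → ℂ) :=
  Submodule.span ℂ ((fun (k : ℤ) (t : ℝ) => e (k * t)) '' {k : ℤ | |k| ≤ (M : ℤ)})

/-- The derivative of a real function, as a complex-valued function. -/
def cderiv (g : ℝ → ℝ) (t : ℝ) : ℂ := ((deriv g t : ℝ) : ℂ)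

/-- `𝓕(g)(k) = ∫₀¹ g(t) e^{-2πikt} dt`, the Fourier coefficient in the physical coordinate. -/
def fourierC (g : ℝ → ℂ) (k : ℤ) : ℂ := fourierCoeffOn (zero_lt_one' ℝ) g k

/-- `‖𝓕(g)‖₁ = ∑_{k ∈ ℤ} |𝓕(g)(k)|` (used below for trigonometric polynomials only, for which
the sum is finite). -/
def fourierNorm (g : ℝ → ℂ) : ℝ := ∑' k : ℤ, ‖fourierC g k‖

/-- `𝓕(g)(k)` written out as an integral. -/
theorem fourierC_eq (g : ℝ → ℂ) (k : ℤ) :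
    fourierC g k = ∫ t in (0 : ℝ)..1, e (-(k * t)) * g t := by
  unfold fourierC e
  rw [fourierCoeffOn_eq_integral]
  simp only [sub_zero, div_one, one_smul]
  refine intervalIntegral.integral_congr fun t _ => ?_
  simp only [fourier_coe_apply, smul_eq_mul]
  congr 2
  push_cast
  ring

/-- The number of periods `L = (θ(1) - θ(0)) / (2π)` of a phase function. -/
def numPeriods (θ : ℝ → ℝ) : ℝ := (θ 1 - θ 0) / (2 * Real.pi)

/-- The normalized phase function `θ̄ = (θ - θ(0)) / (2πL)`. -/
def normPhase (θ : ℝ → ℝ) (t : ℝ) : ℝ := (θ t - θ 0) / (2 * Real.pi * numPeriods θ)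

/-- `∫₀¹ g e^{-2πikθ̄} dθ̄`, the Fourier coefficient of `g` in the `θ̄`-coordinate. -/
def phaseCoeff (θ g : ℝ → ℝ) (k : ℤ) : ℂ :=
  ∫ t in (0 : ℝ)..1, (g t : ℂ) * e (-(k * normPhase θ t)) * ((deriv (normPhase θ) t : ℝ) : ℂ)

/-- A differentiable phase function whose derivative (the instantaneous frequency) lies in
`V_M`. -/
structure IsSparsePhase (M : ℕ) (θ : ℝ → ℝ) : Prop where
  differentiable : Differentiable ℝ θ
  deriv_mem : cderiv θ ∈ trigSpace M

/-- A local mean or an envelope: continuous, of period one, with no Fourier coefficient of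
order larger than `M` in the `θ̄`-coordinate. -/
structure IsSparseInPhase (M : ℕ) (θ g : ℝ → ℝ) : Prop where
  continuous : Continuous g
  periodic : Function.Periodic g 1
  coeff_eq_zero : ∀ k : ℤ, (M : ℤ) < |k| → phaseCoeff θ g k = 0

/-- The Fourier modes `-N/2+1, …, N/2` (there are `N` of them, as `N` is even). -/
def modes (N : ℕ) : Finset ℤ := Finset.Ioc (-((N : ℤ) / 2)) ((N : ℤ) / 2)

theorem card_modes {N : ℕ} (hN : Even N) : (modes N).card = N := by
  obtain ⟨K, rfl⟩ := hN
  simp only [modes, Int.card_Ioc]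
  omega

/-- The matrix `Φ_θ`, with entries `√(θ̄'(t_j)/ν) e^{2πikθ̄(t_j)}`; here `ν > 0` is the
normalization (for instance the number of points of a uniform grid, or the number of samples). -/
def Phi {Ns : ℕ} (Nb : ℕ) (ν : ℝ) (t : Fin Ns → ℝ) (θ : ℝ → ℝ) :
    Matrix (Fin Ns) (modes Nb) ℂ :=
  fun j k => (Real.sqrt (deriv (normPhase θ) (t j) / ν) : ℂ) * e ((k : ℤ) * normPhase θ (t j))

/-- The weighted samples `√(θ̄'(t_j)/ν) f(t_j)`. -/
def data {Ns : ℕ} (ν : ℝ) (t : Fin Ns → ℝ) (f θ : ℝ → ℝ) : Fin Ns → ℂ :=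
  fun j => (Real.sqrt (deriv (normPhase θ) (t j) / ν) : ℂ) * (f (t j) : ℂ)

/-- `x` is a solution of `min ‖x‖₁ subject to A x = y`. -/
def IsL1Minimizer {ι κ : Type*} [Fintype κ] (A : Matrix ι κ ℂ) (y : ι → ℂ) (x : κ → ℂ) :
    Prop :=
  A.mulVec x = y ∧ ∀ x' : κ → ℂ, A.mulVec x' = y → ∑ k, ‖x k‖ ≤ ∑ k, ‖x' k‖

/-- The `S`-restricted isometry constant of `A`: the smallest `δ ≥ 0` such that
`(1 - δ)‖c‖² ≤ ‖A_T c‖² ≤ (1 + δ)‖c‖²` for all sets `T` of at most `S` columns and all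
coefficient sequences `c` on `T`. -/
def ric {ι κ : Type*} [Fintype ι] [Fintype κ] (A : Matrix ι κ ℂ) (S : ℕ) : ℝ :=
  sInf {δ : ℝ | 0 ≤ δ ∧ ∀ (T : Finset κ) (c : κ → ℂ), T.card ≤ S → (∀ k, k ∉ T → c k = 0) →
    (1 - δ) * ∑ k, ‖c k‖ ^ 2 ≤ ∑ j, ‖A.mulVec c j‖ ^ 2 ∧
      ∑ j, ‖A.mulVec c j‖ ^ 2 ≤ (1 + δ) * ∑ k, ‖c k‖ ^ 2}

/-- `S` is the largest number with `δ_{3S}(A) + 3 δ_{4S}(A) < 2`. -/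
def IsSparsityLevel {ι κ : Type*} [Fintype ι] [Fintype κ] (A : Matrix ι κ ℂ) (S : ℕ) : Prop :=
  IsGreatest {s : ℕ | ric A (3 * s) + 3 * ric A (4 * s) < 2} S

/-- The cutoff function: the indicator function of `(-1/2, 1/2)`. -/
def cutoff (ω : ℝ) : ℂ := Set.indicator (Ioo (-1 / 2 : ℝ) (1 / 2)) (fun _ => (1 : ℂ)) ω

/-- `∑_ω x(ω + s) χ(ω/L) e^{2πiωθ̄(t)}`, summed over the `ω = k - s` for which `ω + s = k` is one
of the Fourier modes. It is used with the shifts `s = L` and `s = -L`, where `L` is the number of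
periods of `θ`, which need not be an integer for an approximate phase function. -/
def shifted {Nb : ℕ} (θ : ℝ → ℝ) (x : modes Nb → ℂ) (s t : ℝ) : ℂ :=
  ∑ k : modes Nb, x k * cutoff ((((k : ℤ) : ℝ) - s) / numPeriods θ) *
    e ((((k : ℤ) : ℝ) - s) * normPhase θ t)

/-- `a = 𝓕_θ⁻¹[(x(ω + L) + x(ω - L)) χ(ω/L)]`. The real part is taken because a minimizer `x`
need not be conjugate symmetric. -/
def ampA {Nb : ℕ} (θ : ℝ → ℝ) (x : modes Nb → ℂ) (t : ℝ) : ℝ :=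
  (shifted θ x (numPeriods θ) t + shifted θ x (-numPeriods θ) t).re

/-- `b = 𝓕_θ⁻¹[-i (x(ω + L) - x(ω - L)) χ(ω/L)]`, real part as for `a`. -/
def ampB {Nb : ℕ} (θ : ℝ → ℝ) (x : modes Nb → ℂ) (t : ℝ) : ℝ :=
  (-Complex.I * (shifted θ x (numPeriods θ) t - shifted θ x (-numPeriods θ) t)).re

/-- The derivative of (a continuous branch of) `arctan (b/a)`, also across the zeros of `a`. -/
def arctanRate (a b : ℝ → ℝ) (t : ℝ) : ℝ :=
  (a t * deriv b t - b t * deriv a t) / (a t ^ 2 + b t ^ 2)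

theorem deriv_arctan_div {a b : ℝ → ℝ} {t : ℝ} (ha : DifferentiableAt ℝ a t)
    (hb : DifferentiableAt ℝ b t) (h : a t ≠ 0) :
    deriv (fun s => Real.arctan (b s / a s)) t = arctanRate a b t := by
  have h1 := ((hb.hasDerivAt.div ha.hasDerivAt h).arctan).deriv
  have h2 : (fun s => Real.arctan (b s / a s)) = fun s => Real.arctan ((b / a) s) := rfl
  rw [h2, h1, arctanRate]
  have h3 : a t ^ 2 + b t ^ 2 ≠ 0 := by positivity
  have h4 : 1 + ((b / a) t) ^ 2 ≠ 0 := by positivity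
  simp only [Pi.div_apply] at h4 ⊢
  field_simp

/-- The orthogonal projection `P_{V_M} g = ∑_{|k| ≤ M} 𝓕(g)(k) e^{2πikt}` of a real function
(the sum is real). -/
def proj (M : ℕ) (g : ℝ → ℝ) (t : ℝ) : ℝ :=
  (∑ k ∈ Finset.Icc (-(M : ℤ)) M, fourierC (fun s => (g s : ℂ)) k * e (k * t)).re

/-- `Δθ(t) = ∫₀ᵗ P_{V_M}((arctan (b/a))')(s) ds`. -/
def increment {Nb : ℕ} (M : ℕ) (θ : ℝ → ℝ) (x : modes Nb → ℂ) (t : ℝ) : ℝ :=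
  ∫ s in (0 : ℝ)..t, proj M (arctanRate (ampA θ x) (ampB θ x)) s

/-- One step of the algorithm takes the phase function `θ` to `θ'`: `x` solves the `ℓ¹` problem
for the matrix `Φ_θ`, and `θ' = θ + βΔθ` with the largest `β ∈ [0,1]` that keeps the phase
function nondecreasing. -/
def IsStep {Ns : ℕ} (M Nb : ℕ) (ν : ℝ) (t : Fin Ns → ℝ) (f θ θ' : ℝ → ℝ) : Prop :=
  ∃ (x : modes Nb → ℂ) (β : ℝ),
    IsL1Minimizer (Phi Nb ν t θ) (data ν t f θ) x ∧
    IsGreatest {α : ℝ | α ∈ Icc (0 : ℝ) 1 ∧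
      ∀ s ∈ Icc (0 : ℝ) 1, 0 ≤ deriv (fun r => θ r + α * increment M θ x r) s} β ∧
    ∀ s, θ' s = θ s + β * increment M θ x s

/-- The error `‖𝓕((θ₁ - θ)')‖₁` of the instantaneous frequency. -/
def freqError (θ₁ θ : ℝ → ℝ) : ℝ := fourierNorm (cderiv (fun t => θ₁ t - θ t))

end SparseTF

end

noncomputable section

namespace SparseTF

/-! Phases here are primitives of trigonometric polynomials, hence entire, and this produces
exponential decay with constants independent of `L`. Let `φ` and `ψ` be the normalized phases of `θ`
and of the iterate `Θ`, and let `D` be the current frequency error. The number of periods of `θ` is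
an integer `N`, because `f` is periodic. With `a = 2πN`, `Q` the primitive of `(Θ - θ)'` vanishing
at 0, and `r = Q(1)`, one has `ψ = (aφ + Q)/(a + r)`, so `e(nφ) = e(nψ) exp(i(n/N)(rψ - Q))`. For
`|n| ≤ 2N` the exponent is `O(D)` uniformly in `N`. Shifting the contour of integration off the real
axis then shows that the second factor minus one has Fourier coefficients `O(D e^{-ρ|l|})` in the
coordinate `ψ` (`exists_phase_change`). Consequently the signal, written in `ψ`, consists of three
clusters centered at `0`, `N`, `-N`, whose coefficients at distance more than `M₁` from the center
are exponentially small multiples of `D` (`exists_expandsAt`).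

These coefficients form an infinite sequence, whereas the `ℓ¹` problem has finitely many modes. But
the constraint is only tested at `Ns` points, where a high mode coincides with a combination of
modes of order below `Ns`, at a cost growing exponentially with arbitrarily small rate
(`exists_interpolating_modes`). If `Nb` is large this cost is beaten by the decay, and
`exists_truncation` gives a feasible vector very close to the true coefficients. Stable `ℓ¹`
recovery (`sum_norm_sub_le_of_isL1Minimizer`), with windows of fixed radius `R` around the three
centers as the small set, bounds the error of the minimizer by the tails outside the windows. These
are at most `εD` once `R` and `N` are large (`exists_l1_recovery`): the error is small relative to
`D`, not merely to the size of the signal.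

The cutoffs separate the clusters, so `a + ib` is within `εD` of `f₁ exp(i(θ - Θ + Θ(0)))`. After
rotation by the exact phase the error of the argument is an honest arctangent of size `O(εD/μ)`.
Differentiation is harmless because only the modes `|k| ≤ M₀` survive the projection
(`norm_fourierC_deriv_le`). The new error is thus `O(εD)`, and `ε` is chosen to make it at most
`D/2`. Since `θ'` is of order `N`, the full step keeps the phase nondecreasing, so `β = 1`. The
bound on the error is preserved, and induction covers all steps. -/

/-! ### Characters and trigonometric polynomials. -/

theorem e_zero : e 0 = 1 := by simp [e]

theorem e_add (x y : ℝ) : e (x + y) = e x * e y := by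
  rw [e, e, e, ← Complex.exp_add]; congr 1; push_cast; ring

theorem norm_e (x : ℝ) : ‖e x‖ = 1 := by
  have : (2 * Real.pi * x * Complex.I : ℂ) = ((2 * Real.pi * x : ℝ) : ℂ) * Complex.I := by
    push_cast; ring
  rw [e, this, Complex.norm_exp_ofReal_mul_I]

theorem conj_e (x : ℝ) : (starRingEnd ℂ) (e x) = e (-x) := by
  rw [e, e, ← Complex.exp_conj]; congr 1; simp [Complex.conj_ofNat]

theorem e_intCast (n : ℤ) : e n = 1 := by
  rw [e, Complex.exp_eq_one_iff]; exact ⟨n, by push_cast; ring⟩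

theorem e_mul_intCast (n : ℤ) (x : ℝ) : e (n * x) = e x ^ n := by
  rw [e, e, ← Complex.exp_int_mul]; congr 1; push_cast; ring

theorem hasDerivAt_e (x : ℝ) : HasDerivAt e (2 * Real.pi * Complex.I * e x) x := by
  have h : HasDerivAt (fun x : ℝ => (2 * Real.pi * x * Complex.I : ℂ))
      (2 * Real.pi * 1 * Complex.I) x :=
    (((Complex.ofRealCLM.hasDerivAt (x := x))).const_mul _).mul_const _
  refine (h.cexp).congr_deriv ?_
  rw [e]; ring

theorem contDiff_e {n : WithTop ℕ∞} : ContDiff ℝ n e := by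
  unfold e
  exact ((contDiff_const.mul Complex.ofRealCLM.contDiff).mul contDiff_const).cexp

theorem continuous_e : Continuous e := contDiff_e (n := 0).continuous

/-- The trigonometric polynomial `∑_{|k| ≤ M} c_k e(kt)`. -/
def trigPoly (M : ℕ) (c : ℤ → ℂ) (t : ℝ) : ℂ :=
  ∑ k ∈ Finset.Icc (-(M : ℤ)) M, c k * e (k * t)

theorem continuous_trigPoly (M : ℕ) (c : ℤ → ℂ) : Continuous (trigPoly M c) := by
  unfold trigPoly
  exact continuous_finsetSum _ fun k _ =>
    continuous_const.mul (continuous_e.comp (continuous_const.mul continuous_id))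

theorem trigPoly_add_one (M : ℕ) (c : ℤ → ℂ) (t : ℝ) :
    trigPoly M c (t + 1) = trigPoly M c t := by
  unfold trigPoly
  refine Finset.sum_congr rfl fun k _ => ?_
  rw [mul_add, mul_one, e_add, e_intCast, mul_one]

theorem trigPoly_mem_trigSpace (M : ℕ) (c : ℤ → ℂ) : trigPoly M c ∈ trigSpace M := by
  have : trigPoly M c = ∑ k ∈ Finset.Icc (-(M : ℤ)) M, c k • (fun t : ℝ => e (k * t)) := by
    funext t; simp [trigPoly]
  rw [this]
  refine Submodule.sum_mem _ fun k hk => Submodule.smul_mem _ _ (Submodule.subset_span ⟨k, ?_, rfl⟩)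
  rw [Finset.mem_Icc] at hk
  exact abs_le.2 hk

theorem exists_trigPoly_of_mem {M : ℕ} {g : ℝ → ℂ} (hg : g ∈ trigSpace M) :
    ∃ c, g = trigPoly M c := by
  unfold trigSpace at hg
  induction hg using Submodule.span_induction with
  | mem x hx =>
    obtain ⟨k, hk, rfl⟩ := hx
    refine ⟨fun l => if l = k then 1 else 0, ?_⟩
    funext t
    have : k ∈ Finset.Icc (-(M : ℤ)) M := Finset.mem_Icc.2 (abs_le.1 hk)
    simp only [trigPoly, ite_mul, one_mul, zero_mul]
    rw [Finset.sum_ite_eq' _ k, if_pos this]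
  | zero => exact ⟨0, by funext t; simp [trigPoly]⟩
  | add x y _ _ hx hy =>
    obtain ⟨c, rfl⟩ := hx
    obtain ⟨d, rfl⟩ := hy
    exact ⟨c + d, by funext t; simp [trigPoly, add_mul, Finset.sum_add_distrib]⟩
  | smul a x _ hx =>
    obtain ⟨c, rfl⟩ := hx
    exact ⟨a • c, by funext t; simp [trigPoly, Finset.mul_sum, mul_assoc]⟩

theorem integral_e_mul (n : ℤ) : ∫ t in (0 : ℝ)..1, e (n * t) = if n = 0 then 1 else 0 := by
  split_ifs with h
  · simp [h, e_zero]
  · have hc : (2 * Real.pi * Complex.I * n : ℂ) ≠ 0 := by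
      simp [h, Real.pi_ne_zero, Complex.I_ne_zero]
    have hd : ∀ t ∈ uIcc (0 : ℝ) 1,
        HasDerivAt (fun t : ℝ => (2 * Real.pi * Complex.I * n : ℂ)⁻¹ * e (n * t)) (e (n * t)) t := by
      intro t _
      have h1 : HasDerivAt (fun t : ℝ => (n : ℝ) * t) (n * 1) t := (hasDerivAt_id t).const_mul _
      have h2 := ((hasDerivAt_e (n * t)).scomp t h1).const_mul (2 * Real.pi * Complex.I * n : ℂ)⁻¹
      refine h2.congr_deriv ?_
      rw [mul_one, Complex.real_smul]
      push_cast
      field_simp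
    rw [intervalIntegral.integral_eq_sub_of_hasDerivAt hd
      ((continuous_e.comp (continuous_const.mul continuous_id)).intervalIntegrable _ _)]
    have := e_intCast n
    simp [this, e_zero]

theorem fourierC_trigPoly (M : ℕ) (c : ℤ → ℂ) (k : ℤ) :
    fourierC (trigPoly M c) k = if k ∈ Finset.Icc (-(M : ℤ)) M then c k else 0 := by
  rw [fourierC_eq]
  have h1 : ∀ t : ℝ, e (-(k * t)) * trigPoly M c t
      = ∑ l ∈ Finset.Icc (-(M : ℤ)) M, c l * e (((l - k : ℤ) : ℝ) * t) := by
    intro t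
    rw [trigPoly, Finset.mul_sum]
    refine Finset.sum_congr rfl fun l _ => ?_
    rw [mul_left_comm, ← e_add]
    congr 2
    push_cast
    ring
  simp_rw [h1]
  rw [intervalIntegral.integral_finsetSum]
  · simp_rw [intervalIntegral.integral_const_mul, integral_e_mul, sub_eq_zero]
    simp
  · intro l _
    exact (continuous_const.mul
      (continuous_e.comp (continuous_const.mul continuous_id))).intervalIntegrable _ _

theorem fourierNorm_trigPoly (M : ℕ) (c : ℤ → ℂ) :
    fourierNorm (trigPoly M c) = ∑ k ∈ Finset.Icc (-(M : ℤ)) M, ‖c k‖ := by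
  rw [fourierNorm, tsum_eq_sum (s := Finset.Icc (-(M : ℤ)) M)]
  · refine Finset.sum_congr rfl fun k hk => ?_
    rw [fourierC_trigPoly, if_pos hk]
  · intro k hk
    rw [fourierC_trigPoly, if_neg hk, norm_zero]

theorem sum_Icc_neg {α : Type*} [AddCommMonoid α] (M : ℕ) (g : ℤ → α) :
    ∑ k ∈ Finset.Icc (-(M : ℤ)) M, g (-k) = ∑ k ∈ Finset.Icc (-(M : ℤ)) M, g k := by
  refine Finset.sum_bij' (fun k _ => -k) (fun k _ => -k) ?_ ?_ ?_ ?_ ?_ <;>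
    simp [Finset.mem_Icc] <;> omega

/-- The real part of a trigonometric polynomial is a trigonometric polynomial. -/
theorem ofReal_re_trigPoly (M : ℕ) (c : ℤ → ℂ) (t : ℝ) :
    (((trigPoly M c t).re : ℝ) : ℂ)
      = trigPoly M (fun k => (c k + (starRingEnd ℂ) (c (-k))) / 2) t := by
  rw [Complex.re_eq_add_conj]
  have : (starRingEnd ℂ) (trigPoly M c t)
      = trigPoly M (fun k => (starRingEnd ℂ) (c (-k))) t := by
    rw [trigPoly, trigPoly, map_sum, ← sum_Icc_neg]
    refine Finset.sum_congr rfl fun k _ => ?_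
    rw [map_mul, conj_e]
    push_cast
    ring_nf
  rw [this, trigPoly, trigPoly, trigPoly, ← Finset.sum_add_distrib, Finset.sum_div]
  refine Finset.sum_congr rfl fun k _ => ?_
  ring

/-- Taking the real part averages `c k` with the conjugate of `c (-k)`, which does not increase the
`ℓ¹` norm. -/
theorem fourierNorm_re_trigPoly_le (M : ℕ) (c : ℤ → ℂ) :
    fourierNorm (fun t => (((trigPoly M c t).re : ℝ) : ℂ))
      ≤ ∑ k ∈ Finset.Icc (-(M : ℤ)) M, ‖c k‖ := by
  simp_rw [ofReal_re_trigPoly]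
  change fourierNorm (trigPoly M _) ≤ _
  rw [fourierNorm_trigPoly]
  calc _ ≤ ∑ k ∈ Finset.Icc (-(M : ℤ)) M, (‖c k‖ / 2 + ‖c (-k)‖ / 2) := by
        refine Finset.sum_le_sum fun k _ => ?_
        rw [norm_div, Complex.norm_ofNat, ← add_div]
        gcongr
        exact (norm_add_le _ _).trans (by rw [RCLike.norm_conj])
    _ = _ := by
        rw [Finset.sum_add_distrib, sum_Icc_neg M (fun k => ‖c k‖ / 2), ← Finset.sum_add_distrib]
        simp

theorem norm_trigPoly_le (M : ℕ) (c : ℤ → ℂ) (t : ℝ) :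
    ‖trigPoly M c t‖ ≤ ∑ k ∈ Finset.Icc (-(M : ℤ)) M, ‖c k‖ := by
  refine (norm_sum_le _ _).trans (Finset.sum_le_sum fun k _ => ?_)
  rw [norm_mul, norm_e, mul_one]

/-! ### Phase functions with band-limited derivative. -/

theorem IsSparsePhase.exists_coeff {M : ℕ} {θ : ℝ → ℝ} (h : IsSparsePhase M θ) :
    ∃ c, ∀ t, ((deriv θ t : ℝ) : ℂ) = trigPoly M c t := by
  obtain ⟨c, hc⟩ := exists_trigPoly_of_mem h.deriv_mem
  exact ⟨c, fun t => congrFun hc t⟩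

theorem IsSparsePhase.continuous_deriv {M : ℕ} {θ : ℝ → ℝ} (h : IsSparsePhase M θ) :
    Continuous (deriv θ) := by
  obtain ⟨c, hc⟩ := h.exists_coeff
  have : deriv θ = fun t => (trigPoly M c t).re := by
    funext t; rw [← hc, Complex.ofReal_re]
  rw [this]
  exact Complex.continuous_re.comp (continuous_trigPoly M c)

theorem IsSparsePhase.contDiff {M : ℕ} {θ : ℝ → ℝ} (h : IsSparsePhase M θ) : ContDiff ℝ 1 θ :=
  contDiff_one_iff_deriv.2 ⟨h.differentiable, h.continuous_deriv⟩

theorem IsSparsePhase.deriv_add_one {M : ℕ} {θ : ℝ → ℝ} (h : IsSparsePhase M θ) (t : ℝ) :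
    deriv θ (t + 1) = deriv θ t := by
  obtain ⟨c, hc⟩ := h.exists_coeff
  have := hc (t + 1)
  rw [trigPoly_add_one, ← hc] at this
  exact_mod_cast this

theorem IsSparsePhase.add_one {M : ℕ} {θ : ℝ → ℝ} (h : IsSparsePhase M θ) (t : ℝ) :
    θ (t + 1) = θ t + (θ 1 - θ 0) := by
  have hd : Differentiable ℝ (fun s => θ (s + 1) - θ s) :=
    (h.differentiable.comp (differentiable_id.add_const 1)).sub h.differentiable
  have hz : ∀ s, deriv (fun s => θ (s + 1) - θ s) s = 0 := by
    intro s
    have h1 : HasDerivAt (fun s => θ (s + 1)) (deriv θ (s + 1)) s :=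
      (h.differentiable (s + 1)).hasDerivAt.comp_add_const s 1
    have h2 : HasDerivAt (fun s => θ (s + 1) - θ s) _ s := h1.sub (h.differentiable s).hasDerivAt
    rw [h2.deriv, h.deriv_add_one, sub_self]
  have := is_const_of_deriv_eq_zero hd hz t 0
  simp only [zero_add] at this
  linarith

theorem IsSparsePhase.sub {M : ℕ} {θ₁ θ₂ : ℝ → ℝ} (h₁ : IsSparsePhase M θ₁)
    (h₂ : IsSparsePhase M θ₂) : IsSparsePhase M (fun t => θ₁ t - θ₂ t) := by
  refine ⟨h₁.differentiable.sub h₂.differentiable, ?_⟩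
  have : cderiv (fun t => θ₁ t - θ₂ t) = cderiv θ₁ - cderiv θ₂ := by
    funext t
    have := ((h₁.differentiable t).hasDerivAt.sub (h₂.differentiable t).hasDerivAt).deriv
    simp only [cderiv, Pi.sub_apply]
    rw [← Complex.ofReal_sub, ← this]
    rfl
  rw [this]
  exact Submodule.sub_mem _ h₁.deriv_mem h₂.deriv_mem

/-! ### Restricted isometry and stable `ℓ¹` recovery. -/

section CompressedSensing

/-- A set contains a subset of given cardinality carrying the largest values. -/
theorem exists_top_subset {κ : Type*} [DecidableEq κ] (u : κ → ℝ) (M : ℕ) (U : Finset κ) (hU : M ≤ U.card) :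
    ∃ T ⊆ U, T.card = M ∧ ∀ k ∈ T, ∀ l ∈ U \ T, u l ≤ u k := by
  induction M with
  | zero => exact ⟨∅, by simp, by simp, by simp⟩
  | succ M ih =>
    obtain ⟨T, hTU, hT, htop⟩ := ih (by omega)
    have hne : (U \ T).Nonempty := by
      rw [← Finset.card_pos, Finset.card_sdiff_of_subset hTU]; omega
    obtain ⟨m, hm, hmax⟩ := Finset.exists_max_image (U \ T) u hne
    rw [Finset.mem_sdiff] at hm
    refine ⟨insert m T, Finset.insert_subset hm.1 hTU, by rw [Finset.card_insert_of_notMem hm.2, hT],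
      ?_⟩
    intro k hk l hl
    simp only [Finset.mem_sdiff, Finset.mem_insert, not_or] at hl
    have hl' : l ∈ U \ T := Finset.mem_sdiff.2 ⟨hl.1, hl.2.2⟩
    rcases Finset.mem_insert.1 hk with rfl | hk
    · exact hmax l hl'
    · exact htop k hk l hl'

variable {ι κ : Type*} [Fintype ι] [Fintype κ]

/-- The defining set of the restricted isometry constant is nonempty. -/
theorem exists_isometry_bound (A : Matrix ι κ ℂ) :
    ∃ δ : ℝ, 0 ≤ δ ∧ ∀ c : κ → ℂ, (1 - δ) * ∑ k, ‖c k‖ ^ 2 ≤ ∑ j, ‖A.mulVec c j‖ ^ 2 ∧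
      ∑ j, ‖A.mulVec c j‖ ^ 2 ≤ (1 + δ) * ∑ k, ‖c k‖ ^ 2 := by
  have hK : 0 ≤ ∑ j, ∑ k, ‖A j k‖ ^ 2 := by positivity
  refine ⟨1 + ∑ j, ∑ k, ‖A j k‖ ^ 2, by linarith, fun c => ⟨?_, ?_⟩⟩
  · have h1 : 0 ≤ ∑ k, ‖c k‖ ^ 2 := by positivity
    have h2 : 0 ≤ ∑ j, ‖A.mulVec c j‖ ^ 2 := by positivity
    nlinarith
  · have h1 : 0 ≤ ∑ k, ‖c k‖ ^ 2 := by positivity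
    have : ∑ j, ‖A.mulVec c j‖ ^ 2 ≤ ∑ j, (∑ k, ‖A j k‖ ^ 2) * ∑ k, ‖c k‖ ^ 2 := by
      refine Finset.sum_le_sum fun j _ => ?_
      calc ‖A.mulVec c j‖ ^ 2 ≤ (∑ k, ‖A j k‖ * ‖c k‖) ^ 2 := by
            gcongr
            exact (norm_sum_le _ _).trans (Finset.sum_le_sum fun k _ => (norm_mul_le _ _))
        _ ≤ _ := Finset.sum_mul_sq_le_sq_mul_sq _ _ _
    rw [← Finset.sum_mul] at this
    nlinarith

theorem ric_nonneg (A : Matrix ι κ ℂ) (S : ℕ) : 0 ≤ ric A S :=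
  Real.sInf_nonneg fun _ h => h.1

variable [DecidableEq κ]

/-- The restriction of a coefficient sequence to a set of indices. -/
def restrict (U : Finset κ) (h : κ → ℂ) (k : κ) : ℂ := if k ∈ U then h k else 0

/-- The Euclidean norm of `A h_U`. -/
def imageNorm (A : Matrix ι κ ℂ) (h : κ → ℂ) (U : Finset κ) : ℝ :=
  ‖WithLp.toLp 2 (A.mulVec (restrict U h))‖

theorem imageNorm_sq (A : Matrix ι κ ℂ) (h : κ → ℂ) (U : Finset κ) :
    imageNorm A h U ^ 2 = ∑ j, ‖A.mulVec (restrict U h) j‖ ^ 2 := by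
  rw [imageNorm, EuclideanSpace.norm_sq_eq]

theorem imageNorm_union_le (A : Matrix ι κ ℂ) (h : κ → ℂ) {U V : Finset κ} (hUV : Disjoint U V) :
    imageNorm A h (U ∪ V) ≤ imageNorm A h U + imageNorm A h V := by
  have : restrict (U ∪ V) h = restrict U h + restrict V h := by
    funext k
    have hk : k ∈ U → k ∉ V := fun h => Finset.disjoint_left.1 hUV h
    simp only [restrict, Finset.mem_union, Pi.add_apply]
    split_ifs <;> simp_all
  rw [imageNorm, this, Matrix.mulVec_add, WithLp.toLp_add]
  exact norm_add_le _ _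

theorem sum_restrict_sq (h : κ → ℂ) (U : Finset κ) :
    ∑ k, ‖restrict U h k‖ ^ 2 = ∑ k ∈ U, ‖h k‖ ^ 2 := by
  rw [← Finset.sum_subset (Finset.subset_univ U)]
  · exact Finset.sum_congr rfl fun k hk => by simp [restrict, hk]
  · intro k _ hk; simp [restrict, hk]

theorem exists_isometry_of_ric_lt (A : Matrix ι κ ℂ) (S : ℕ) {r : ℝ} (hr : ric A S < r) :
    ∀ (T : Finset κ) (h : κ → ℂ), T.card ≤ S →
      (1 - r) * ∑ k ∈ T, ‖h k‖ ^ 2 ≤ imageNorm A h T ^ 2 ∧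
      imageNorm A h T ^ 2 ≤ (1 + r) * ∑ k ∈ T, ‖h k‖ ^ 2 := by
  obtain ⟨δ₀, h0, hδ₀⟩ := exists_isometry_bound A
  rw [ric] at hr
  obtain ⟨δ, ⟨_, hδ⟩, hlt⟩ := exists_lt_of_csInf_lt (by exact ⟨δ₀, h0, fun _ c _ _ => hδ₀ c⟩) hr
  intro T h hT
  have := hδ T (restrict T h) hT (fun k hk => by simp [restrict, hk])
  rw [sum_restrict_sq, ← imageNorm_sq] at this
  have hp : 0 ≤ ∑ k ∈ T, ‖h k‖ ^ 2 := by positivity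
  constructor <;> nlinarith [this.1, this.2]

/-- Splitting off the largest entries, the image of the rest is controlled by the `ℓ¹` norm. -/
theorem exists_shelling (A : Matrix ι κ ℂ) (h : κ → ℂ) (M : ℕ) (hM : 0 < M) {r : ℝ} (hr : 0 ≤ r)
    (hA : ∀ T : Finset κ, T.card ≤ M → imageNorm A h T ^ 2 ≤ r ^ 2 * ∑ k ∈ T, ‖h k‖ ^ 2)
    (U : Finset κ) :
    ∃ T ⊆ U, T.card ≤ M ∧ imageNorm A h (U \ T) ≤ r * (∑ k ∈ U, ‖h k‖) / √M := by
  induction U using Finset.strongInduction with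
  | H U ih =>
    by_cases hU : U.card ≤ M
    · refine ⟨U, subset_rfl, hU, ?_⟩
      have : imageNorm A h (U \ U) = 0 := by
        have : restrict (∅ : Finset κ) h = 0 := by funext k; simp [restrict]
        simp [imageNorm, this]
      rw [this]
      positivity
    · push Not at hU
      obtain ⟨T, hTU, hT, htop⟩ := exists_top_subset (fun k => ‖h k‖) M U hU.le
      have hlt : U \ T ⊂ U := by
        refine Finset.sdiff_ssubset hTU ?_
        rw [← Finset.card_pos]; omega
      -- `T'` is the next block. Each of its entries is at most the average over the full block `T`,
      -- so the Euclidean norm on `T'` is at most the `ℓ¹` norm on `T` divided by `√M`; summing over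
      -- blocks telescopes to the `ℓ¹` norm on `U`.
      obtain ⟨T', hT'U, hT', hle⟩ := ih _ hlt
      refine ⟨T, hTU, hT.le, ?_⟩
      have hMr : (0 : ℝ) < M := by exact_mod_cast hM
      have hs : 0 < √(M : ℝ) := Real.sqrt_pos.2 hMr
      have hsum : ∑ k ∈ U, ‖h k‖ = ∑ k ∈ U \ T, ‖h k‖ + ∑ k ∈ T, ‖h k‖ :=
        (Finset.sum_sdiff hTU).symm
      have h1 : imageNorm A h T' ≤ r * (∑ k ∈ T, ‖h k‖) / √M := by
        have hP : 0 ≤ ∑ k ∈ T, ‖h k‖ := by positivity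
        have hbd : ∀ l ∈ T', ‖h l‖ ≤ (∑ k ∈ T, ‖h k‖) / M := by
          intro l hl
          rw [le_div_iff₀ hMr]
          have := Finset.card_nsmul_le_sum T (fun k => ‖h k‖) ‖h l‖
            (fun k hk => htop k hk l (hT'U hl))
          rw [hT, nsmul_eq_mul] at this
          linarith
        refine abs_le_of_sq_le_sq' ?_ (by positivity) |>.2
        refine (hA T' hT').trans ?_
        rw [div_pow, mul_pow, Real.sq_sqrt hMr.le, mul_div_assoc]
        gcongr
        calc ∑ k ∈ T', ‖h k‖ ^ 2 ≤ ∑ k ∈ T', ((∑ k ∈ T, ‖h k‖) / M) ^ 2 :=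
              Finset.sum_le_sum fun l hl => by gcongr; exact hbd l hl
          _ = T'.card * ((∑ k ∈ T, ‖h k‖) / M) ^ 2 := by rw [Finset.sum_const, nsmul_eq_mul]
          _ ≤ M * ((∑ k ∈ T, ‖h k‖) / M) ^ 2 := by gcongr
          _ = _ := by field_simp
      have h2 : imageNorm A h (U \ T) ≤ imageNorm A h T' + imageNorm A h ((U \ T) \ T') := by
        conv_lhs => rw [← Finset.union_sdiff_of_subset hT'U]
        exact imageNorm_union_le A h Finset.disjoint_sdiff
      calc _ ≤ _ := h2
        _ ≤ r * (∑ k ∈ T, ‖h k‖) / √M + r * (∑ k ∈ U \ T, ‖h k‖) / √M := add_le_add h1 hle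
        _ = _ := by rw [hsum]; ring

/-- Stable `ℓ¹` recovery: the distance from a minimizer to any feasible point is controlled by
the part of the latter outside a small set of indices. -/
theorem sum_norm_sub_le_of_isL1Minimizer (A : Matrix ι κ ℂ) (y : ι → ℂ) {S : ℕ} (hS : 0 < S)
    (hric : ric A (3 * S) + 3 * ric A (4 * S) < 2) {x x' : κ → ℂ} (hx : IsL1Minimizer A y x)
    (hx' : A.mulVec x' = y) (T : Finset κ) (hT : 10 * T.card ≤ S) :
    ∑ k, ‖x k - x' k‖ ≤ 6 * ∑ k ∈ Tᶜ, ‖x' k‖ := by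
  have hr : ric A (4 * S) < 2 / 3 := by have := ric_nonneg A (3 * S); linarith
  have hiso := exists_isometry_of_ric_lt A (4 * S) hr
  set h : κ → ℂ := fun k => x k - x' k with hh
  -- The value `4/3` is admissible since `1 + 2/3 ≤ (4/3)²`.
  obtain ⟨T₁, hT₁, hcard, hle⟩ := exists_shelling A h (3 * S) (by omega) (r := 4 / 3) (by norm_num)
    (fun U hU => by
      have := (hiso U h (by omega)).2
      have hp : 0 ≤ ∑ k ∈ U, ‖h k‖ ^ 2 := by positivity
      nlinarith) Tᶜ
  have hdisj : Disjoint T T₁ := Finset.disjoint_left.2 fun k hk hk1 =>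
    (Finset.mem_compl.1 (hT₁ hk1)) hk
  -- Both vectors are feasible, so `A h = 0` and the images of the two complementary parts cancel.
  have hzero : imageNorm A h (T ∪ T₁) = imageNorm A h (Tᶜ \ T₁) := by
    have hu : restrict (T ∪ T₁) h = h - restrict (Tᶜ \ T₁) h := by
      funext k
      simp only [restrict, Finset.mem_union, Finset.mem_sdiff, Finset.mem_compl, Pi.sub_apply]
      by_cases hk : k ∈ T <;> by_cases hk1 : k ∈ T₁ <;> simp [hk, hk1]
    have hAh : A.mulVec h = 0 := by
      have : h = x - x' := rfl
      rw [this, Matrix.mulVec_sub, hx.1, hx', sub_self]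
    rw [imageNorm, imageNorm, hu, Matrix.mulVec_sub, hAh, zero_sub, WithLp.toLp_neg, norm_neg]
  set P := ∑ k ∈ Tᶜ, ‖h k‖ with hP
  set Q := ∑ k ∈ T, ‖h k‖ with hQ
  have hP0 : 0 ≤ P := by positivity
  have hQ0 : 0 ≤ Q := by positivity
  have hSr : (0 : ℝ) < S := by exact_mod_cast hS
  have hQP : Q ≤ P / 2 := by
    refine abs_le_of_sq_le_sq' ?_ (by positivity) |>.2
    have h1 : Q ^ 2 ≤ T.card * ∑ k ∈ T, ‖h k‖ ^ 2 := sq_sum_le_card_mul_sum_sq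
    have h2 : ∑ k ∈ T, ‖h k‖ ^ 2 ≤ ∑ k ∈ T ∪ T₁, ‖h k‖ ^ 2 :=
      Finset.sum_le_sum_of_subset_of_nonneg Finset.subset_union_left fun _ _ _ => by positivity
    have h3 := (hiso (T ∪ T₁) h ((Finset.card_union_le _ _).trans (by omega))).1
    rw [hzero] at h3
    have h4 : imageNorm A h (Tᶜ \ T₁) ^ 2 ≤ (4 / 3 * P / √((3 * S : ℕ) : ℝ)) ^ 2 := by
      gcongr
      exact norm_nonneg _
    rw [div_pow, Real.sq_sqrt (by positivity), le_div_iff₀ (by positivity)] at h4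
    push_cast at h4
    have h5 : (10 * T.card : ℝ) ≤ S := by exact_mod_cast hT
    have h6 : ∑ k ∈ T, ‖h k‖ ^ 2 ≤ 3 * imageNorm A h (Tᶜ \ T₁) ^ 2 := by linarith
    have h7 : Q ^ 2 ≤ T.card * (3 * imageNorm A h (Tᶜ \ T₁) ^ 2) := h1.trans (by gcongr)
    -- In total `Q² ≤ (16/9)(|T|/S) P² ≤ (16/90) P²`, which is less than `P²/4`; this is where
    -- `10|T| ≤ S` enters.
    nlinarith [sq_nonneg (imageNorm A h (Tᶜ \ T₁)), sq_nonneg P]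
  -- Minimality forces the mass of `h` off `T` to be paid for by its mass on `T` and by the tail of
  -- `x'`. Combined with `Q ≤ P/2`, this gives `P ≤ 4·tail` and `Q ≤ 2·tail`, hence the factor 6.
  have hcone : P ≤ Q + 2 * ∑ k ∈ Tᶜ, ‖x' k‖ := by
    have h1 := hx.2 x' hx'
    rw [← Finset.sum_add_sum_compl T, ← Finset.sum_add_sum_compl T (fun k => ‖x' k‖)] at h1
    have h2 : ∑ k ∈ T, ‖x' k‖ ≤ ∑ k ∈ T, ‖x k‖ + Q := by
      rw [hQ, ← Finset.sum_add_distrib]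
      refine Finset.sum_le_sum fun k _ => ?_
      have := norm_sub_norm_le (x' k) (x k)
      rw [norm_sub_rev] at this
      simp only [hh]; linarith
    have h3 : P ≤ ∑ k ∈ Tᶜ, ‖x k‖ + ∑ k ∈ Tᶜ, ‖x' k‖ := by
      rw [hP, ← Finset.sum_add_distrib]
      exact Finset.sum_le_sum fun k _ => norm_sub_le _ _
    linarith
  have : ∑ k, ‖x k - x' k‖ = Q + P := (Finset.sum_add_sum_compl T _).symm
  rw [this]
  linarith

end CompressedSensing

/-! ### Interpolation of powers on the unit circle. -/

open Polynomial in
/-- At `n` points of the unit circle, `z ^ k` agrees with a polynomial of degree less than `n`,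
with an explicit bound for its coefficients. -/
theorem exists_interpolating_polynomial (z : ℕ → ℂ) (hz : ∀ j, ‖z j‖ = 1) {τ : ℝ} (hτ : 0 < τ)
    (hτ1 : τ ≤ 1) (n : ℕ) :
    ∀ k : ℕ, ∃ p : ℂ[X], (∀ i, n ≤ i → p.coeff i = 0) ∧ (∀ j < n, p.eval (z j) = z j ^ k) ∧
      ∑ i ∈ Finset.range n, ‖p.coeff i‖ ≤ τ⁻¹ ^ n * (1 + 2 * τ) ^ k := by
  induction n with
  | zero => exact fun k => ⟨0, by simp, by simp, by simp; positivity⟩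
  | succ n ih =>
    intro k
    choose p hp hev hb using ih
    set a := z n with ha
    -- From `z^k = a^k + (z - a) ∑ z^m a^{k-1-m}`: the factor `z - a` vanishes at the new point, so
    -- each `z^m` need only be correct at the old points and may be replaced by its interpolant. The
    -- points need not be distinct.
    set q : ℂ[X] := ∑ m ∈ Finset.range k, C (a ^ (k - 1 - m)) * p m with hq
    have hqc : ∀ i, n ≤ i → q.coeff i = 0 := by
      intro i hi
      rw [hq, finsetSum_coeff]
      exact Finset.sum_eq_zero fun m _ => by rw [coeff_C_mul, hp m i hi, mul_zero]
    have hqb : ∑ i ∈ Finset.range n, ‖q.coeff i‖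
        ≤ ∑ m ∈ Finset.range k, τ⁻¹ ^ n * (1 + 2 * τ) ^ m := by
      calc ∑ i ∈ Finset.range n, ‖q.coeff i‖
          ≤ ∑ i ∈ Finset.range n, ∑ m ∈ Finset.range k, ‖(p m).coeff i‖ := by
            refine Finset.sum_le_sum fun i _ => ?_
            rw [hq, finsetSum_coeff]
            refine (norm_sum_le _ _).trans (Finset.sum_le_sum fun m _ => ?_)
            rw [coeff_C_mul, norm_mul, norm_pow, hz, one_pow, one_mul]
        _ ≤ _ := by
            rw [Finset.sum_comm]
            exact Finset.sum_le_sum fun m _ => hb m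
    have hgeom : 2 * τ * ∑ m ∈ Finset.range k, (1 + 2 * τ) ^ m = (1 + 2 * τ) ^ k - 1 := by
      have := mul_geom_sum (1 + 2 * τ) k
      rw [add_sub_cancel_left] at this
      exact this
    refine ⟨C (a ^ k) + (X - C a) * q, ?_, ?_, ?_⟩
    · intro i hi
      obtain ⟨i, rfl⟩ : ∃ i', i = i' + 1 := ⟨i - 1, by omega⟩
      rw [coeff_add, coeff_C_succ, sub_mul, coeff_sub, coeff_X_mul, coeff_C_mul,
        hqc i (by omega), hqc (i + 1) (by omega), mul_zero, sub_zero, add_zero]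
    · intro j hj
      rcases Nat.lt_succ_iff_lt_or_eq.1 hj with hj | rfl
      · have : q.eval (z j) = ∑ m ∈ Finset.range k, z j ^ m * a ^ (k - 1 - m) := by
          rw [hq, eval_finsetSum]
          exact Finset.sum_congr rfl fun m _ => by rw [eval_mul, eval_C, hev m j hj, mul_comm]
        have hg := (Commute.all (z j) a).geom_sum₂_mul k
        simp only [eval_add, eval_C, eval_mul, eval_sub, eval_X, this]
        rw [mul_comm, hg]; ring
      · simp [ha]
    · have hc : ∀ i, ‖(C (a ^ k) + (X - C a) * q).coeff i‖
          ≤ (if i = 0 then 1 else ‖q.coeff (i - 1)‖) + ‖q.coeff i‖ := by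
        intro i
        rcases i with _ | i
        · simp only [sub_mul, coeff_add, coeff_sub, coeff_C_mul, coeff_C_zero, coeff_X_mul_zero,
            if_true, zero_sub]
          refine (norm_add_le _ _).trans ?_
          rw [norm_neg, norm_mul, norm_pow, hz, one_pow, one_mul]
        · simp only [sub_mul, coeff_add, coeff_sub, coeff_C_mul, coeff_C_succ, coeff_X_mul,
            zero_add, Nat.succ_ne_zero, if_false, Nat.add_sub_cancel]
          refine (norm_sub_le _ _).trans ?_
          rw [norm_mul, hz, one_mul]
      calc _ ≤ ∑ i ∈ Finset.range (n + 1),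
              ((if i = 0 then 1 else ‖q.coeff (i - 1)‖) + ‖q.coeff i‖) :=
            Finset.sum_le_sum fun i _ => hc i
        _ = 1 + 2 * ∑ i ∈ Finset.range n, ‖q.coeff i‖ := by
            rw [Finset.sum_add_distrib, Finset.sum_range_succ', Finset.sum_range_succ _ n,
              hqc n le_rfl]
            simp; ring
        _ ≤ 1 + 2 * ∑ m ∈ Finset.range k, τ⁻¹ ^ n * (1 + 2 * τ) ^ m := by gcongr
        _ = 1 + τ⁻¹ ^ (n + 1) * ((1 + 2 * τ) ^ k - 1) := by
            rw [← hgeom, ← Finset.mul_sum, pow_succ]; field_simp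
        _ ≤ τ⁻¹ ^ (n + 1) * (1 + 2 * τ) ^ k := by
            have : 1 ≤ τ⁻¹ ^ (n + 1) := one_le_pow₀ ((one_le_inv₀ hτ).2 hτ1)
            linarith

/-! ### Fourier series in a phase coordinate. -/

/-- `∫₀¹ g e(-lψ) dψ`, the Fourier coefficient of `g` in the coordinate `ψ`. -/
def coordCoeff (ψ : ℝ → ℝ) (g : ℝ → ℂ) (l : ℤ) : ℂ :=
  ∫ t in (0 : ℝ)..1, g t * e (-(l * ψ t)) * ((deriv ψ t : ℝ) : ℂ)

theorem surjective_of_add_one {ψ : ℝ → ℝ} (hψ : Continuous ψ) (h0 : ψ 0 = 0)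
    (hper : ∀ t, ψ (t + 1) = ψ t + 1) : Function.Surjective ψ := by
  have hnat : ∀ n : ℕ, ψ n = n ∧ ψ (-n) = -n := by
    intro n
    induction n with
    | zero => simp [h0]
    | succ n ih =>
      have h1 := hper n
      have h2 := hper (-(n + 1))
      rw [show (-((n : ℝ) + 1) + 1) = -n by ring] at h2
      push_cast
      constructor <;> linarith [ih.1, ih.2]
  intro y
  obtain ⟨n, hn⟩ := exists_nat_ge |y|
  have hy := abs_le.1 hn
  have hsub := intermediate_value_Icc (a := -(n : ℝ)) (b := n)
    (by have : (0 : ℝ) ≤ n := n.cast_nonneg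
        linarith) hψ.continuousOn
  rw [(hnat n).1, (hnat n).2] at hsub
  obtain ⟨t, _, ht⟩ := hsub hy
  exact ⟨t, ht⟩

/-- A continuous periodic function with summable Fourier coefficients in the coordinate `ψ` is
the sum of its Fourier series in that coordinate. -/
theorem hasSum_coordCoeff {ψ : ℝ → ℝ} (hψ : ContDiff ℝ 1 ψ) (hpos : ∀ t, 0 < deriv ψ t)
    (h0 : ψ 0 = 0) (hper : ∀ t, ψ (t + 1) = ψ t + 1) {g : ℝ → ℂ} (hg : Continuous g)
    (gper : Function.Periodic g 1) (hs : Summable (coordCoeff ψ g)) (t : ℝ) :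
    HasSum (fun l : ℤ => coordCoeff ψ g l * e (l * ψ t)) (g t) := by
  have hd := (contDiff_one_iff_deriv.1 hψ).1
  have hd' := (contDiff_one_iff_deriv.1 hψ).2
  have hmono : StrictMono ψ := strictMono_of_deriv_pos hpos
  let Ψ : ℝ ≃o ℝ := hmono.orderIsoOfSurjective ψ (surjective_of_add_one hψ.continuous h0 hper)
  have hΨ : ∀ t, Ψ t = ψ t := fun t => rfl
  have hinv : ∀ s, Ψ.symm (s + 1) = Ψ.symm s + 1 := by
    intro s
    rw [OrderIso.symm_apply_eq, hΨ, hper, ← hΨ, OrderIso.apply_symm_apply]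
  have hGper : Function.Periodic (fun s => g (Ψ.symm s)) 1 := by
    intro s
    change g (Ψ.symm (s + 1)) = g (Ψ.symm s)
    rw [hinv, gper]
  have hGc : Continuous fun s => g (Ψ.symm s) := hg.comp Ψ.symm.continuous
  -- In the coordinate `s = ψ(t)` the function descends to the circle; the substitution identifies
  -- its ordinary Fourier coefficients with `coordCoeff`.
  let G : C(AddCircle (1 : ℝ), ℂ) := ⟨hGper.lift, continuous_coinduced_dom.2 hGc⟩
  have hcoeff : ∀ l : ℤ, fourierCoeff (G : AddCircle (1 : ℝ) → ℂ) l = coordCoeff ψ g l := by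
    intro l
    rw [fourierCoeff_eq_intervalIntegral _ _ 0, coordCoeff]
    have hcv := intervalIntegral.integral_deriv_smul_comp (a := 0) (b := 1) (f := ψ)
      (f' := deriv ψ) (g := fun s => g (Ψ.symm s) * e (-(l * s)))
      (fun x _ => (hd x).hasDerivAt) hd'.continuousOn
      (hGc.mul (continuous_e.comp (continuous_const.mul continuous_id).neg))
    have h1 : ψ 1 = 1 := by have := hper 0; rw [zero_add, h0, zero_add] at this; exact this
    rw [h0, h1] at hcv
    rw [zero_add, div_one, one_smul]
    calc _ = ∫ s in (0 : ℝ)..1, g (Ψ.symm s) * e (-(l * s)) := by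
          refine intervalIntegral.integral_congr fun s _ => ?_
          change fourier (-l) (s : AddCircle (1 : ℝ)) • g (Ψ.symm s) = _
          rw [fourier_coe_apply, smul_eq_mul, mul_comm, e]
          congr 2
          push_cast
          ring
      _ = _ := hcv.symm
      _ = _ := by
          refine intervalIntegral.integral_congr fun s _ => ?_
          have : Ψ.symm (ψ s) = s := by rw [← hΨ, OrderIso.symm_apply_apply]
          simp only [Function.comp_apply, Complex.real_smul, this]
          ring
  have hsum := has_pointwise_sum_fourier_series_of_summable (f := G)
    (by rw [show fourierCoeff (G : AddCircle (1 : ℝ) → ℂ) = coordCoeff ψ g from funext hcoeff]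
        exact hs) (ψ t : AddCircle (1 : ℝ))
  have hGt : G (ψ t : AddCircle (1 : ℝ)) = g t := by
    change g (Ψ.symm (ψ t)) = g t
    rw [← hΨ, OrderIso.symm_apply_apply]
  rw [hGt] at hsum
  convert hsum using 2 with l
  rw [hcoeff, fourier_coe_apply, smul_eq_mul, e]
  congr 2
  push_cast
  ring

/-! ### Exponential decay of coefficients by contour shift. -/

/-- Cauchy's theorem on a rectangle of width one: the integrals over the vertical sides cancel by
periodicity. -/
theorem integral_shift_of_periodic {F : ℂ → ℂ} (hF : Differentiable ℂ F)
    (hper : ∀ z, F (z + 1) = F z) (σ : ℝ) :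
    ∫ t in (0 : ℝ)..1, F t = ∫ t in (0 : ℝ)..1, F (t + σ * Complex.I) := by
  have h := Complex.integral_boundary_rect_eq_zero_of_differentiableOn F 0 (1 + σ * Complex.I)
    hF.differentiableOn
  have hp : ∀ y : ℝ, F (1 + y * Complex.I) = F (y * Complex.I) := fun y => by
    rw [add_comm, hper]
  simp [hp] at h
  exact sub_eq_zero.1 h

/-- Exponential decay of Fourier coefficients, by moving the contour of integration. -/
theorem norm_integral_le_exp {Ψ H : ℂ → ℂ} (hΨ : Differentiable ℂ Ψ) (hH : Differentiable ℂ H)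
    (hΨp : ∀ z, Ψ (z + 1) = Ψ z + 1) (hHp : ∀ z, H (z + 1) = H z) {σ ρ K : ℝ}
    (hup : ∀ t ∈ Icc (0 : ℝ) 1, ρ ≤ (Ψ (t + (σ : ℝ) * Complex.I)).im)
    (hdown : ∀ t ∈ Icc (0 : ℝ) 1, (Ψ (t + ((-σ : ℝ) : ℂ) * Complex.I)).im ≤ -ρ)
    (hK : ∀ s : ℝ, (s = σ ∨ s = -σ) → ∀ t ∈ Icc (0 : ℝ) 1,
      ‖H (t + s * Complex.I) * deriv Ψ (t + s * Complex.I)‖ ≤ K) (l : ℤ) :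
    ‖∫ t in (0 : ℝ)..1, H t * Complex.exp (-(2 * Real.pi * Complex.I * l * Ψ t)) * deriv Ψ t‖
      ≤ K * Real.exp (-(2 * Real.pi * ρ) * |(l : ℝ)|) := by
  have hΨ' : Differentiable ℂ (deriv Ψ) :=
    fun z => (hΨ.analyticAt z).deriv.differentiableAt
  have hΨ'p : ∀ z, deriv Ψ (z + 1) = deriv Ψ z := by
    intro z
    have h1 : deriv (fun z => Ψ (z + 1)) z = deriv Ψ (z + 1) := deriv_comp_add_const _ _ _
    rw [← h1, show (fun z => Ψ (z + 1)) = fun z => Ψ z + 1 from funext hΨp, deriv_add_const]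
  set F : ℂ → ℂ := fun z =>
    H z * Complex.exp (-(2 * Real.pi * Complex.I * l * Ψ z)) * deriv Ψ z with hF
  have hFd : Differentiable ℂ F := (hH.mul ((hΨ.const_mul _).neg.cexp)).mul hΨ'
  have hFp : ∀ z, F (z + 1) = F z := by
    intro z
    have : Complex.exp (-(2 * Real.pi * Complex.I * l * (Ψ z + 1)))
        = Complex.exp (-(2 * Real.pi * Complex.I * l * Ψ z)) := by
      rw [Complex.exp_eq_exp_iff_exists_int]
      exact ⟨-l, by push_cast; ring⟩
    simp only [hF, hHp, hΨp, hΨ'p, this]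
  have hnorm : ∀ z, ‖Complex.exp (-(2 * Real.pi * Complex.I * l * Ψ z))‖
      = Real.exp (2 * Real.pi * l * (Ψ z).im) := by
    intro z
    rw [Complex.norm_exp]
    congr 1
    have : -(2 * Real.pi * Complex.I * l * Ψ z)
        = (((2 * Real.pi * l : ℝ) : ℂ)) * (-Complex.I * Ψ z) := by push_cast; ring
    rw [this, Complex.re_ofReal_mul]
    simp
  have key : ∀ s : ℝ, (s = σ ∨ s = -σ) →
      (∀ t ∈ Icc (0 : ℝ) 1, l * (Ψ (t + s * Complex.I)).im ≤ -(ρ * |(l : ℝ)|)) →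
      ‖∫ t in (0 : ℝ)..1, F t‖ ≤ K * Real.exp (-(2 * Real.pi * ρ) * |(l : ℝ)|) := by
    intro s hs hl
    rw [integral_shift_of_periodic hFd hFp s]
    have := intervalIntegral.norm_integral_le_of_norm_le_const (a := 0) (b := 1)
      (f := fun t : ℝ => F (t + s * Complex.I))
      (C := K * Real.exp (-(2 * Real.pi * ρ) * |(l : ℝ)|)) ?_
    · simpa using this
    · intro t ht
      rw [uIoc_of_le zero_le_one] at ht
      have ht' : t ∈ Icc (0 : ℝ) 1 := ⟨ht.1.le, ht.2⟩
      have h1 := hK s hs t ht'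
      rw [hF]
      simp only
      rw [mul_right_comm, norm_mul, hnorm]
      refine mul_le_mul h1 ?_ (Real.exp_pos _).le ((norm_nonneg _).trans h1)
      refine Real.exp_le_exp.2 ?_
      have := mul_le_mul_of_nonneg_left (hl t ht') Real.two_pi_pos.le
      linarith
  rcases le_total 0 l with h0 | h0
  -- The kernel has modulus `exp(2π l Im Ψ)`, so the contour moves down for `l ≥ 0` and up for `l ≤
  -- 0`.
  · refine key (-σ) (Or.inr rfl) fun t ht => ?_
    have h0' : (0 : ℝ) ≤ l := by exact_mod_cast h0
    rw [abs_of_nonneg h0']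
    nlinarith [hdown t ht]
  · refine key σ (Or.inl rfl) fun t ht => ?_
    have h0' : (l : ℝ) ≤ 0 := by exact_mod_cast h0
    rw [abs_of_nonpos h0']
    nlinarith [hup t ht]

/-! ### Entire primitives of trigonometric polynomials. -/

theorem norm_exp_sub_one_le (x : ℂ) : ‖Complex.exp x - 1‖ ≤ ‖x‖ * Real.exp ‖x‖ := by
  simpa using Complex.norm_exp_sub_sum_le_norm_mul_exp x 1

/-- The primitive of `e(kz)` vanishing at the origin. -/
def prim (k : ℤ) (z : ℂ) : ℂ :=
  if k = 0 then z else
    (Complex.exp (2 * Real.pi * Complex.I * k * z) - 1) / (2 * Real.pi * Complex.I * k)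

theorem two_pi_I_mul_ne_zero {k : ℤ} (hk : k ≠ 0) : (2 * Real.pi * Complex.I * k : ℂ) ≠ 0 := by
  simp [hk, Real.pi_ne_zero, Complex.I_ne_zero]

theorem hasDerivAt_prim (k : ℤ) (z : ℂ) :
    HasDerivAt (prim k) (Complex.exp (2 * Real.pi * Complex.I * k * z)) z := by
  by_cases hk : k = 0
  · subst hk
    have : prim 0 = id := by funext z; simp [prim]
    rw [this]
    simpa using hasDerivAt_id z
  · have h0 := two_pi_I_mul_ne_zero hk
    have : prim k = fun z => (Complex.exp (2 * Real.pi * Complex.I * k * z) - 1) /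
        (2 * Real.pi * Complex.I * k) := by funext z; simp [prim, hk]
    rw [this]
    refine ((((hasDerivAt_id z).const_mul _).cexp.sub_const 1).div_const _).congr_deriv ?_
    simp only [id]
    field_simp

/-- The cocycle identity transfers estimates near the origin to any real base point, where the
exponential factor has modulus one. -/
theorem prim_add (k : ℤ) (z w : ℂ) :
    prim k (z + w) = prim k z + Complex.exp (2 * Real.pi * Complex.I * k * z) * prim k w := by
  by_cases hk : k = 0
  · simp [prim, hk]
  · have h0 := two_pi_I_mul_ne_zero hk
    simp only [prim, hk, if_false]
    rw [mul_add, Complex.exp_add]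
    field_simp
    ring

theorem prim_zero (k : ℤ) : prim k 0 = 0 := by simp [prim]

theorem prim_one (k : ℤ) : prim k 1 = if k = 0 then 1 else 0 := by
  by_cases hk : k = 0
  · simp [prim, hk]
  · have : Complex.exp (2 * Real.pi * Complex.I * k * 1) = 1 :=
      Complex.exp_eq_one_iff.2 ⟨k, by ring⟩
    simp only [prim, hk, if_false, this, sub_self, zero_div]

theorem norm_two_pi_I_mul (k : ℤ) : ‖(2 * Real.pi * Complex.I * k : ℂ)‖ = 2 * Real.pi * |(k : ℝ)| := by
  simp [abs_of_pos Real.pi_pos]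

theorem norm_prim_le (k : ℤ) (z : ℂ) :
    ‖prim k z‖ ≤ ‖z‖ * Real.exp (2 * Real.pi * |(k : ℝ)| * ‖z‖) := by
  by_cases hk : k = 0
  · simp [prim, hk]
  · have h0 := norm_pos_iff.2 (two_pi_I_mul_ne_zero hk)
    simp only [prim, hk, if_false]
    rw [norm_div, div_le_iff₀ h0]
    refine (norm_exp_sub_one_le _).trans (le_of_eq ?_)
    rw [norm_mul, norm_two_pi_I_mul]
    ring

theorem norm_prim_sub_le (k : ℤ) (z : ℂ) :
    ‖prim k z - z‖
      ≤ 2 * Real.pi * |(k : ℝ)| * ‖z‖ ^ 2 * Real.exp (2 * Real.pi * |(k : ℝ)| * ‖z‖) := by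
  by_cases hk : k = 0
  · simp [prim, hk]
  · have hne := two_pi_I_mul_ne_zero hk
    have h0 := norm_pos_iff.2 hne
    have h2 := Complex.norm_exp_sub_sum_le_norm_mul_exp (2 * Real.pi * Complex.I * k * z) 2
    have : prim k z - z = (Complex.exp (2 * Real.pi * Complex.I * k * z) -
        ∑ m ∈ Finset.range 2, (2 * Real.pi * Complex.I * k * z) ^ m / (m.factorial : ℂ)) /
        (2 * Real.pi * Complex.I * k) := by
      simp only [prim, hk, if_false, Finset.sum_range_succ, Finset.sum_range_zero]
      field_simp
      simp
      ring
    rw [this, norm_div, div_le_iff₀ h0]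
    refine h2.trans (le_of_eq ?_)
    rw [norm_mul, norm_two_pi_I_mul]
    ring

/-- The entire primitive of a trigonometric polynomial, vanishing at the origin. -/
def expPrim (M : ℕ) (c : ℤ → ℂ) (z : ℂ) : ℂ :=
  ∑ k ∈ Finset.Icc (-(M : ℤ)) M, c k * prim k z

section expPrim

variable (M : ℕ) (c : ℤ → ℂ)

theorem hasDerivAt_expPrim (z : ℂ) : HasDerivAt (expPrim M c)
    (∑ k ∈ Finset.Icc (-(M : ℤ)) M, c k * Complex.exp (2 * Real.pi * Complex.I * k * z)) z := by
  unfold expPrim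
  exact HasDerivAt.fun_sum fun k _ => (hasDerivAt_prim k z).const_mul _

theorem differentiable_expPrim : Differentiable ℂ (expPrim M c) := fun z =>
  (hasDerivAt_expPrim M c z).differentiableAt

theorem exp_eq_e (k : ℤ) (t : ℝ) : Complex.exp (2 * Real.pi * Complex.I * k * t) = e (k * t) := by
  rw [e]; congr 1; push_cast; ring

theorem deriv_expPrim_ofReal (t : ℝ) : deriv (expPrim M c) t = trigPoly M c t := by
  rw [(hasDerivAt_expPrim M c t).deriv, trigPoly]
  exact Finset.sum_congr rfl fun k _ => by rw [exp_eq_e]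

theorem expPrim_zero : expPrim M c 0 = 0 := by simp [expPrim, prim_zero]

theorem expPrim_one : expPrim M c 1 = c 0 := by
  simp [expPrim, prim_one]

theorem expPrim_add_one (z : ℂ) : expPrim M c (z + 1) = expPrim M c z + c 0 := by
  rw [← expPrim_one M c, expPrim, expPrim, expPrim, ← Finset.sum_add_distrib]
  refine Finset.sum_congr rfl fun k _ => ?_
  rw [prim_add, prim_one]
  split_ifs with h
  · simp [h, mul_add]
  · simp

theorem abs_le_of_mem_Icc {M : ℕ} {k : ℤ} (hk : k ∈ Finset.Icc (-(M : ℤ)) M) :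
    |(k : ℝ)| ≤ M := by
  rw [Finset.mem_Icc] at hk
  have : |k| ≤ M := abs_le.2 hk
  exact_mod_cast this

theorem norm_deriv_expPrim_le {z : ℂ} {r : ℝ} (hz : ‖z‖ ≤ r) : ‖deriv (expPrim M c) z‖
    ≤ (∑ k ∈ Finset.Icc (-(M : ℤ)) M, ‖c k‖) * Real.exp (2 * Real.pi * M * r) := by
  rw [(hasDerivAt_expPrim M c z).deriv, Finset.sum_mul]
  refine (norm_sum_le _ _).trans (Finset.sum_le_sum fun k hk => ?_)
  rw [norm_mul]
  gcongr
  refine (Complex.norm_exp_le_exp_norm _).trans ?_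
  rw [norm_mul, norm_two_pi_I_mul]
  have := abs_le_of_mem_Icc hk
  gcongr

theorem norm_expPrim_le {z : ℂ} {r : ℝ} (hz : ‖z‖ ≤ r) : ‖expPrim M c z‖
    ≤ (∑ k ∈ Finset.Icc (-(M : ℤ)) M, ‖c k‖) * (r * Real.exp (2 * Real.pi * M * r)) := by
  rw [Finset.sum_mul]
  refine (norm_sum_le _ _).trans (Finset.sum_le_sum fun k hk => ?_)
  rw [norm_mul]
  have := abs_le_of_mem_Icc hk
  have hr : 0 ≤ r := (norm_nonneg z).trans hz
  gcongr
  refine (norm_prim_le _ _).trans ?_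
  gcongr

theorem norm_expPrim_add_sub_le (t : ℝ) {w : ℂ} {r : ℝ} (hw : ‖w‖ ≤ r) :
    ‖expPrim M c (t + w) - expPrim M c t‖
      ≤ (∑ k ∈ Finset.Icc (-(M : ℤ)) M, ‖c k‖) * (r * Real.exp (2 * Real.pi * M * r)) := by
  rw [Finset.sum_mul, expPrim, expPrim, ← Finset.sum_sub_distrib]
  refine (norm_sum_le _ _).trans (Finset.sum_le_sum fun k hk => ?_)
  rw [prim_add, ← mul_sub, add_sub_cancel_left, norm_mul, norm_mul, exp_eq_e, norm_e, one_mul]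
  have := abs_le_of_mem_Icc hk
  have hr : 0 ≤ r := (norm_nonneg w).trans hw
  gcongr
  refine (norm_prim_le _ _).trans ?_
  gcongr

/-- First-order Taylor expansion at a real point, with a quadratic remainder uniform in `t`; it
determines the imaginary part of a phase slightly off the real axis. -/
theorem norm_expPrim_add_sub_sub_le (t : ℝ) {w : ℂ} {r : ℝ} (hw : ‖w‖ ≤ r) :
    ‖expPrim M c (t + w) - expPrim M c t - trigPoly M c t * w‖
      ≤ (∑ k ∈ Finset.Icc (-(M : ℤ)) M, ‖c k‖) *
        (2 * Real.pi * M * r ^ 2 * Real.exp (2 * Real.pi * M * r)) := by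
  rw [Finset.sum_mul, expPrim, expPrim, trigPoly, Finset.sum_mul, ← Finset.sum_sub_distrib,
    ← Finset.sum_sub_distrib]
  refine (norm_sum_le _ _).trans (Finset.sum_le_sum fun k hk => ?_)
  have : c k * prim k (t + w) - c k * prim k t - c k * e (k * t) * w
      = c k * (e (k * t) * (prim k w - w)) := by
    rw [prim_add, exp_eq_e]; ring
  rw [this, norm_mul, norm_mul, norm_e, one_mul]
  have := abs_le_of_mem_Icc hk
  have hr : 0 ≤ r := (norm_nonneg w).trans hw
  gcongr
  refine (norm_prim_sub_le _ _).trans ?_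
  gcongr

end expPrim

/-- A function whose derivative is a trigonometric polynomial is the restriction of an entire
function. -/
theorem ofReal_eq_expPrim {M : ℕ} {c : ℤ → ℂ} {θ : ℝ → ℝ} (hθ : Differentiable ℝ θ)
    (hc : ∀ t, ((deriv θ t : ℝ) : ℂ) = trigPoly M c t) (t : ℝ) :
    (θ t : ℂ) = θ 0 + expPrim M c t := by
  have hd : ∀ s : ℝ, HasDerivAt (fun s : ℝ => (θ s : ℂ) - expPrim M c s) 0 s := by
    intro s
    have h1 : HasDerivAt (fun s : ℝ => (θ s : ℂ)) ((deriv θ s : ℝ) : ℂ) s :=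
      (hθ s).hasDerivAt.ofReal_comp
    have h2 : HasDerivAt (fun s : ℝ => expPrim M c s) (deriv (expPrim M c) s) s :=
      ((differentiable_expPrim M c) s).hasDerivAt.comp_ofReal
    refine (h1.sub h2).congr_deriv ?_
    rw [deriv_expPrim_ofReal, hc, sub_self]
  have := is_const_of_deriv_eq_zero (fun s => (hd s).differentiableAt) (fun s => (hd s).deriv) t 0
  simp only [Complex.ofReal_zero, expPrim_zero, sub_zero] at this
  rw [← this]; ring

theorem exists_pos_le_deriv {M : ℕ} {φ : ℝ → ℝ} (hφ : IsSparsePhase M φ)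
    (hpos : ∀ t, 0 < deriv φ t) : ∃ κ, 0 < κ ∧ ∀ t, κ ≤ deriv φ t := by
  obtain ⟨t₀, _, ht₀⟩ := isCompact_Icc.exists_isMinOn (nonempty_Icc.2 (zero_le_one' ℝ))
    hφ.continuous_deriv.continuousOn
  refine ⟨deriv φ t₀, hpos t₀, fun t => ?_⟩
  obtain ⟨s, hs, hts⟩ := Function.Periodic.exists_mem_Ico₀ (f := deriv φ) (c := 1)
    (fun t => hφ.deriv_add_one t) one_pos t
  rw [hts]
  exact ht₀ ⟨hs.1, hs.2.le⟩

/-! ### Complex estimates for a perturbed phase. -/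

/-- A perturbed normalized phase `(aΦ + Q) / (a + r)`, where `Q(1) = r`. -/
def perturbed (M : ℕ) (c q : ℤ → ℂ) (a r : ℝ) (z : ℂ) : ℂ :=
  (a * expPrim M c z + expPrim M q z) / (a + r)

section perturbed

variable {M : ℕ} {c q : ℤ → ℂ} {a r D₀ : ℝ}

theorem differentiable_perturbed : Differentiable ℂ (perturbed M c q a r) :=
  (((differentiable_expPrim M c).const_mul _).add (differentiable_expPrim M q)).div_const _

theorem perturbed_add_one (hc : c 0 = 1) (hq : q 0 = r) (har : (a + r : ℂ) ≠ 0) (z : ℂ) :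
    perturbed M c q a r (z + 1) = perturbed M c q a r z + 1 := by
  rw [perturbed, perturbed, expPrim_add_one, expPrim_add_one, hc, hq]
  field_simp
  ring

theorem norm_add_ofReal_ge (haD : 2 * D₀ ≤ a) (hr : |r| ≤ D₀) :
    a / 2 ≤ ‖(a + r : ℂ)‖ := by
  rw [← Complex.ofReal_add, Complex.norm_real, Real.norm_eq_abs]
  have := abs_le.1 hr
  exact le_trans (by linarith) (le_abs_self _)

theorem norm_perturbed_le (ha : 1 ≤ a) (haD : 2 * D₀ ≤ a) (hr : |r| ≤ D₀)
    (hq : ∑ k ∈ Finset.Icc (-(M : ℤ)) M, ‖q k‖ ≤ D₀) {z : ℂ} (hz : ‖z‖ ≤ 2) :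
    ‖perturbed M c q a r z‖ ≤ 4 * Real.exp (2 * Real.pi * M * 2) *
      ((∑ k ∈ Finset.Icc (-(M : ℤ)) M, ‖c k‖) + D₀) := by
  have h1 := norm_expPrim_le M c hz
  have h2 := norm_expPrim_le M q hz
  have h3 := norm_add_ofReal_ge haD hr
  set W := Real.exp (2 * Real.pi * M * 2)
  set C := ∑ k ∈ Finset.Icc (-(M : ℤ)) M, ‖c k‖
  have hW : 0 < W := Real.exp_pos _
  have hC : 0 ≤ C := by positivity
  have hD : 0 ≤ D₀ := (abs_nonneg r).trans hr
  rw [perturbed, norm_div, div_le_iff₀ (by linarith)]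
  calc _ ≤ a * (C * (2 * W)) + D₀ * (2 * W) := by
        refine (norm_add_le _ _).trans (add_le_add ?_ (h2.trans (by gcongr)))
        rw [norm_mul, Complex.norm_real, Real.norm_of_nonneg (by linarith)]
        gcongr
    _ ≤ a * (C * (2 * W)) + a * (D₀ * (2 * W)) := by
        have : 0 ≤ D₀ * (2 * W) := by positivity
        nlinarith
    _ = 4 * W * (C + D₀) * (a / 2) := by ring
    _ ≤ _ := by gcongr

theorem norm_deriv_perturbed_le (ha : 1 ≤ a) (haD : 2 * D₀ ≤ a) (hr : |r| ≤ D₀)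
    (hq : ∑ k ∈ Finset.Icc (-(M : ℤ)) M, ‖q k‖ ≤ D₀) {z : ℂ} (hz : ‖z‖ ≤ 2) :
    ‖deriv (perturbed M c q a r) z‖ ≤ 2 * Real.exp (2 * Real.pi * M * 2) *
      ((∑ k ∈ Finset.Icc (-(M : ℤ)) M, ‖c k‖) + D₀) := by
  have hd : deriv (perturbed M c q a r) z
      = (a * deriv (expPrim M c) z + deriv (expPrim M q) z) / (a + r) :=
    ((((differentiable_expPrim M c z).hasDerivAt).const_mul (a : ℂ)).add
      (differentiable_expPrim M q z).hasDerivAt |>.div_const _).deriv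
  have h1 := norm_deriv_expPrim_le M c hz
  have h2 := norm_deriv_expPrim_le M q hz
  have h3 := norm_add_ofReal_ge haD hr
  set W := Real.exp (2 * Real.pi * M * 2)
  set C := ∑ k ∈ Finset.Icc (-(M : ℤ)) M, ‖c k‖
  have hW : 0 < W := Real.exp_pos _
  have hC : 0 ≤ C := by positivity
  have hD : 0 ≤ D₀ := (abs_nonneg r).trans hr
  rw [hd, norm_div, div_le_iff₀ (by linarith)]
  calc _ ≤ a * (C * W) + D₀ * W := by
        refine (norm_add_le _ _).trans (add_le_add ?_ (h2.trans (by gcongr)))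
        rw [norm_mul, Complex.norm_real, Real.norm_of_nonneg (by linarith)]
        gcongr
    _ ≤ a * (C * W) + a * (D₀ * W) := by
        have : 0 ≤ D₀ * W := by positivity
        nlinarith
    _ = 2 * W * (C + D₀) * (a / 2) := by ring
    _ ≤ _ := by gcongr

/-- Off the real axis the imaginary part of the perturbed phase has the sign of the shift. -/
theorem mul_im_perturbed_ge (ha : 1 ≤ a) (haD : 2 * D₀ ≤ a) (hr : |r| ≤ D₀)
    (hq : ∑ k ∈ Finset.Icc (-(M : ℤ)) M, ‖q k‖ ≤ D₀) {κ σ : ℝ} (hκ : 0 < κ)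
    (haκ : 4 * D₀ * Real.exp (2 * Real.pi * M * 2) ≤ a * κ) (hσ0 : 0 < σ) (hσ1 : σ ≤ 1)
    (hσ : σ * ((∑ k ∈ Finset.Icc (-(M : ℤ)) M, ‖c k‖) *
      (2 * Real.pi * M * Real.exp (2 * Real.pi * M * 2))) ≤ κ / 2)
    {t s : ℝ} (hs : |s| = σ) (hΦ : (expPrim M c t).im = 0) (hQ : (expPrim M q t).im = 0)
    {v : ℝ} (hv : trigPoly M c t = v) (hκv : κ ≤ v) :
    σ ^ 2 * κ / 8 ≤ s * (perturbed M c q a r (t + s * Complex.I)).im := by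
  have hw : ‖(s * Complex.I : ℂ)‖ ≤ σ := by simp [hs]
  have h1 := norm_expPrim_add_sub_sub_le M c t hw
  have h2 := norm_expPrim_add_sub_le M q t hw
  have hWσ : Real.exp (2 * Real.pi * M * σ) ≤ Real.exp (2 * Real.pi * M * 2) := by
    gcongr; linarith
  set W := Real.exp (2 * Real.pi * M * 2)
  set C := ∑ k ∈ Finset.Icc (-(M : ℤ)) M, ‖c k‖
  have hW : 0 < W := Real.exp_pos _
  have hC : 0 ≤ C := by positivity
  have hD : 0 ≤ D₀ := (abs_nonneg r).trans hr
  -- The smallness of `σ` lets the linear term `v s`, with `v ≥ κ`, absorb half its size in Taylor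
  -- remainder.
  have h1' : |(expPrim M c (t + s * Complex.I)).im - v * s| ≤ σ * (κ / 2) := by
    have h3 := (Complex.abs_im_le_norm _).trans h1
    rw [hv, Complex.sub_im, Complex.sub_im, hΦ, sub_zero] at h3
    simp only [Complex.im_ofReal_mul, Complex.I_im, mul_one] at h3
    refine h3.trans ?_
    calc C * (2 * Real.pi * M * σ ^ 2 * Real.exp (2 * Real.pi * M * σ))
        ≤ C * (2 * Real.pi * M * σ ^ 2 * W) := by gcongr
      _ = σ * (σ * (C * (2 * Real.pi * M * W))) := by ring
      _ ≤ _ := by gcongr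
  have h2' : |(expPrim M q (t + s * Complex.I)).im| ≤ D₀ * (σ * W) := by
    have h3 := (Complex.abs_im_le_norm _).trans h2
    rw [Complex.sub_im, hQ, sub_zero] at h3
    exact h3.trans (by gcongr)
  have hss : s * s = σ * σ := by rw [← hs]; exact (abs_mul_abs_self s).symm
  have h3 : -(σ * (σ * (κ / 2))) ≤ s * ((expPrim M c (t + s * Complex.I)).im - v * s) := by
    have : |s * ((expPrim M c (t + s * Complex.I)).im - v * s)| ≤ σ * (σ * (κ / 2)) := by
      rw [abs_mul, hs]; gcongr
    exact (abs_le.1 this).1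
  have h4 : -(σ * (D₀ * (σ * W))) ≤ s * (expPrim M q (t + s * Complex.I)).im := by
    have : |s * (expPrim M q (t + s * Complex.I)).im| ≤ σ * (D₀ * (σ * W)) := by
      rw [abs_mul, hs]; gcongr
    exact (abs_le.1 this).1
  have him : (perturbed M c q a r (t + s * Complex.I)).im
      = (a * (expPrim M c (t + s * Complex.I)).im + (expPrim M q (t + s * Complex.I)).im)
        / (a + r) := by
    rw [perturbed, ← Complex.ofReal_add, Complex.div_ofReal_im, Complex.add_im,
      Complex.im_ofReal_mul]
  have hrr := abs_le.1 hr
  rw [him, mul_div_assoc', le_div_iff₀ (by linarith)]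
  have h5 : σ * σ * (κ / 2) ≤ s * (expPrim M c (t + s * Complex.I)).im := by
    have : σ * σ * κ ≤ s * (v * s) := by
      rw [show s * (v * s) = s * s * v by ring, hss]; gcongr
    linarith
  have h6 : a * (σ * σ * (κ / 2)) ≤ a * (s * (expPrim M c (t + s * Complex.I)).im) := by gcongr
  -- The perturbation `Q` is not multiplied by `a`, so largeness of `a` makes it cost at most half
  -- of what remains.
  have h7 : σ * σ * (4 * D₀ * W) ≤ σ * σ * (a * κ) := by gcongr
  have h8 : σ ^ 2 * κ / 8 * (a + r) ≤ σ ^ 2 * κ / 8 * (2 * a) := by gcongr; linarith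
  linarith

/-- The Fourier coefficients of `e(nΦ) - e(nΨ)`, relative to `e(nΨ)`, in the perturbed phase `Ψ`. -/
theorem norm_perturbed_coeff_le (hc : c 0 = 1) (hq0 : q 0 = r) (ha : 1 ≤ a) (haD : 2 * D₀ ≤ a)
    (hqD : ∑ k ∈ Finset.Icc (-(M : ℤ)) M, ‖q k‖ ≤ D₀) {κ σ : ℝ} (hκ : 0 < κ)
    (haκ : 4 * D₀ * Real.exp (2 * Real.pi * M * 2) ≤ a * κ) (hσ0 : 0 < σ) (hσ1 : σ ≤ 1)
    (hσ : σ * ((∑ k ∈ Finset.Icc (-(M : ℤ)) M, ‖c k‖) *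
      (2 * Real.pi * M * Real.exp (2 * Real.pi * M * 2))) ≤ κ / 2)
    (hΦ : ∀ t : ℝ, (expPrim M c t).im = 0) (hQ : ∀ t : ℝ, (expPrim M q t).im = 0)
    {v : ℝ → ℝ} (hv : ∀ t, trigPoly M c t = v t) (hκv : ∀ t, κ ≤ v t) {b : ℝ} (hb : |b| ≤ 2)
    {G K₁ : ℝ} (hG : G = Real.exp (2 * Real.pi * M * 2) *
      ((∑ k ∈ Finset.Icc (-(M : ℤ)) M, ‖c k‖) + D₀))
    (hK₁ : K₁ = 4 * G + 2 * Real.exp (2 * Real.pi * M * 2)) (l : ℤ) :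
    ‖∫ t in (0 : ℝ)..1, (Complex.exp (Complex.I * b * (r * perturbed M c q a r t
        - expPrim M q t)) - 1) *
        Complex.exp (-(2 * Real.pi * Complex.I * l * perturbed M c q a r t)) *
        deriv (perturbed M c q a r) t‖
      ≤ 2 * K₁ * Real.exp (2 * (D₀ * K₁)) * (2 * G) *
        (∑ k ∈ Finset.Icc (-(M : ℤ)) M, ‖q k‖) *
        Real.exp (-(2 * Real.pi * (σ * κ / 8)) * |(l : ℝ)|) := by
  set D := ∑ k ∈ Finset.Icc (-(M : ℤ)) M, ‖q k‖ with hDdef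
  have hrD : |r| ≤ D := by
    have : ‖q 0‖ ≤ D := Finset.single_le_sum (f := fun k => ‖q k‖) (fun _ _ => norm_nonneg _)
      (Finset.mem_Icc.2 ⟨by simp, by simp⟩)
    rwa [hq0, Complex.norm_real, Real.norm_eq_abs] at this
  have hr : |r| ≤ D₀ := hrD.trans hqD
  have hD0 : 0 ≤ D := by positivity
  have har : (a + r : ℂ) ≠ 0 := by
    rw [← norm_pos_iff]
    exact lt_of_lt_of_le (by linarith) (norm_add_ofReal_ge haD hr)
  have hnorm2 : ∀ s : ℝ, (s = σ ∨ s = -σ) → ∀ t ∈ Icc (0 : ℝ) 1,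
      ‖(t + s * Complex.I : ℂ)‖ ≤ 2 := by
    intro s hs t ht
    refine (norm_add_le _ _).trans ?_
    have : |s| = σ := by rcases hs with rfl | rfl <;> simp [abs_of_pos hσ0]
    rw [Complex.norm_real, norm_mul, Complex.norm_real, Complex.norm_I, Real.norm_eq_abs,
      Real.norm_eq_abs, this, abs_of_nonneg ht.1]
    linarith [ht.2]
  have hper := perturbed_add_one (M := M) hc hq0 har
  set W := Real.exp (2 * Real.pi * M * 2) with hWdef
  have hW : 0 < W := Real.exp_pos _
  refine norm_integral_le_exp (Ψ := perturbed M c q a r)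
    (H := fun z => Complex.exp (Complex.I * b * (r * perturbed M c q a r z - expPrim M q z)) - 1)
    (σ := σ) (ρ := σ * κ / 8) differentiable_perturbed
    ((((differentiable_perturbed.const_mul _).sub (differentiable_expPrim M q)).const_mul
      _).cexp.sub_const 1) hper ?_ ?_ ?_ ?_ l
  · intro z
    rw [hper, expPrim_add_one, hq0]
    ring_nf
  · intro t ht
    have := mul_im_perturbed_ge ha haD hr hqD hκ haκ hσ0 hσ1 hσ (abs_of_pos hσ0) (hΦ t) (hQ t)
      (hv t) (hκv t)
    refine le_of_mul_le_mul_left ?_ hσ0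
    linarith
  · intro t ht
    have := mul_im_perturbed_ge ha haD hr hqD hκ haκ hσ0 hσ1 hσ
      (s := -σ) (by rw [abs_neg, abs_of_pos hσ0]) (hΦ t) (hQ t) (hv t) (hκv t)
    refine le_of_mul_le_mul_left ?_ hσ0
    linarith
  · intro s hs t ht
    have hz := hnorm2 s hs t ht
    have h1 := norm_perturbed_le (c := c) ha haD hr hqD hz
    have h2 := norm_deriv_perturbed_le (c := c) ha haD hr hqD hz
    have h3 := norm_expPrim_le M q hz
    rw [← hWdef, mul_assoc, ← hG] at h1 h2
    rw [← hWdef, ← hDdef] at h3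
    have hG0 : 0 ≤ G := by
      have := (norm_nonneg _).trans h2
      linarith
    have hK₁0 : 0 ≤ K₁ := by rw [hK₁]; positivity
    -- Both terms of `γ` are linear in the perturbation, so the final bound carries the factor `D`;
    -- the a priori bound `D₀` is used only inside the exponential.
    set γ : ℂ := r * perturbed M c q a r (t + s * Complex.I) - expPrim M q (t + s * Complex.I)
      with hγ
    have h4 : ‖γ‖ ≤ D * K₁ := by
      calc ‖γ‖ ≤ D * (4 * G) + D * (2 * W) := by
            refine (norm_sub_le _ _).trans (add_le_add ?_ h3)
            rw [norm_mul, Complex.norm_real, Real.norm_eq_abs]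
            gcongr
        _ = _ := by rw [hK₁]; ring
    have h5 : ‖Complex.I * b * γ‖ ≤ 2 * (D * K₁) := by
      rw [norm_mul, norm_mul, Complex.norm_I, one_mul, Complex.norm_real, Real.norm_eq_abs]
      gcongr
    rw [norm_mul]
    calc _ ≤ (2 * (D * K₁) * Real.exp (2 * (D₀ * K₁))) * (2 * G) := by
          gcongr
          refine (norm_exp_sub_one_le _).trans ?_
          gcongr
          refine h5.trans ?_
          gcongr
      _ = _ := by ring

end perturbed

/-! ### Expansion of the signal in a nearby phase. -/

theorem summable_exp_neg_mul_abs {ρ : ℝ} (hρ : 0 < ρ) :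
    Summable fun l : ℤ => Real.exp (-ρ * |(l : ℝ)|) := by
  have h : Summable fun n : ℕ => Real.exp (-ρ * n) := by
    have := summable_geometric_of_lt_one (Real.exp_pos (-ρ)).le (Real.exp_lt_one_iff.2 (by linarith))
    refine this.congr fun n => ?_
    rw [← Real.exp_nat_mul, mul_comm]
  refine Summable.of_nat_of_neg ?_ ?_
  · simpa using h
  · simpa using h

/-- Changing the phase from `φ` to a nearby phase, the characters have expansions whose
coefficients decay exponentially away from the main one and are proportional to the error. -/
theorem exists_phase_change {M : ℕ} {φ : ℝ → ℝ} (hφ : IsSparsePhase M φ) (h0 : φ 0 = 0)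
    (h1 : φ 1 = 1) (hpos : ∀ t, 0 < deriv φ t) {D₀ : ℝ} (hD₀ : 0 ≤ D₀) :
    ∃ κ L₀ K ρ : ℝ, 0 < κ ∧ 0 < L₀ ∧ 0 < K ∧ 0 < ρ ∧ (∀ t, κ ≤ deriv φ t) ∧
      ∀ (θ Θ : ℝ → ℝ) (N : ℕ), IsSparsePhase M θ → IsSparsePhase M Θ → normPhase θ = φ →
        numPeriods θ = N → L₀ ≤ N → freqError Θ θ ≤ D₀ →
        |numPeriods Θ - N| ≤ D₀ ∧
        ∀ n : ℤ, |(n : ℝ)| ≤ 2 * N → ∃ y : ℤ → ℂ,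
          (∀ l, ‖y l‖ ≤ K * freqError Θ θ * Real.exp (-ρ * |(l : ℝ)|)) ∧
          ∀ t, HasSum (fun l : ℤ => y l * e ((l + n) * normPhase Θ t))
            (e (n * φ t) - e (n * normPhase Θ t)) := by
  obtain ⟨κ, hκ, hκφ⟩ := exists_pos_le_deriv hφ hpos
  obtain ⟨c, hc⟩ := hφ.exists_coeff
  have hφc : ∀ t : ℝ, (φ t : ℂ) = expPrim M c t := by
    intro t
    have := ofReal_eq_expPrim hφ.differentiable hc t
    rwa [h0, Complex.ofReal_zero, zero_add] at this
  have hc0 : c 0 = 1 := by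
    have := hφc 1
    rw [h1, Complex.ofReal_one, expPrim_one] at this
    exact this.symm
  set W := Real.exp (2 * Real.pi * M * 2) with hW
  set C := ∑ k ∈ Finset.Icc (-(M : ℤ)) M, ‖c k‖ with hC
  have hW0 : 0 < W := Real.exp_pos _
  have hW1 : 1 ≤ W := Real.one_le_exp (by positivity)
  have hC0 : 0 ≤ C := by positivity
  have hCpos : 0 < C := by
    have : ‖c 0‖ ≤ C := Finset.single_le_sum (f := fun k => ‖c k‖) (fun _ _ => norm_nonneg _)
      (Finset.mem_Icc.2 ⟨by simp, by simp⟩)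
    rw [hc0, norm_one] at this
    linarith
  set E := C * (2 * Real.pi * M * W) with hE
  have hE0 : 0 ≤ E := by positivity
  set σ := min 1 (κ / 2 / (E + 1)) with hσ
  have hσ0 : 0 < σ := lt_min one_pos (by positivity)
  have hσ1 : σ ≤ 1 := min_le_left _ _
  have hσE : σ * E ≤ κ / 2 := by
    have h2 : σ ≤ κ / 2 / (E + 1) := min_le_right _ _
    rw [le_div_iff₀ (by positivity)] at h2
    linarith
  set G := W * (C + D₀) with hG
  set K₁ := 4 * G + 2 * W with hK₁
  have hG0 : 0 < G := by positivity
  have hK₁0 : 0 < K₁ := by positivity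
  -- The three terms of the threshold ensure `a ≥ 1`, `a ≥ 2D₀` and `aκ ≥ 4D₀W` for `a = 2πN`.
  refine ⟨κ, 1 + 2 * D₀ + 4 * D₀ * W / κ, 2 * K₁ * Real.exp (2 * (D₀ * K₁)) * (2 * G),
    2 * Real.pi * (σ * κ / 8), hκ, by positivity, by positivity, by positivity, hκφ, ?_⟩
  intro θ Θ N hθ hΘ hφθ hN hL hD
  have hNφ : ∀ t, θ t = θ 0 + 2 * Real.pi * N * φ t := by
    intro t
    have hN0 : (N : ℝ) ≠ 0 := by
      have : 0 ≤ 4 * D₀ * W / κ := by positivity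
      intro h; rw [h] at hL; linarith
    have := Real.pi_ne_zero
    rw [← hφθ, normPhase, hN]
    field_simp
    ring
  have hε := hΘ.sub hθ
  obtain ⟨q, hq⟩ := hε.exists_coeff
  have hDq : freqError Θ θ = ∑ k ∈ Finset.Icc (-(M : ℤ)) M, ‖q k‖ := by
    rw [← fourierNorm_trigPoly]
    exact congrArg fourierNorm (funext hq)
  rw [hDq] at hD ⊢
  set D := ∑ k ∈ Finset.Icc (-(M : ℤ)) M, ‖q k‖ with hDdef
  have hεq := ofReal_eq_expPrim hε.differentiable hq
  set r : ℝ := (Θ 1 - θ 1) - (Θ 0 - θ 0) with hr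
  have hq0 : q 0 = r := by
    have := hεq 1
    rw [Complex.ofReal_one, expPrim_one] at this
    rw [hr, Complex.ofReal_sub, this, add_sub_cancel_left]
  have hrD : |r| ≤ D := by
    have : ‖q 0‖ ≤ D := Finset.single_le_sum (f := fun k => ‖q k‖) (fun _ _ => norm_nonneg _)
      (Finset.mem_Icc.2 ⟨by simp, by simp⟩)
    rwa [hq0, Complex.norm_real, Real.norm_eq_abs] at this
  have hrD₀ := hrD.trans hD
  have hpi := Real.pi_gt_three
  have hWκ : 0 ≤ 4 * D₀ * W / κ := by positivity
  set a : ℝ := 2 * Real.pi * N with ha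
  have haN : (N : ℝ) ≤ a := by
    have : (0 : ℝ) ≤ N := N.cast_nonneg
    rw [ha]; nlinarith
  have ha1 : 1 ≤ a := by linarith
  have haD : 2 * D₀ ≤ a := by linarith
  have haκ : 4 * D₀ * W ≤ a * κ := by
    rw [← div_le_iff₀ hκ]; linarith
  have har : 0 < a + r := by have := abs_le.1 hrD₀; linarith
  have hNp : (0 : ℝ) < N := by linarith
  have hper : numPeriods Θ * (2 * Real.pi) = a + r := by
    rw [numPeriods, div_mul_cancel₀ _ (by positivity), hr, hNφ 1, h1]
    ring
  have hper' : numPeriods Θ = N + r / (2 * Real.pi) := by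
    rw [eq_comm, ← mul_left_inj' (two_pos.trans (by linarith : (2 : ℝ) < 2 * Real.pi)).ne', hper,
      add_mul, div_mul_cancel₀ _ (by positivity), ha]
    ring
  have hψ : ∀ t, normPhase Θ t = (Θ t - Θ 0) / (a + r) := by
    intro t; rw [normPhase, mul_comm (2 * Real.pi), hper]
  have hψ' : ∀ t, ((normPhase Θ t : ℝ) : ℂ) = perturbed M c q a r t := by
    intro t
    rw [hψ, perturbed, ← hφc]
    have h2 : expPrim M q t = (((Θ t - θ t) - (Θ 0 - θ 0) : ℝ) : ℂ) := by
      rw [Complex.ofReal_sub, hεq, add_sub_cancel_left]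
    rw [h2, hNφ t]
    push_cast
    ring
  have hψd : ∀ t, HasDerivAt (normPhase Θ) (deriv Θ t / (a + r)) t := by
    intro t
    rw [show normPhase Θ = fun t => (Θ t - Θ 0) / (a + r) from funext hψ]
    exact ((hΘ.differentiable t).hasDerivAt.sub_const _).div_const _
  have hψd' : ∀ t : ℝ, ((deriv (normPhase Θ) t : ℝ) : ℂ) = deriv (perturbed M c q a r) t := by
    intro t
    have h2 : HasDerivAt (fun t : ℝ => ((normPhase Θ t : ℝ) : ℂ))
        ((deriv (normPhase Θ) t : ℝ) : ℂ) t := (hψd t).differentiableAt.hasDerivAt.ofReal_comp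
    rw [show (fun t : ℝ => ((normPhase Θ t : ℝ) : ℂ)) = fun t : ℝ => perturbed M c q a r t from
      funext hψ'] at h2
    exact h2.unique ((differentiable_perturbed (t : ℂ)).hasDerivAt.comp_ofReal)
  have hψpos : ∀ t, 0 < deriv (normPhase Θ) t := by
    intro t
    rw [(hψd t).deriv]
    refine div_pos ?_ har
    have h2 : deriv Θ t = a * deriv φ t + deriv (fun t => Θ t - θ t) t := by
      have h3 : HasDerivAt θ (a * deriv φ t) t := by
        rw [show θ = fun t => θ 0 + 2 * Real.pi * N * φ t from funext hNφ]
        exact ((hφ.differentiable t).hasDerivAt.const_mul _).const_add _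
      have h4 : HasDerivAt (fun t => Θ t - θ t) _ t := (hΘ.differentiable t).hasDerivAt.sub h3
      rw [h4.deriv]; ring
    have h5 : |deriv (fun t => Θ t - θ t) t| ≤ D := by
      rw [← Real.norm_eq_abs, ← Complex.norm_real, hq]
      exact norm_trigPoly_le M q t
    have h6 := (abs_le.1 (h5.trans hD)).1
    have h7 : a * κ ≤ a * deriv φ t := by gcongr; exact hκφ t
    have h8 : D₀ ≤ D₀ * W := le_mul_of_one_le_right hD₀ hW1
    have h9 : 0 < a * κ := by positivity
    linarith
  refine ⟨?_, ?_⟩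
  · rw [hper', add_sub_cancel_left, abs_div, abs_of_pos (by positivity : 0 < 2 * Real.pi)]
    refine (div_le_self (abs_nonneg _) (by linarith)).trans hrD₀
  intro n hn
  -- Since `a(φ - ψ) = rψ - Q`, one gets `2πn(φ - ψ) = b(rψ - Q)`: the large frequency enters only
  -- through the bounded ratio `b`.
  set b : ℝ := n / N with hb
  have hb2 : |b| ≤ 2 := by
    rw [hb, abs_div, abs_of_pos hNp, div_le_iff₀ hNp]
    exact hn
  set g : ℝ → ℂ := fun t => Complex.exp (Complex.I * b * (r * perturbed M c q a r t
    - expPrim M q t)) - 1 with hg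
  have hgc : Continuous g := by
    have h2 : Continuous fun t : ℝ => perturbed M c q a r t :=
      differentiable_perturbed.continuous.comp Complex.continuous_ofReal
    have h3 : Continuous fun t : ℝ => expPrim M q t :=
      (differentiable_expPrim M q).continuous.comp Complex.continuous_ofReal
    fun_prop
  have har' : (a + r : ℂ) ≠ 0 := by exact_mod_cast har.ne'
  have hgp : Function.Periodic g 1 := by
    intro t
    simp only [hg]
    rw [Complex.ofReal_add, Complex.ofReal_one, perturbed_add_one hc0 hq0 har', expPrim_add_one, hq0]
    ring_nf
  have hψ0 : normPhase Θ 0 = 0 := by simp [normPhase]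
  have hψ1 : ∀ t, normPhase Θ (t + 1) = normPhase Θ t + 1 := by
    intro t
    have := perturbed_add_one (M := M) hc0 hq0 har' t
    have h2 : ((t : ℂ) + 1) = ((t + 1 : ℝ) : ℂ) := by push_cast; rfl
    rw [h2, ← hψ', ← hψ'] at this
    exact_mod_cast this
  have hψC : ContDiff ℝ 1 (normPhase Θ) := by
    rw [show normPhase Θ = fun t => (Θ t - Θ 0) / (a + r) from funext hψ]
    exact (hΘ.contDiff.sub contDiff_const).div_const _
  have hcoeff : ∀ l : ℤ, ‖coordCoeff (normPhase Θ) g l‖ ≤ 2 * K₁ * Real.exp (2 * (D₀ * K₁)) *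
      (2 * G) * D * Real.exp (-(2 * Real.pi * (σ * κ / 8)) * |(l : ℝ)|) := by
    intro l
    refine le_trans (le_of_eq ?_) (norm_perturbed_coeff_le (v := deriv φ) hc0 hq0 ha1 haD hD hκ haκ
      hσ0 hσ1 hσE ?_ ?_ (fun t => (hc t).symm) hκφ hb2 hG hK₁ l)
    · congr 1
      refine intervalIntegral.integral_congr fun t _ => ?_
      simp only [hg, hψd']
      congr 2
      rw [e]
      congr 1
      push_cast
      rw [hψ']
      ring
    · intro t; rw [← hφc, Complex.ofReal_im]
    · intro t
      have h2 : expPrim M q t = (((Θ t - θ t) - (Θ 0 - θ 0) : ℝ) : ℂ) := by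
        rw [Complex.ofReal_sub, hεq, add_sub_cancel_left]
      rw [h2, Complex.ofReal_im]
  refine ⟨coordCoeff (normPhase Θ) g, hcoeff, fun t => ?_⟩
  have hsum := hasSum_coordCoeff hψC hψpos hψ0 hψ1 hgc hgp
    (Summable.of_norm_bounded ((summable_exp_neg_mul_abs (by positivity)).mul_left _) hcoeff) t
  have h2 := hsum.mul_right (e (n * normPhase Θ t))
  have h3 : g t * e (n * normPhase Θ t) = e (n * φ t) - e (n * normPhase Θ t) := by
    rw [hg, sub_mul, one_mul, e, e, ← Complex.exp_add]
    congr 2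
    rw [← hψ' t, hb]
    have h4 : expPrim M q t = ((a + r : ℝ) : ℂ) * normPhase Θ t - a * φ t := by
      have : (((a + r : ℝ) : ℂ)) * ((normPhase Θ t : ℝ) : ℂ) = a * φ t + expPrim M q t := by
        rw [hψ', perturbed, hφc]
        push_cast
        field_simp
      rw [this]; ring
    have hNc : (N : ℂ) ≠ 0 := by exact_mod_cast hNp.ne'
    rw [h4, ha]
    push_cast
    field_simp
    ring
  rw [h3] at h2
  simpa only [mul_assoc, ← e_add, ← add_mul] using h2

theorem norm_coordCoeff_le {ψ : ℝ → ℝ} (hψ : ContDiff ℝ 1 ψ) (hpos : ∀ t, 0 < deriv ψ t)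
    (h0 : ψ 0 = 0) (h1 : ψ 1 = 1) {g : ℝ → ℂ} {B : ℝ} (hB : ∀ t, ‖g t‖ ≤ B) (l : ℤ) :
    ‖coordCoeff ψ g l‖ ≤ B := by
  have hd := (contDiff_one_iff_deriv.1 hψ).1
  have hd' := (contDiff_one_iff_deriv.1 hψ).2
  have h2 : ‖coordCoeff ψ g l‖ ≤ ∫ t in (0 : ℝ)..1, B * deriv ψ t := by
    refine intervalIntegral.norm_integral_le_of_norm_le zero_le_one ?_
      ((continuous_const.mul hd').intervalIntegrable _ _)
    refine Filter.Eventually.of_forall fun t _ => ?_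
    rw [norm_mul, norm_mul, norm_e, mul_one, Complex.norm_real, Real.norm_of_nonneg (hpos t).le]
    exact mul_le_mul_of_nonneg_right (hB t) (hpos t).le
  rw [intervalIntegral.integral_const_mul, intervalIntegral.integral_deriv_eq_sub
    (fun t _ => hd t) (hd'.intervalIntegrable _ _), h0, h1] at h2
  simpa using h2

/-- A function that is sparse in the phase is a trigonometric polynomial in the phase. -/
theorem IsSparseInPhase.exists_coeff {M : ℕ} {θ g : ℝ → ℝ} (hg : IsSparseInPhase M θ g)
    (hψ : ContDiff ℝ 1 (normPhase θ)) (hpos : ∀ t, 0 < deriv (normPhase θ) t)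
    (hper : ∀ t, normPhase θ (t + 1) = normPhase θ t + 1) {B : ℝ} (hB : ∀ t, |g t| ≤ B) :
    ∃ c : ℤ → ℂ, (∀ j, ‖c j‖ ≤ B) ∧ ∀ t, (g t : ℂ) = trigPoly M c (normPhase θ t) := by
  have h0 : normPhase θ 0 = 0 := by simp [normPhase]
  have h1 : normPhase θ 1 = 1 := by have := hper 0; rwa [zero_add, h0, zero_add] at this
  have hz : ∀ k ∉ Finset.Icc (-(M : ℤ)) M, coordCoeff (normPhase θ) (fun t => (g t : ℂ)) k = 0 := by
    intro k hk
    refine hg.coeff_eq_zero k ?_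
    by_contra hlt
    exact hk (Finset.mem_Icc.2 (abs_le.1 (not_lt.1 hlt)))
  refine ⟨coordCoeff (normPhase θ) (fun t => (g t : ℂ)),
    norm_coordCoeff_le hψ hpos h0 h1 (fun t => by simpa using hB t), fun t => ?_⟩
  have hs := hasSum_coordCoeff (g := fun t => (g t : ℂ)) hψ hpos h0 hper
    (Complex.continuous_ofReal.comp hg.continuous) (fun t => by simp only [hg.periodic t])
    (summable_of_ne_finset_zero hz) t
  refine hs.unique (hasSum_sum_of_ne_finset_zero fun k hk => ?_)
  rw [hz k hk, zero_mul]

/-- `G` has the expansion `∑ Y_l e(lψ)`, whose coefficients decay exponentially at distances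
larger than `M` from the center `s`. -/
structure ExpandsAt (ψ : ℝ → ℝ) (G : ℝ → ℂ) (Y : ℤ → ℂ) (s : ℤ) (M : ℕ) (A ρ : ℝ) : Prop where
  hasSum : ∀ t, HasSum (fun l : ℤ => Y l * e (l * ψ t)) (G t)
  norm_le : ∀ l, (M : ℤ) < |l - s| → ‖Y l‖ ≤ A * Real.exp (-ρ * |(l : ℝ) - s|)

/-- Each of the `2M + 1` modes near `s` contributes a main coefficient within distance `M` of `s`
and a tail of size `A`. Beyond that distance only the tails remain, and recentering them at `s`
costs the factor `e^{ρM}`. -/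
theorem exists_expandsAt {φ ψ : ℝ → ℝ} {M : ℕ} {c : ℤ → ℂ} {B : ℝ} (hB : ∀ j, ‖c j‖ ≤ B)
    {A ρ : ℝ} (hA : 0 ≤ A) (hρ : 0 < ρ) (s : ℤ)
    (hy : ∀ n : ℤ, |n - s| ≤ M → ∃ y : ℤ → ℂ, (∀ l, ‖y l‖ ≤ A * Real.exp (-ρ * |(l : ℝ)|)) ∧
      ∀ t, HasSum (fun l : ℤ => y l * e ((l + n) * ψ t)) (e (n * φ t) - e (n * ψ t))) :
    ∃ Y, ExpandsAt ψ (fun t => e (s * φ t) * trigPoly M c (φ t)) Y s M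
      ((2 * M + 1) * (B * (A * Real.exp (ρ * M)))) ρ := by
  have hB0 : 0 ≤ B := (norm_nonneg _).trans (hB 0)
  have hy' : ∀ j : ℤ, ∃ y : ℤ → ℂ, j ∈ Finset.Icc (-(M : ℤ)) M →
      (∀ l, ‖y l‖ ≤ A * Real.exp (-ρ * |(l : ℝ)|)) ∧
      ∀ t, HasSum (fun l : ℤ => y l * e ((l + (s + j : ℤ)) * ψ t))
        (e ((s + j : ℤ) * φ t) - e ((s + j : ℤ) * ψ t)) := by
    intro j
    by_cases hj : j ∈ Finset.Icc (-(M : ℤ)) M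
    · obtain ⟨y, h⟩ := hy (s + j) (by
        rw [add_sub_cancel_left]; exact abs_le.2 (Finset.mem_Icc.1 hj))
      exact ⟨y, fun _ => h⟩
    · exact ⟨0, fun h => absurd h hj⟩
  choose y hy using hy'
  refine ⟨fun l => ∑ j ∈ Finset.Icc (-(M : ℤ)) M,
    c j * ((if l = s + j then 1 else 0) + y j (l - (s + j))), ⟨fun t => ?_, fun l hl => ?_⟩⟩
  · have hj : ∀ j ∈ Finset.Icc (-(M : ℤ)) M, HasSum (fun l : ℤ =>
        c j * ((if l = s + j then 1 else 0) + y j (l - (s + j))) * e (l * ψ t))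
        (c j * e ((s + j : ℤ) * φ t)) := by
      intro j hj
      have h1 : HasSum (fun l : ℤ => (if l = s + j then (1 : ℂ) else 0) * e (l * ψ t))
          (e ((s + j : ℤ) * ψ t)) := by
        have := hasSum_ite_eq (s + j) (e ((s + j : ℤ) * ψ t))
        refine (congrArg (HasSum · _) (funext fun l => ?_)).mp this
        split_ifs with h
        · rw [h, one_mul]
        · rw [zero_mul]
      have h2 : HasSum (fun l : ℤ => y j (l - (s + j)) * e (l * ψ t))
          (e ((s + j : ℤ) * φ t) - e ((s + j : ℤ) * ψ t)) := by
        have := (Equiv.subRight (s + j)).hasSum_iff.2 ((hy j hj).2 t)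
        refine (congrArg (HasSum · _) (funext fun l => ?_)).mp this
        simp only [Function.comp_apply, Equiv.subRight_apply]
        push_cast
        rw [sub_add_cancel]
      have h3 := (h1.add h2).mul_left (c j)
      rw [add_sub_cancel] at h3
      simpa only [← add_mul, mul_assoc] using h3
    have h4 := hasSum_sum hj
    have h5 : e (s * φ t) * trigPoly M c (φ t)
        = ∑ j ∈ Finset.Icc (-(M : ℤ)) M, c j * e ((s + j : ℤ) * φ t) := by
      rw [trigPoly, Finset.mul_sum]
      refine Finset.sum_congr rfl fun j _ => ?_
      rw [mul_left_comm, ← e_add]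
      push_cast
      rw [add_mul]
    rw [h5]
    simpa only [← Finset.sum_mul] using h4
  · have hj : ∀ j ∈ Finset.Icc (-(M : ℤ)) M,
        ‖c j * ((if l = s + j then 1 else 0) + y j (l - (s + j)))‖
          ≤ B * (A * Real.exp (ρ * M)) * Real.exp (-ρ * |(l : ℝ) - s|) := by
      intro j hj
      have hne : l ≠ s + j := by
        rintro rfl
        rw [add_sub_cancel_left] at hl
        exact absurd (abs_le.2 (Finset.mem_Icc.1 hj)) (not_le.2 hl)
      have hjM := abs_le_of_mem_Icc hj
      rw [if_neg hne, zero_add, norm_mul, mul_assoc B]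
      refine mul_le_mul (hB j) (((hy j hj).1 _).trans ?_) (norm_nonneg _) hB0
      rw [mul_assoc A, ← Real.exp_add]
      gcongr
      push_cast
      have : |(l : ℝ) - s| ≤ |(l : ℝ) - (s + j)| + |(j : ℝ)| := by
        have := abs_add_le ((l : ℝ) - (s + j)) j
        rwa [show (l : ℝ) - (s + j) + j = l - s by ring] at this
      nlinarith
    refine (norm_sum_le_of_le _ hj).trans (le_of_eq ?_)
    rw [Finset.sum_const, Int.card_Icc, nsmul_eq_mul]
    have : (((M : ℤ) + 1 - -(M : ℤ)).toNat : ℝ) = 2 * M + 1 := by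
      rw [show (M : ℤ) + 1 - -(M : ℤ) = ((2 * M + 1 : ℕ) : ℤ) by push_cast; ring, Int.toNat_natCast]
      push_cast; ring
    rw [this]
    ring

/-- The number of periods of the phase of a periodic signal is an integer. -/
theorem exists_numPeriods_eq_nat {M : ℕ} {θ f₀ f₁ f : ℝ → ℝ} (hθ : IsSparsePhase M θ)
    (hL : 1 ≤ numPeriods θ) (hf₀ : Function.Periodic f₀ 1) (hf₁ : Function.Periodic f₁ 1)
    (hpos : ∀ t, 0 < f₁ t) (hf : ∀ t, f t = f₀ t + f₁ t * Real.cos (θ t))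
    (hper : Function.Periodic f 1) : ∃ N : ℕ, numPeriods θ = N := by
  have hcos : ∀ t, Real.cos (θ t + (θ 1 - θ 0)) = Real.cos (θ t) := by
    intro t
    have h1 := hper t
    rw [hf, hf, hf₀, hf₁, hθ.add_one] at h1
    exact mul_left_cancel₀ (hpos t).ne' (add_left_cancel h1)
  have hpi := Real.pi_pos
  have hdiff : θ 1 - θ 0 = numPeriods θ * (2 * Real.pi) := by
    rw [numPeriods, div_mul_cancel₀ _ (by positivity)]
  -- With at least one period, `θ` attains a multiple of `2π` on `[0,1]`. There `cos θ = 1`, so the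
  -- shift by `2πL` also gives cosine 1, which forces `L` to be an integer.
  set n : ℤ := ⌈θ 0 / (2 * Real.pi)⌉ with hn
  have hmem : n * (2 * Real.pi) ∈ Icc (θ 0) (θ 1) := by
    constructor
    · rw [← div_le_iff₀ (by positivity)]; exact Int.le_ceil _
    · have : (n : ℝ) ≤ θ 0 / (2 * Real.pi) + 1 := (Int.ceil_lt_add_one _).le
      have h2 : n * (2 * Real.pi) ≤ (θ 0 / (2 * Real.pi) + 1) * (2 * Real.pi) := by gcongr
      rw [add_mul, div_mul_cancel₀ _ (by positivity)] at h2
      nlinarith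
  obtain ⟨t, _, ht⟩ := intermediate_value_Icc zero_le_one hθ.differentiable.continuous.continuousOn
    hmem
  have h3 := hcos t
  rw [ht, add_comm, Real.cos_add_int_mul_two_pi, Real.cos_int_mul_two_pi,
    Real.cos_eq_one_iff] at h3
  obtain ⟨k, hk⟩ := h3
  rw [hdiff] at hk
  have hk' : numPeriods θ = k := (mul_right_cancel₀ (by positivity) hk).symm
  have hk0 : 0 ≤ k := by
    have : (0 : ℝ) ≤ k := by rw [← hk']; linarith
    exact_mod_cast this
  refine ⟨k.toNat, ?_⟩
  rw [hk']
  exact_mod_cast (Int.toNat_of_nonneg hk0).symm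

/-! ### Feasible vectors from infinite expansions. -/

/-- Interpolation of a high-frequency mode by low-frequency modes at finitely many points. -/
theorem exists_interpolating_modes {ρ : ℝ} (hρ : 0 < ρ) :
    ∃ η : ℝ, 0 < η ∧ ∀ (n : ℕ) (p : Fin n → ℝ) (l : ℤ), η * n ≤ |(l : ℝ)| →
      ∃ w : ℤ → ℂ, (∀ k : ℤ, k ∉ Finset.Ioo (-(n : ℤ)) n → w k = 0) ∧
        (∀ j, ∑ k ∈ Finset.Ioo (-(n : ℤ)) n, w k * e (k * p j) = e (l * p j)) ∧
        ∑ k ∈ Finset.Ioo (-(n : ℤ)) n, ‖w k‖ ≤ Real.exp (ρ * |(l : ℝ)|) := by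
  set τ : ℝ := min 1 (ρ / 4) with hτ
  have hτ0 : 0 < τ := lt_min one_pos (by positivity)
  have hτ1 : τ ≤ 1 := min_le_left _ _
  have hτρ : 1 + 2 * τ ≤ Real.exp (ρ / 2) := by
    have h1 : τ ≤ ρ / 4 := min_le_right _ _
    have h2 := Real.add_one_le_exp (ρ / 2)
    linarith
  have hlog : 0 ≤ Real.log τ⁻¹ := Real.log_nonneg ((one_le_inv₀ hτ0).2 hτ1)
  -- The choice of `τ` bounds `(1 + 2τ)^{|l|}` by `e^{ρ|l|/2}`, and this threshold bounds `τ^{-n}`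
  -- by the same quantity.
  refine ⟨Real.log τ⁻¹ / (ρ / 2) + 1, by positivity, fun n p l hl => ?_⟩
  -- The sign reduces negative modes to nonnegative powers of the conjugate points.
  obtain ⟨ς, hς, hςl⟩ : ∃ ς : ℤ, (ς = 1 ∨ ς = -1) ∧ l = ς * (l.natAbs : ℤ) := by
    rcases Int.natAbs_eq l with h | h
    · exact ⟨1, Or.inl rfl, by omega⟩
    · exact ⟨-1, Or.inr rfl, by omega⟩
  have hςς : ς * ς = 1 := by rcases hς with rfl | rfl <;> rfl
  set z : ℕ → ℂ := fun j => if h : j < n then e (ς * p ⟨j, h⟩) else 1 with hz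
  have hz1 : ∀ j, ‖z j‖ = 1 := by
    intro j
    simp only [hz]
    split_ifs
    · exact norm_e _
    · exact norm_one
  obtain ⟨P, hP0, hPz, hPb⟩ := exists_interpolating_polynomial z hz1 hτ0 hτ1 n l.natAbs
  set w : ℤ → ℂ := fun k => if 0 ≤ ς * k then P.coeff (ς * k).toNat else 0 with hw
  have hwi : ∀ i : ℕ, w (ς * i) = P.coeff i := by
    intro i
    simp only [hw, ← mul_assoc, hςς, one_mul]
    rw [if_pos (Int.natCast_nonneg i), Int.toNat_natCast]
  have hsum : ∀ {α : Type} [AddCommMonoid α] (F : ℤ → α), (∀ k, w k = 0 → F k = 0) →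
      ∑ k ∈ Finset.Ioo (-(n : ℤ)) n, F k = ∑ i ∈ Finset.range n, F (ς * i) := by
    intro α _ F hF
    have hinj : ∀ i ∈ Finset.range n, ∀ i' ∈ Finset.range n,
        ς * (i : ℤ) = ς * (i' : ℤ) → i = i' := by
      intro i _ i' _ h
      have := congrArg (ς * ·) h
      simp only [← mul_assoc, hςς, one_mul] at this
      exact_mod_cast this
    rw [← Finset.sum_image (f := F) (g := fun i : ℕ => ς * (i : ℤ)) hinj]
    refine (Finset.sum_subset ?_ ?_).symm
    · intro k hk
      obtain ⟨i, hi, rfl⟩ := Finset.mem_image.1 hk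
      rw [Finset.mem_range] at hi
      rw [Finset.mem_Ioo]
      rcases hς with rfl | rfl <;> omega
    · intro k hk hk'
      refine hF k ?_
      simp only [hw]
      split_ifs with h0
      · exfalso
        refine hk' (Finset.mem_image.2 ⟨(ς * k).toNat, ?_, ?_⟩)
        · rw [Finset.mem_range]
          rw [Finset.mem_Ioo] at hk
          rcases hς with rfl | rfl <;> omega
        · rw [Int.toNat_of_nonneg h0, ← mul_assoc, hςς, one_mul]
      · rfl
  refine ⟨w, ?_, ?_, ?_⟩
  · intro k hk
    simp only [hw]
    split_ifs with h0
    · refine hP0 _ ?_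
      rw [Finset.mem_Ioo] at hk
      rcases hς with rfl | rfl <;> omega
    · rfl
  · intro j
    rw [hsum (fun k => w k * e (k * p j)) (fun k hk => by rw [hk, zero_mul])]
    have h1 := hPz j j.2
    have hzj : z j = e (ς * p j) := by simp [hz]
    have hdeg : P.natDegree < n := by
      by_contra hle
      have h2 := hP0 _ (not_lt.1 hle)
      rw [Polynomial.coeff_natDegree, Polynomial.leadingCoeff_eq_zero] at h2
      rw [h2, Polynomial.natDegree_zero] at hle
      exact hle (j.pos)
    rw [Polynomial.eval_eq_sum_range' hdeg] at h1
    have h2 : e (l * p j) = z j ^ l.natAbs := by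
      rw [hzj, ← zpow_natCast, ← e_mul_intCast, ← mul_assoc]
      congr 2
      conv_lhs => rw [hςl]
      push_cast
      ring
    rw [h2, ← h1]
    refine Finset.sum_congr rfl fun i _ => ?_
    rw [hwi, hzj, ← zpow_natCast, ← e_mul_intCast, ← mul_assoc]
    congr 3
    push_cast
    ring
  · rw [hsum (fun k => ‖w k‖) (fun k hk => by rw [hk, norm_zero])]
    simp_rw [hwi]
    refine hPb.trans ?_
    have hl' : (l.natAbs : ℝ) = |(l : ℝ)| := by
      rw [← Int.cast_abs, Int.abs_eq_natAbs, Int.cast_natCast]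
    have h1 : τ⁻¹ ^ n ≤ Real.exp (ρ / 2 * |(l : ℝ)|) := by
      rw [← Real.log_le_iff_le_exp (by positivity), Real.log_pow]
      have h2 : (Real.log τ⁻¹ / (ρ / 2)) * n ≤ |(l : ℝ)| := by
        have : (0 : ℝ) ≤ n := n.cast_nonneg
        nlinarith
      rw [div_mul_eq_mul_div, div_le_iff₀ (by positivity)] at h2
      linarith
    have h3 : (1 + 2 * τ) ^ l.natAbs ≤ Real.exp (ρ / 2 * |(l : ℝ)|) := by
      rw [mul_comm (ρ / 2), ← hl', Real.exp_nat_mul]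
      gcongr
    calc _ ≤ Real.exp (ρ / 2 * |(l : ℝ)|) * Real.exp (ρ / 2 * |(l : ℝ)|) := by gcongr
      _ = _ := by rw [← Real.exp_add]; congr 1; ring

/-- A sequence of modes can be truncated to a finite set of modes without changing the values at
given points, if the remaining modes can be interpolated at these points. -/
theorem exists_truncation {ι : Type*} (E : Finset ℤ) (X : ℤ → ℂ) (p : ι → ℝ) (F : ι → ℂ)
    (hX : ∀ j, HasSum (fun l : ℤ => X l * e (l * p j)) (F j)) {c u : ℤ → ℝ} {U : ℝ}
    (hw : ∀ l ∉ E, ∃ w : ℤ → ℂ, (∀ j, ∑ k ∈ E, w k * e (k * p j) = e (l * p j)) ∧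
      ∑ k ∈ E, ‖w k‖ ≤ c l)
    (hu : HasSum u U) (hu0 : ∀ l, 0 ≤ u l) (hcu : ∀ l ∉ E, ‖X l‖ * c l ≤ u l) :
    ∃ x : E → ℂ, (∀ j, ∑ k : E, x k * e ((k : ℤ) * p j) = F j) ∧ ∑ k : E, ‖x k - X k‖ ≤ U := by
  have hw' : ∀ l, ∃ w : ℤ → ℂ, l ∉ E → (∀ j, ∑ k ∈ E, w k * e (k * p j) = e (l * p j)) ∧
      ∑ k ∈ E, ‖w k‖ ≤ c l := by
    intro l
    by_cases hl : l ∈ E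
    · exact ⟨0, fun h => absurd hl h⟩
    · obtain ⟨w, h⟩ := hw l hl
      exact ⟨w, fun _ => h⟩
  choose w hw using hw'
  -- `v l k` is the share of the discarded mode `l` that is moved to the retained mode `k`.
  set v : ℤ → ℤ → ℂ := fun l k => if l ∈ E then 0 else X l * w l k with hv
  have hvu : ∀ l, ∑ k ∈ E, ‖v l k‖ ≤ u l := by
    intro l
    by_cases hl : l ∈ E
    · simp only [hv, if_pos hl, norm_zero, Finset.sum_const_zero]
      exact hu0 l
    · simp only [hv, if_neg hl, norm_mul, ← Finset.mul_sum]
      exact (mul_le_mul_of_nonneg_left (hw l hl).2 (norm_nonneg _)).trans (hcu l hl)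
  have hvs : ∀ k ∈ E, Summable fun l => ‖v l k‖ := fun k hk =>
    Summable.of_nonneg_of_le (fun _ => norm_nonneg _)
      (fun l => (Finset.single_le_sum (f := fun k => ‖v l k‖) (fun _ _ => norm_nonneg _) hk).trans
        (hvu l)) hu.summable
  refine ⟨fun k => X k + ∑' l, v l k, fun j => ?_, ?_⟩
  · rw [Finset.sum_coe_sort E (fun k => (X k + ∑' l, v l k) * e (k * p j))]
    simp only [add_mul, Finset.sum_add_distrib]
    have h1 : HasSum (fun l => ∑ k ∈ E, v l k * e (k * p j))
        (∑ k ∈ E, (∑' l, v l k) * e (k * p j)) :=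
      hasSum_sum fun k hk => (hvs k hk).of_norm.hasSum.mul_right _
    have h2 : HasSum (fun l => if l ∈ E then X l * e (l * p j) else 0)
        (∑ k ∈ E, X k * e (k * p j)) := by
      rw [← Finset.sum_congr rfl fun k hk => if_pos (c := k ∈ E) (e := 0) hk]
      exact hasSum_sum_of_ne_finset_zero fun l hl => if_neg hl
    refine (h2.add h1).unique ?_
    have h3 : (fun l => (if l ∈ E then X l * e (l * p j) else 0) + ∑ k ∈ E, v l k * e (k * p j))
        = fun l => X l * e (l * p j) := by
      funext l
      by_cases hl : l ∈ E
      · simp [hv, hl]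
      · simp only [hv, if_neg hl, zero_add, mul_assoc, ← Finset.mul_sum, (hw l hl).1]
    rw [h3]
    exact hX j
  · rw [Finset.sum_coe_sort E (fun k => ‖X k + ∑' l, v l k - X k‖)]
    simp only [add_sub_cancel_left]
    calc _ ≤ ∑ k ∈ E, ∑' l, ‖v l k‖ :=
          Finset.sum_le_sum fun k hk => norm_tsum_le_tsum_norm (hvs k hk)
      _ = ∑' l, ∑ k ∈ E, ‖v l k‖ := (Summable.tsum_finsetSum hvs).symm
      _ ≤ ∑' l, u l := Summable.tsum_le_tsum hvu (summable_sum hvs) hu.summable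
      _ = U := hu.tsum_eq

/-- The sum of `e^{-ρ|l|}` over the integers. -/
def expSum (ρ : ℝ) : ℝ := ∑' l : ℤ, Real.exp (-ρ * |(l : ℝ)|)

theorem hasSum_exp_sub {ρ : ℝ} (hρ : 0 < ρ) (s : ℤ) :
    HasSum (fun l : ℤ => Real.exp (-ρ * |(l : ℝ) - s|)) (expSum ρ) := by
  have := (Equiv.subRight s).hasSum_iff.2 (summable_exp_neg_mul_abs hρ).hasSum
  simpa [Function.comp_def, expSum] using this

theorem sum_exp_sub_le {ρ : ℝ} (hρ : 0 < ρ) (s : ℤ) (E : Finset ℤ) :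
    ∑ l ∈ E, Real.exp (-ρ * |(l : ℝ) - s|) ≤ expSum ρ :=
  sum_le_hasSum E (fun _ _ => (Real.exp_pos _).le) (hasSum_exp_sub hρ s)

theorem expSum_nonneg (ρ : ℝ) : 0 ≤ expSum ρ := tsum_nonneg fun _ => (Real.exp_pos _).le

theorem exists_mul_exp_neg_le (C : ℝ) {ρ ε : ℝ} (hρ : 0 < ρ) (hε : 0 < ε) :
    ∃ R : ℝ, 0 < R ∧ ∀ r, R ≤ r → C * Real.exp (-ρ * r) ≤ ε := by
  refine ⟨|C| / (ε * ρ) + 1, by positivity, fun r hr => ?_⟩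
  have h1 := Real.add_one_le_exp (ρ * r)
  have h2 : |C| / (ε * ρ) ≤ r := by linarith
  rw [div_le_iff₀ (by positivity)] at h2
  rw [neg_mul, Real.exp_neg, ← div_eq_mul_inv, div_le_iff₀ (Real.exp_pos _)]
  nlinarith [le_abs_self C]

theorem le_abs_of_notMem_modes {Nb : ℕ} (hNb : Even Nb) {l : ℤ} (hl : l ∉ modes Nb) :
    (Nb : ℝ) / 2 ≤ |(l : ℝ)| := by
  obtain ⟨h, rfl⟩ := hNb
  have h1 : (h : ℤ) ≤ |l| := by
    simp only [modes, Finset.mem_Ioc] at hl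
    rcases abs_cases l with h2 | h2 <;> omega
  have h2 : (h : ℝ) ≤ |(l : ℝ)| := by exact_mod_cast h1
  push_cast
  linarith

theorem Phi_mulVec {Ns Nb : ℕ} (ν : ℝ) (t : Fin Ns → ℝ) (θ : ℝ → ℝ) (x : modes Nb → ℂ)
    (j : Fin Ns) : (Phi Nb ν t θ).mulVec x j =
      (Real.sqrt (deriv (normPhase θ) (t j) / ν) : ℂ) *
        ∑ k : modes Nb, x k * e ((k : ℤ) * normPhase θ (t j)) := by
  rw [Matrix.mulVec, dotProduct, Finset.mul_sum]
  refine Finset.sum_congr rfl fun k _ => ?_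
  rw [Phi]
  ring

/-! ### Recovery of the coefficients and separation of the clusters. -/

/-- A signal whose coefficients concentrate at three centers is recovered by `ℓ¹` minimization,
with an error in `ℓ¹` that is small compared with the size of the tails of the coefficients. -/
theorem exists_l1_recovery (M : ℕ) {K ρ ε : ℝ} (hK : 0 ≤ K) (hρ : 0 < ρ) (hε : 0 < ε) :
    ∃ η₀ η₁ η₂ : ℝ, 0 < η₀ ∧ 0 < η₁ ∧ 16 ≤ η₂ ∧
      ∀ (Θ f : ℝ → ℝ) (N : ℕ) (Y : Fin 3 → ℤ → ℂ) (G : Fin 3 → ℝ → ℂ) (s : Fin 3 → ℤ) (D : ℝ),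
        (∀ i, |(s i : ℝ)| ≤ N) → 0 ≤ D →
        (∀ i, ExpandsAt (normPhase Θ) (G i) (Y i) (s i) M (K * D) ρ) →
        (∀ t, (f t : ℂ) = ∑ i, G i t) → η₀ ≤ N →
        ∀ (Ns Nb : ℕ) (ν : ℝ) (t : Fin Ns → ℝ) (S : ℕ) (x : modes Nb → ℂ),
          Even Nb → η₂ * (N + Ns) ≤ Nb →
          ric (Phi Nb ν t Θ) (3 * S) + 3 * ric (Phi Nb ν t Θ) (4 * S) < 2 → η₁ ≤ S →
          IsL1Minimizer (Phi Nb ν t Θ) (data ν t f Θ) x →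
          ∑ k : modes Nb, ‖x k - ∑ i, Y i k‖ ≤ ε * D := by
  set A := expSum (ρ / 4) with hA
  have hA0 : 0 ≤ A := expSum_nonneg _
  obtain ⟨R₀, hR₀, hexp⟩ := exists_mul_exp_neg_le (21 * K * A) (half_pos hρ) (half_pos hε)
  obtain ⟨ηi, hηi, hinterp⟩ := exists_interpolating_modes (half_pos hρ)
  set R : ℕ := max ⌈R₀⌉₊ M with hR
  have hRR : R₀ ≤ R := (Nat.le_ceil _).trans (by exact_mod_cast le_max_left _ _)
  have hRM : M ≤ R := le_max_right _ _
  -- Three windows of `2R + 1` modes and the requirement `10|T| ≤ S` give `30(2R + 1)`. The last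
  -- constant makes `Nb/2` dominate each of `8N`, `ηi Ns` and `Ns`.
  refine ⟨max R₀ (M + 1), 30 * (2 * R + 1), 18 + 2 * ηi, lt_max_of_lt_left hR₀, by positivity,
    by linarith, ?_⟩
  intro Θ f N Y G s D hs hD hY hf hN Ns Nb ν t S x hNb hNbη hric hS hx
  have hNR : R₀ ≤ N := (le_max_left _ _).trans hN
  have hNM : (M : ℝ) + 1 ≤ N := (le_max_right _ _).trans hN
  have hN0 : (0 : ℝ) ≤ N := N.cast_nonneg
  have hNs0 : (0 : ℝ) ≤ Ns := Ns.cast_nonneg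
  have hηN : 0 ≤ ηi * N := by positivity
  have hηNs : 0 ≤ ηi * Ns := by positivity
  have hNb1 : 8 * (N : ℝ) ≤ Nb / 2 := by linarith
  have hNb2 : ηi * Ns ≤ (Nb : ℝ) / 2 := by linarith
  have hNb3 : (Ns : ℝ) ≤ Nb / 2 := by linarith
  set U := 3 * (K * D) * Real.exp (-ρ * N) * A with hU
  have hX : ∀ j : Fin Ns, HasSum (fun l : ℤ => (∑ i, Y i l) * e (l * normPhase Θ (t j)))
      (f (t j) : ℂ) := by
    intro j
    rw [hf]
    simpa only [← Finset.sum_mul] using hasSum_sum fun i _ => (hY i).hasSum (t j)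
  have hw : ∀ l ∉ modes Nb, ∃ w : ℤ → ℂ,
      (∀ j : Fin Ns, ∑ k ∈ modes Nb, w k * e (k * normPhase Θ (t j)) = e (l * normPhase Θ (t j))) ∧
      ∑ k ∈ modes Nb, ‖w k‖ ≤ Real.exp (ρ / 2 * |(l : ℝ)|) := by
    intro l hl
    obtain ⟨w, hw0, hw1, hw2⟩ := hinterp Ns (fun j => normPhase Θ (t j)) l
      (hNb2.trans (le_abs_of_notMem_modes hNb hl))
    have hsub : Finset.Ioo (-(Ns : ℤ)) Ns ⊆ modes Nb := by
      intro k hk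
      obtain ⟨h, rfl⟩ := hNb
      push_cast at hNb3
      have : Ns ≤ h := by
        have : (Ns : ℝ) ≤ h := by linarith
        exact_mod_cast this
      rw [Finset.mem_Ioo] at hk
      simp only [modes, Finset.mem_Ioc]
      omega
    refine ⟨w, fun j => ?_, ?_⟩
    · rw [← hw1 j]
      exact (Finset.sum_subset hsub fun k _ hk => by rw [hw0 k hk, zero_mul]).symm
    · refine le_trans (le_of_eq ?_) hw2
      exact (Finset.sum_subset hsub fun k _ hk => by rw [hw0 k hk, norm_zero]).symm
  -- Decay `e^{-ρ(|l| - N)}` times interpolation cost `e^{ρ|l|/2}`: since `|l| ≥ 8N`, a quarter of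
  -- the rate pays for the shift by `N` with `e^{-ρN}` to spare, and another quarter is left for
  -- summation.
  have hu : ∀ l ∉ modes Nb, ‖∑ i, Y i l‖ * Real.exp (ρ / 2 * |(l : ℝ)|)
      ≤ 3 * (K * D) * Real.exp (-ρ * N) * Real.exp (-(ρ / 4) * |(l : ℝ) - (0 : ℤ)|) := by
    intro l hl
    have hlN := hNb1.trans (le_abs_of_notMem_modes hNb hl)
    have hi : ∀ i ∈ Finset.univ, ‖Y i l‖ ≤ K * D * Real.exp (-ρ * (|(l : ℝ)| - N)) := by
      intro i _
      have h1 : |(l : ℝ)| - N ≤ |(l : ℝ) - s i| := by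
        have := abs_sub_abs_le_abs_sub (l : ℝ) (s i)
        have := hs i
        linarith
      refine ((hY i).norm_le l ?_).trans ?_
      · have h2 : (M : ℝ) < |(l : ℝ) - s i| := by linarith
        exact_mod_cast h2
      · gcongr ?_ * Real.exp ?_
        nlinarith
    have h2 := norm_sum_le_of_le _ hi
    rw [Finset.sum_const, Finset.card_univ, Fintype.card_fin, nsmul_eq_mul] at h2
    calc _ ≤ ((3 : ℕ) : ℝ) * (K * D * Real.exp (-ρ * (|(l : ℝ)| - N))) *
          Real.exp (ρ / 2 * |(l : ℝ)|) := by gcongr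
      _ = 3 * (K * D) * Real.exp (ρ * N - ρ / 2 * |(l : ℝ)|) := by
          rw [mul_assoc, mul_assoc (K * D), ← Real.exp_add, ← mul_assoc]
          push_cast
          ring_nf
      _ ≤ 3 * (K * D) * Real.exp (-ρ * N + -(ρ / 4) * |(l : ℝ)|) := by
          gcongr
          nlinarith
      _ = _ := by rw [Real.exp_add, Int.cast_zero, sub_zero]; ring
  obtain ⟨x', hx', hx'U⟩ := exists_truncation (modes Nb) (fun l => ∑ i, Y i l)
    (fun j => normPhase Θ (t j)) (fun j => (f (t j) : ℂ)) (U := U) hX hw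
    ((hasSum_exp_sub (by positivity) 0).mul_left _) (fun l => by positivity) hu
  -- All coefficients that need not be small with `D` lie in `T`, because `R ≥ M`; recovery only
  -- charges those outside.
  set T : Finset (modes Nb) := Finset.univ.filter fun k => ∃ i, |(k : ℤ) - s i| ≤ R with hT
  have hTcard : T.card ≤ 3 * (2 * R + 1) := by
    rw [← Finset.card_map (Function.Embedding.subtype _)]
    have hsub : T.map (Function.Embedding.subtype _) ⊆
        (Finset.univ : Finset (Fin 3)).biUnion fun i => Finset.Icc (s i - R) (s i + R) := by
      intro k hk
      obtain ⟨k', hk', rfl⟩ := Finset.mem_map.1 hk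
      obtain ⟨i, hi⟩ := (Finset.mem_filter.1 hk').2
      refine Finset.mem_biUnion.2 ⟨i, Finset.mem_univ _, Finset.mem_Icc.2 ?_⟩
      have := abs_le.1 hi
      simp only [Function.Embedding.subtype_apply]
      omega
    refine (Finset.card_le_card hsub).trans ?_
    refine (Finset.card_biUnion_le_card_mul _ _ (2 * R + 1) fun i _ => ?_).trans (by simp)
    rw [Int.card_Icc]
    omega
  have hfeas : (Phi Nb ν t Θ).mulVec x' = data ν t f Θ := by
    funext j
    rw [Phi_mulVec, hx', data]
  have hS' : 30 * (2 * R + 1) ≤ S := by exact_mod_cast hS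
  have hcs := sum_norm_sub_le_of_isL1Minimizer (Phi Nb ν t Θ) (data ν t f Θ) (S := S) (by omega)
    hric hx hfeas T (by omega)
  have hXT : ∑ k ∈ Tᶜ, ‖∑ i, Y i (k : ℤ)‖ ≤ 3 * (K * D) * Real.exp (-(ρ / 2) * R) * A := by
    calc ∑ k ∈ Tᶜ, ‖∑ i, Y i (k : ℤ)‖
        ≤ ∑ k ∈ Tᶜ, ∑ i, K * D * Real.exp (-(ρ / 2) * R) *
            Real.exp (-(ρ / 4) * |((k : ℤ) : ℝ) - s i|) := by
          refine Finset.sum_le_sum fun k hk => norm_sum_le_of_le _ fun i _ => ?_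
          have hki : (R : ℤ) < |(k : ℤ) - s i| := by
            rw [Finset.mem_compl, hT, Finset.mem_filter] at hk
            push Not at hk
            exact hk (Finset.mem_univ _) i
          have hki' : (R : ℝ) < |((k : ℤ) : ℝ) - s i| := by exact_mod_cast hki
          refine ((hY i).norm_le k (lt_of_le_of_lt (by exact_mod_cast hRM) hki)).trans ?_
          rw [mul_assoc (K * D) (Real.exp _) (Real.exp _), ← Real.exp_add]
          gcongr ?_ * Real.exp ?_
          nlinarith
      _ ≤ ∑ k : modes Nb, ∑ i, K * D * Real.exp (-(ρ / 2) * R) *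
            Real.exp (-(ρ / 4) * |((k : ℤ) : ℝ) - s i|) :=
          Finset.sum_le_sum_of_subset_of_nonneg (Finset.subset_univ _) fun _ _ _ => by positivity
      _ = ∑ i, K * D * Real.exp (-(ρ / 2) * R) *
            ∑ k ∈ modes Nb, Real.exp (-(ρ / 4) * |(k : ℝ) - s i|) := by
          rw [Finset.sum_comm]
          refine Finset.sum_congr rfl fun i _ => ?_
          rw [Finset.mul_sum]
          exact Finset.sum_coe_sort (modes Nb) fun k : ℤ => K * D * Real.exp (-(ρ / 2) * R) *
            Real.exp (-(ρ / 4) * |(k : ℝ) - s i|)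
      _ ≤ ∑ _i : Fin 3, K * D * Real.exp (-(ρ / 2) * R) * A := by
          refine Finset.sum_le_sum fun i _ => ?_
          gcongr
          exact sum_exp_sub_le (by positivity) _ _
      _ = _ := by
          rw [Finset.sum_const, Finset.card_univ, Fintype.card_fin, nsmul_eq_mul]
          push_cast
          ring
  have hx'T : ∑ k ∈ Tᶜ, ‖x' k‖ ≤ ∑ k ∈ Tᶜ, ‖∑ i, Y i (k : ℤ)‖ + U := by
    have h1 : ∑ k ∈ Tᶜ, ‖x' k - ∑ i, Y i (k : ℤ)‖ ≤ U :=
      (Finset.sum_le_sum_of_subset_of_nonneg (Finset.subset_univ _)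
        fun _ _ _ => norm_nonneg _).trans hx'U
    refine le_trans ?_ (add_le_add_right h1 _)
    rw [← Finset.sum_add_distrib]
    refine Finset.sum_le_sum fun k _ => ?_
    have := norm_add_le (∑ i, Y i (k : ℤ)) (x' k - ∑ i, Y i (k : ℤ))
    rwa [add_sub_cancel] at this
  have hfin : ∑ k : modes Nb, ‖x k - ∑ i, Y i (k : ℤ)‖
      ≤ ∑ k : modes Nb, ‖x k - x' k‖ + ∑ k : modes Nb, ‖x' k - ∑ i, Y i (k : ℤ)‖ := by
    rw [← Finset.sum_add_distrib]
    exact Finset.sum_le_sum fun k _ => norm_sub_le_norm_sub_add_norm_sub _ _ _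
  have hU' : U ≤ 3 * (K * D) * Real.exp (-(ρ / 2) * N) * A := by
    rw [hU]
    gcongr ?_ * Real.exp ?_ * ?_
    nlinarith
  -- The total is 18 times the window tail plus 7 times the truncation error. Each is at most half
  -- of `εD`, since `hexp` was set up with `21 = 7·3`.
  have h1 := mul_le_mul_of_nonneg_right (hexp R hRR) hD
  have h2 := mul_le_mul_of_nonneg_right (hexp N hNR) hD
  have hnn : 0 ≤ 3 * (K * D) * Real.exp (-(ρ / 2) * R) * A := by positivity
  calc _ ≤ _ := hfin
    _ ≤ 6 * (3 * (K * D) * Real.exp (-(ρ / 2) * R) * A + U) + U := by linarith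
    _ ≤ _ := by linarith

/-- The window around a shift isolates the component centered there. -/
theorem norm_shifted_sub_le {M N Nb : ℕ} {Θ : ℝ → ℝ} {Y : Fin 3 → ℤ → ℂ} {G : Fin 3 → ℝ → ℂ}
    {s : Fin 3 → ℤ} {A ρ D₀ : ℝ} (hA : 0 ≤ A) (hρ : 0 < ρ)
    (hY : ∀ i, ExpandsAt (normPhase Θ) (G i) (Y i) (s i) M A ρ)
    {i : Fin 3} (hsep : ∀ j ≠ i, (N : ℝ) ≤ |(s j : ℝ) - s i|) {S : ℝ} (hS : |(s i : ℝ) - S| ≤ D₀)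
    (hSL : |S| ≤ numPeriods Θ) (hL : |numPeriods Θ - N| ≤ D₀) (hND : 6 * D₀ ≤ N)
    (hNM : 4 * (M : ℝ) + 4 ≤ N) (hNb : Even Nb) (hNNb : 8 * (N : ℝ) ≤ Nb) (x : modes Nb → ℂ)
    (t : ℝ) :
    ‖shifted Θ x S t - G i t * e (-(S * normPhase Θ t))‖
      ≤ ∑ k : modes Nb, ‖x k - ∑ i, Y i k‖
        + 3 * (A * Real.exp (-(ρ / 8) * N)) * expSum (ρ / 4) := by
  set L := numPeriods Θ with hLdef
  have hL' := abs_le.1 hL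
  have hM0 : (0 : ℝ) ≤ M := M.cast_nonneg
  have hL0 : 0 < L := by linarith
  set W : ℤ → ℂ := fun l => cutoff (((l : ℝ) - S) / L) with hW
  have hW1 : ∀ l : ℤ, |(l : ℝ) - S| < L / 2 → W l = 1 := by
    intro l hl
    have := abs_lt.1 hl
    simp only [hW, cutoff]
    refine Set.indicator_of_mem (Set.mem_Ioo.2 ⟨?_, ?_⟩) _
    · rw [lt_div_iff₀ hL0]; linarith
    · rw [div_lt_iff₀ hL0]; linarith
  have hW0 : ∀ l : ℤ, L / 2 ≤ |(l : ℝ) - S| → W l = 0 := by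
    intro l hl
    simp only [hW, cutoff]
    refine Set.indicator_of_notMem (fun h => ?_) _
    have h1 := h.1
    have h2 := h.2
    rw [lt_div_iff₀ hL0] at h1
    rw [div_lt_iff₀ hL0] at h2
    have := abs_lt.2 (show -(L / 2) < (l : ℝ) - S ∧ (l : ℝ) - S < L / 2 by
      constructor <;> linarith)
    linarith
  have hWn : ∀ l : ℤ, ‖W l‖ ≤ 1 := by
    intro l
    rcases lt_or_ge |(l : ℝ) - S| (L / 2) with h | h
    · rw [hW1 l h, norm_one]
    · rw [hW0 l h, norm_zero]; exact zero_le_one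
  set E : ℤ → ℂ := fun l => e (((l : ℝ) - S) * normPhase Θ t) with hE
  -- The finite sum loses nothing: a mode outside `modes Nb` has `|l| ≥ 4N`, beyond the window,
  -- which reaches only to `3L/2`.
  have hsum1 : HasSum (fun l : ℤ => (∑ j, Y j l) * W l * E l)
      (∑ k : modes Nb, (∑ j, Y j (k : ℤ)) * W k * E k) := by
    rw [Finset.sum_coe_sort (modes Nb) fun k : ℤ => (∑ j, Y j k) * W k * E k]
    refine hasSum_sum_of_ne_finset_zero fun l hl => ?_
    have h1 := le_abs_of_notMem_modes hNb hl
    have h2 := abs_sub_abs_le_abs_sub (l : ℝ) S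
    rw [hW0 l (by linarith), mul_zero, zero_mul]
  have hsum2 : HasSum (fun l : ℤ => Y i l * E l) (G i t * e (-(S * normPhase Θ t))) := by
    have := ((hY i).hasSum t).mul_right (e (-(S * normPhase Θ t)))
    simpa only [mul_assoc, ← e_add, ← neg_mul, ← add_mul, ← sub_eq_add_neg] using this
  have hfar : ∀ (j : Fin 3) (l : ℤ), (N : ℝ) / 4 ≤ |(l : ℝ) - s j| →
      ‖Y j l‖ ≤ A * Real.exp (-(ρ / 8) * N) * Real.exp (-(ρ / 4) * |(l : ℝ) - s j|) := by
    intro j l hl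
    refine ((hY j).norm_le l ?_).trans ?_
    · have : (M : ℝ) < |(l : ℝ) - s j| := by linarith
      exact_mod_cast this
    · rw [mul_assoc, ← Real.exp_add]
      gcongr ?_ * Real.exp ?_
      nlinarith
  -- Inside the window the error is the other two clusters, outside it is cluster `i` itself. In
  -- either case the distance to the center concerned is at least `N/4`, because `6D₀ ≤ N`.
  have hbound : ∀ l : ℤ, ‖(∑ j, Y j l) * W l * E l - Y i l * E l‖
      ≤ ∑ j, A * Real.exp (-(ρ / 8) * N) * Real.exp (-(ρ / 4) * |(l : ℝ) - s j|) := by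
    intro l
    rw [← sub_mul, norm_mul, norm_e, mul_one]
    rcases lt_or_ge |(l : ℝ) - S| (L / 2) with h | h
    · rw [hW1 l h, mul_one, ← Finset.add_sum_erase _ _ (Finset.mem_univ i), add_sub_cancel_left]
      refine (norm_sum_le_of_le _ fun j hj => ?_).trans (Finset.sum_le_sum_of_subset_of_nonneg
        (Finset.erase_subset i _) fun _ _ _ => by positivity)
      refine hfar j l ?_
      have h1 := hsep j (Finset.ne_of_mem_erase hj)
      have h2 : |(s j : ℝ) - s i| ≤ |(l : ℝ) - s j| + |(l : ℝ) - S| + |(s i : ℝ) - S| := by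
        have h3 := abs_sub_le (s j : ℝ) l (s i)
        have h4 := abs_sub_le (l : ℝ) S (s i)
        rw [abs_sub_comm (s j : ℝ) l] at h3
        rw [abs_sub_comm S (s i : ℝ)] at h4
        linarith
      linarith
    · rw [hW0 l h, mul_zero, zero_sub, norm_neg]
      refine (hfar i l ?_).trans (Finset.single_le_sum (f := fun j => A * Real.exp (-(ρ / 8) * N) *
        Real.exp (-(ρ / 4) * |(l : ℝ) - s j|)) (fun _ _ => by positivity) (Finset.mem_univ i))
      have h4 := abs_sub_le (l : ℝ) (s i) S
      linarith
  have hmain := HasSum.norm_le_of_bounded (hsum1.sub hsum2)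
    (hasSum_sum (s := Finset.univ) fun j _ => (hasSum_exp_sub (by positivity) (s j)).mul_left
      (A * Real.exp (-(ρ / 8) * N))) hbound
  rw [Finset.sum_const, Finset.card_univ, Fintype.card_fin, nsmul_eq_mul] at hmain
  have hx : ‖shifted Θ x S t - ∑ k : modes Nb, (∑ j, Y j (k : ℤ)) * W k * E k‖
      ≤ ∑ k : modes Nb, ‖x k - ∑ i, Y i k‖ := by
    rw [shifted, ← Finset.sum_sub_distrib]
    refine norm_sum_le_of_le _ fun k _ => ?_
    change ‖x k * W k * E k - (∑ j, Y j (k : ℤ)) * W k * E k‖ ≤ _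
    rw [← sub_mul, ← sub_mul, norm_mul, norm_mul, norm_e, mul_one]
    exact mul_le_of_le_one_right (norm_nonneg _) (hWn _)
  refine (norm_sub_le_norm_sub_add_norm_sub _
    (∑ k : modes Nb, (∑ j, Y j (k : ℤ)) * W k * E k) _).trans (add_le_add hx (hmain.trans ?_))
  push_cast
  linarith

/-! ### Perturbation of the argument. -/

theorem abs_arctan_le (x : ℝ) : |Real.arctan x| ≤ |x| := by
  have h : ∀ y : ℝ, 0 ≤ y → Real.arctan y ≤ y := by
    intro y hy
    have h1 := Real.le_tan (Real.arctan_nonneg.2 hy) (Real.arctan_lt_pi_div_two y)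
    rwa [Real.tan_arctan] at h1
  rcases le_total 0 x with hx | hx
  · rw [abs_of_nonneg hx, abs_of_nonneg (Real.arctan_nonneg.2 hx)]
    exact h x hx
  · have h1 := h (-x) (by linarith)
    rw [abs_of_nonpos hx, ← abs_neg, ← Real.arctan_neg,
      abs_of_nonneg (Real.arctan_nonneg.2 (by linarith))]
    exact h1

/-- If `a + ib` is close to `f₁ e^{iα}`, the rate of its argument differs from `α'` by the
derivative of a small function. -/
theorem exists_primitive_arctanRate_sub {a b α f₁ : ℝ → ℝ} (ha : Differentiable ℝ a)
    (hb : Differentiable ℝ b) (hα : Differentiable ℝ α) {η μ : ℝ} (hμ : 0 < μ) (hη : η ≤ μ / 2)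
    (hf₁ : ∀ t, μ ≤ f₁ t)
    (hab : ∀ t, ‖((a t : ℂ) + b t * Complex.I) - f₁ t * Complex.exp (α t * Complex.I)‖ ≤ η) :
    (∀ t, a t ^ 2 + b t ^ 2 ≠ 0) ∧ ∃ g : ℝ → ℝ, (∀ t, |g t| ≤ 2 * η / μ) ∧
      ∀ t, HasDerivAt g (arctanRate a b t - deriv α t) t := by
  -- `c + id` is `a + ib` rotated by `e^{-iα}`, hence close to the positive number `f₁`. In the
  -- half-plane `c ≥ μ/2` the function `arctan (d/c)` is a global branch of the argument error.
  set c : ℝ → ℝ := fun t => a t * Real.cos (α t) + b t * Real.sin (α t) with hc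
  set d : ℝ → ℝ := fun t => b t * Real.cos (α t) - a t * Real.sin (α t) with hd
  have hcd : ∀ t, ‖(((c t - f₁ t : ℝ) : ℂ)) + d t * Complex.I‖ ≤ η := by
    intro t
    have h1 : (((c t - f₁ t : ℝ) : ℂ)) + d t * Complex.I
        = (((a t : ℂ) + b t * Complex.I) - f₁ t * Complex.exp (α t * Complex.I)) *
          Complex.exp (((-α t : ℝ) : ℂ) * Complex.I) := by
      rw [sub_mul, mul_assoc (f₁ t : ℂ), ← Complex.exp_add]
      have h2 : (α t : ℂ) * Complex.I + ((-α t : ℝ) : ℂ) * Complex.I = 0 := by push_cast; ring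
      rw [h2, Complex.exp_zero, Complex.exp_mul_I, ← Complex.ofReal_cos, ← Complex.ofReal_sin,
        Real.cos_neg, Real.sin_neg]
      simp only [hc, hd]
      push_cast
      linear_combination ((b t : ℂ) * Complex.sin (α t)) * Complex.I_sq
    rw [h1, norm_mul, Complex.norm_exp_ofReal_mul_I, mul_one]
    exact hab t
  have hη0 : 0 ≤ η := (norm_nonneg _).trans (hab 0)
  have hcpos : ∀ t, μ / 2 ≤ c t := by
    intro t
    have h1 := (Complex.abs_re_le_norm _).trans (hcd t)
    simp only [Complex.add_re, Complex.ofReal_re, Complex.re_ofReal_mul, Complex.I_re, mul_zero,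
      add_zero] at h1
    have := (abs_le.1 h1).1
    linarith [hf₁ t]
  have hdle : ∀ t, |d t| ≤ η := by
    intro t
    have h1 := (Complex.abs_im_le_norm _).trans (hcd t)
    simpa using h1
  have hsq : ∀ t, c t ^ 2 + d t ^ 2 = a t ^ 2 + b t ^ 2 := by
    intro t
    simp only [hc, hd]
    linear_combination (a t ^ 2 + b t ^ 2) * Real.sin_sq_add_cos_sq (α t)
  have hne : ∀ t, a t ^ 2 + b t ^ 2 ≠ 0 := by
    intro t
    rw [← hsq]
    have := lt_of_lt_of_le (half_pos hμ) (hcpos t)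
    positivity
  refine ⟨hne, fun t => Real.arctan (d t / c t), fun t => ?_, fun t => ?_⟩
  · refine (abs_arctan_le _).trans ?_
    rw [abs_div, abs_of_pos (lt_of_lt_of_le (half_pos hμ) (hcpos t))]
    calc |d t| / c t ≤ η / (μ / 2) := by
          gcongr
          · exact hdle t
          · exact hcpos t
      _ = _ := by field_simp
  · have hα' := (hα t).hasDerivAt
    have hc' : HasDerivAt c (deriv a t * Real.cos (α t) + a t * (-Real.sin (α t) * deriv α t) +
        (deriv b t * Real.sin (α t) + b t * (Real.cos (α t) * deriv α t))) t :=
      ((ha t).hasDerivAt.mul hα'.cos).add ((hb t).hasDerivAt.mul hα'.sin)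
    have hd' : HasDerivAt d (deriv b t * Real.cos (α t) + b t * (-Real.sin (α t) * deriv α t) -
        (deriv a t * Real.sin (α t) + a t * (Real.cos (α t) * deriv α t))) t :=
      ((hb t).hasDerivAt.mul hα'.cos).sub ((ha t).hasDerivAt.mul hα'.sin)
    have hc0 : c t ≠ 0 := (lt_of_lt_of_le (half_pos hμ) (hcpos t)).ne'
    have h1 : HasDerivAt (fun t => Real.arctan (d t / c t)) (arctanRate c d t) t := by
      have h2 : DifferentiableAt ℝ (fun s => Real.arctan (d s / c s)) t :=
        (hd'.differentiableAt.div hc'.differentiableAt hc0).arctan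
      rw [← deriv_arctan_div hc'.differentiableAt hd'.differentiableAt hc0]
      exact h2.hasDerivAt
    refine h1.congr_deriv ?_
    rw [arctanRate, hc'.deriv, hd'.deriv, hsq, arctanRate, div_sub' (hne t)]
    congr 1
    have h2 := hsq t
    simp only [hc, hd] at h2 ⊢
    have h3 := Real.sin_sq_add_cos_sq (α t)
    linear_combination (a t * deriv b t - b t * deriv a t
      - (a t ^ 2 + b t ^ 2) * deriv α t) * h3

/-! ### Projection and the phase update. -/

/-- Integration by parts: the Fourier coefficients of a derivative are controlled by the
supremum of the function. -/
theorem norm_fourierC_deriv_le {g g' : ℝ → ℝ} (hg : ∀ t, HasDerivAt g (g' t) t)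
    (hg' : Continuous g') {η : ℝ} (hη : ∀ t, |g t| ≤ η) (k : ℤ) :
    ‖fourierC (fun t => (g' t : ℂ)) k‖ ≤ (2 + 2 * Real.pi * |(k : ℝ)|) * η := by
  rw [fourierC_eq]
  have hu : ∀ t ∈ uIcc (0 : ℝ) 1, HasDerivAt (fun t : ℝ => e (-(k * t)))
      (-(2 * Real.pi * Complex.I * k) * e (-(k * t))) t := by
    intro t _
    have h1 : HasDerivAt (fun t : ℝ => -((k : ℝ) * t)) (-(k * 1)) t :=
      ((hasDerivAt_id t).const_mul _).neg
    refine ((hasDerivAt_e (-(k * t))).scomp t h1).congr_deriv ?_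
    rw [mul_one, Complex.real_smul]
    push_cast
    ring
  have hec : Continuous fun t : ℝ => e (-(k * t)) :=
    continuous_e.comp (continuous_const.mul continuous_id).neg
  rw [intervalIntegral.integral_mul_deriv_eq_deriv_mul hu (fun t _ => (hg t).ofReal_comp)
    ((continuous_const.mul hec).intervalIntegrable _ _)
    ((Complex.continuous_ofReal.comp hg').intervalIntegrable _ _)]
  have hgn : ∀ t, ‖(g t : ℂ)‖ ≤ η := fun t => by rw [Complex.norm_real]; exact hη t
  have h1 : ‖∫ t in (0 : ℝ)..1, -(2 * Real.pi * Complex.I * k) * e (-(k * t)) * (g t : ℂ)‖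
      ≤ 2 * Real.pi * |(k : ℝ)| * η := by
    have := intervalIntegral.norm_integral_le_of_norm_le_const (a := 0) (b := 1)
      (f := fun t : ℝ => -(2 * Real.pi * Complex.I * k) * e (-(k * t)) * (g t : ℂ))
      (C := 2 * Real.pi * |(k : ℝ)| * η) (fun t _ => by
        rw [norm_mul, norm_mul, norm_neg, norm_two_pi_I_mul, norm_e, mul_one]
        gcongr
        exact hgn t)
    simpa using this
  refine (norm_sub_le _ _).trans ?_
  have h2 : ‖e (-(k * 1)) * (g 1 : ℂ) - e (-(k * 0)) * (g 0 : ℂ)‖ ≤ η + η := by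
    refine (norm_sub_le _ _).trans (add_le_add ?_ ?_) <;>
      rw [norm_mul, norm_e, one_mul] <;> exact hgn _
  linarith

theorem proj_eq (M : ℕ) (g : ℝ → ℝ) (t : ℝ) :
    proj M g t = (trigPoly M (fourierC fun s => (g s : ℂ)) t).re := rfl

theorem continuous_proj (M : ℕ) (g : ℝ → ℝ) : Continuous (proj M g) :=
  Complex.continuous_re.comp (continuous_trigPoly M _)

theorem hasDerivAt_increment {Nb : ℕ} (M : ℕ) (θ : ℝ → ℝ) (x : modes Nb → ℂ) (t : ℝ) :
    HasDerivAt (increment M θ x) (proj M (arctanRate (ampA θ x) (ampB θ x)) t) t :=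
  (continuous_proj M _).integral_hasStrictDerivAt 0 t |>.hasDerivAt

/-- The projection reproduces trigonometric polynomials. -/
theorem proj_sub_eq {M : ℕ} {g h : ℝ → ℝ} (hg : Continuous g) {c : ℤ → ℂ}
    (hc : ∀ t, (h t : ℂ) = trigPoly M c t) (t : ℝ) :
    proj M g t - h t = (trigPoly M (fourierC fun s => ((g s - h s : ℝ) : ℂ)) t).re := by
  have h1 : h t = (trigPoly M c t).re := by rw [← hc, Complex.ofReal_re]
  have hhc : Continuous fun s => (h s : ℂ) := by
    rw [show (fun s => (h s : ℂ)) = trigPoly M c from funext hc]; exact continuous_trigPoly M c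
  rw [proj_eq, h1, ← Complex.sub_re]
  congr 1
  rw [trigPoly, trigPoly, trigPoly, ← Finset.sum_sub_distrib]
  refine Finset.sum_congr rfl fun k hk => ?_
  rw [← sub_mul]
  congr 1
  have h2 : fourierC (fun s => (h s : ℂ)) k = c k := by
    rw [show (fun s => (h s : ℂ)) = trigPoly M c from funext hc, fourierC_trigPoly, if_pos hk]
  have hec : Continuous fun t : ℝ => e (-(k * t)) :=
    continuous_e.comp (continuous_const.mul continuous_id).neg
  rw [← h2, fourierC_eq, fourierC_eq, fourierC_eq]
  have h3 := intervalIntegral.integral_sub (a := 0) (b := 1) (μ := MeasureTheory.volume)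
    ((hec.mul (Complex.continuous_ofReal.comp hg)).intervalIntegrable _ _)
    ((hec.mul hhc).intervalIntegrable _ _)
  refine h3.symm.trans (intervalIntegral.integral_congr fun s _ => ?_)
  change e (-(k * s)) * (g s : ℂ) - e (-(k * s)) * (h s : ℂ)
    = e (-(k * s)) * ((g s - h s : ℝ) : ℂ)
  push_cast
  ring

theorem IsStep.isSparsePhase {Ns M Nb : ℕ} {ν : ℝ} {t : Fin Ns → ℝ} {f θ θ' : ℝ → ℝ}
    (h : IsStep M Nb ν t f θ θ') (hθ : IsSparsePhase M θ) : IsSparsePhase M θ' := by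
  obtain ⟨x, β, -, -, heq⟩ := h
  have hd : ∀ s, HasDerivAt θ' (deriv θ s + β * proj M (arctanRate (ampA θ x) (ampB θ x)) s) s := by
    intro s
    rw [show θ' = fun s => θ s + β * increment M θ x s from funext heq]
    exact (hθ.differentiable s).hasDerivAt.add ((hasDerivAt_increment M θ x s).const_mul β)
  refine ⟨fun s => (hd s).differentiableAt, ?_⟩
  have : cderiv θ' = cderiv θ + (β : ℂ) • trigPoly M (fun k =>
      (fourierC (fun s => (arctanRate (ampA θ x) (ampB θ x) s : ℂ)) k + (starRingEnd ℂ)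
        (fourierC (fun s => (arctanRate (ampA θ x) (ampB θ x) s : ℂ)) (-k))) / 2) := by
    funext s
    simp only [cderiv, Pi.add_apply, Pi.smul_apply, smul_eq_mul]
    rw [(hd s).deriv, ← ofReal_re_trigPoly, ← proj_eq]
    push_cast
    rfl
  rw [this]
  exact Submodule.add_mem _ hθ.deriv_mem (Submodule.smul_mem _ _ (trigPoly_mem_trigSpace M _))

theorem contDiff_shifted {Nb : ℕ} {θ : ℝ → ℝ} (hθ : ContDiff ℝ 1 (normPhase θ))
    (x : modes Nb → ℂ) (s : ℝ) : ContDiff ℝ 1 (shifted θ x s) := by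
  unfold shifted
  exact ContDiff.sum fun k _ => contDiff_const.mul (contDiff_e.comp (contDiff_const.mul hθ))

theorem contDiff_ampA {Nb : ℕ} {θ : ℝ → ℝ} (hθ : ContDiff ℝ 1 (normPhase θ))
    (x : modes Nb → ℂ) : ContDiff ℝ 1 (ampA θ x) :=
  Complex.reCLM.contDiff.comp ((contDiff_shifted hθ x _).add (contDiff_shifted hθ x _))

theorem contDiff_ampB {Nb : ℕ} {θ : ℝ → ℝ} (hθ : ContDiff ℝ 1 (normPhase θ))
    (x : modes Nb → ℂ) : ContDiff ℝ 1 (ampB θ x) :=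
  Complex.reCLM.contDiff.comp
    (contDiff_const.mul ((contDiff_shifted hθ x _).sub (contDiff_shifted hθ x _)))

/-- Despite the real parts in `ampA` and `ampB`, the combination is exactly one sideband plus the
conjugate of the other, so no conjugate symmetry of `x` is needed. -/
theorem ampA_add_ampB_mul_I {Nb : ℕ} (θ : ℝ → ℝ) (x : modes Nb → ℂ) (t : ℝ) :
    (ampA θ x t : ℂ) + ampB θ x t * Complex.I
      = shifted θ x (numPeriods θ) t + (starRingEnd ℂ) (shifted θ x (-numPeriods θ) t) := by
  apply Complex.ext <;> simp [ampA, ampB]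
  ring

theorem contDiff_normPhase {M : ℕ} {θ : ℝ → ℝ} (hθ : IsSparsePhase M θ) :
    ContDiff ℝ 1 (normPhase θ) :=
  (hθ.contDiff.sub contDiff_const).div_const _

/-- The update of the phase when the amplitudes `a`, `b` are close to `f₁ cos α`, `f₁ sin α`. -/
theorem freqError_step_le {M Nb : ℕ} {f₁ θ Θ Θ' : ℝ → ℝ}
    {x : modes Nb → ℂ} {β : ℝ} (hθ : IsSparsePhase M θ) (hΘ : IsSparsePhase M Θ)
    (hβ : IsGreatest {α : ℝ | α ∈ Icc (0 : ℝ) 1 ∧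
      ∀ s ∈ Icc (0 : ℝ) 1, 0 ≤ deriv (fun r => Θ r + α * increment M Θ x r) s} β)
    (heq : ∀ s, Θ' s = Θ s + β * increment M Θ x s) {η μ : ℝ} (hμ : 0 < μ) (hη : η ≤ μ / 2)
    (hf₁ : ∀ t, μ ≤ f₁ t)
    (hab : ∀ t, ‖((ampA Θ x t : ℂ) + ampB Θ x t * Complex.I)
      - f₁ t * Complex.exp (((θ t - Θ t + Θ 0 : ℝ) : ℂ) * Complex.I)‖ ≤ η)
    (hderiv : ∀ t, (2 * M + 1) * ((2 + 2 * Real.pi * M) * (2 * η / μ)) ≤ deriv θ t) :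
    freqError Θ' θ ≤ (2 * M + 1) * ((2 + 2 * Real.pi * M) * (2 * η / μ)) := by
  have hψ := contDiff_normPhase hΘ
  have ha := contDiff_ampA hψ x
  have hb := contDiff_ampB hψ x
  have hαs := hθ.sub hΘ
  have hα : ∀ s, HasDerivAt (fun t => θ t - Θ t + Θ 0) (deriv (fun t => θ t - Θ t) s) s :=
    fun s => (hαs.differentiable s).hasDerivAt.add_const _
  obtain ⟨hne, g, hgη, hg⟩ := exists_primitive_arctanRate_sub (ha.differentiable one_ne_zero)
    (hb.differentiable one_ne_zero) (fun s => (hα s).differentiableAt) hμ hη hf₁ hab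
  obtain ⟨q, hq⟩ := hαs.exists_coeff
  set rate := arctanRate (ampA Θ x) (ampB Θ x) with hrate
  have hrc : Continuous rate := by
    have h1 := (contDiff_one_iff_deriv.1 ha).2
    have h2 := (contDiff_one_iff_deriv.1 hb).2
    exact (((ha.continuous.mul h2).sub (hb.continuous.mul h1)).div
      ((ha.continuous.pow 2).add (hb.continuous.pow 2)) hne)
  have hg' : ∀ s, HasDerivAt g (rate s - deriv (fun t => θ t - Θ t) s) s := by
    intro s
    have := hg s
    rwa [(hα s).deriv] at this
  set r : ℤ → ℂ := fourierC fun s => ((rate s - deriv (fun t => θ t - Θ t) s : ℝ) : ℂ) with hr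
  have hrk : ∑ k ∈ Finset.Icc (-(M : ℤ)) M, ‖r k‖
      ≤ (2 * M + 1) * ((2 + 2 * Real.pi * M) * (2 * η / μ)) := by
    have h1 : ∀ k ∈ Finset.Icc (-(M : ℤ)) M, ‖r k‖ ≤ (2 + 2 * Real.pi * M) * (2 * η / μ) := by
      intro k hk
      refine (norm_fourierC_deriv_le hg' (hrc.sub hαs.continuous_deriv) hgη k).trans ?_
      have := abs_le_of_mem_Icc hk
      have h0 : 0 ≤ 2 * η / μ := (abs_nonneg _).trans (hgη 0)
      gcongr
    refine (Finset.sum_le_sum h1).trans (le_of_eq ?_)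
    rw [Finset.sum_const, Int.card_Icc, nsmul_eq_mul]
    congr 1
    rw [show (M : ℤ) + 1 - -(M : ℤ) = ((2 * M + 1 : ℕ) : ℤ) by push_cast; ring, Int.toNat_natCast]
    push_cast; ring
  have hsubd : ∀ s, deriv (fun t => θ t - Θ t) s = deriv θ s - deriv Θ s := fun s =>
    ((hθ.differentiable s).hasDerivAt.sub (hΘ.differentiable s).hasDerivAt).deriv
  have hproj : ∀ s, proj M rate s = deriv θ s - deriv Θ s + (trigPoly M r s).re := by
    intro s
    rw [← hsubd, ← proj_sub_eq hrc hq s]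
    ring
  have hd1 : ∀ c s : ℝ, HasDerivAt (fun u => Θ u + c * increment M Θ x u)
      (deriv Θ s + c * proj M rate s) s := fun c s =>
    (hΘ.differentiable s).hasDerivAt.add ((hasDerivAt_increment M Θ x s).const_mul c)
  -- The full step has derivative `θ'` plus an error that `hderiv` says is dominated by `θ'`, so `1`
  -- is admissible.
  have hβ1 : β = 1 := by
    refine le_antisymm hβ.1.1.2 (hβ.2 ⟨⟨zero_le_one, le_rfl⟩, fun s _ => ?_⟩)
    rw [(hd1 1 s).deriv, hproj]
    have h1 := (Complex.abs_re_le_norm _).trans ((norm_trigPoly_le M r s).trans hrk)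
    have h2 := (abs_le.1 h1).1
    have h3 := hderiv s
    linarith
  have herr : cderiv (fun t => Θ' t - θ t) = fun s => (((trigPoly M r s).re : ℝ) : ℂ) := by
    funext s
    have h1 : HasDerivAt (fun t => Θ' t - θ t) (deriv Θ s + β * proj M rate s - deriv θ s) s := by
      rw [show Θ' = fun u => Θ u + β * increment M Θ x u from funext heq]
      exact (hd1 β s).sub (hθ.differentiable s).hasDerivAt
    rw [cderiv, h1.deriv, hβ1, hproj]
    congr 1
    ring
  rw [freqError, herr]
  exact (fourierNorm_re_trigPoly_le M r).trans hrk

/-! ### The contraction and the theorem. -/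

/-- A step of the algorithm halves the error of the instantaneous frequency. -/
theorem exists_contraction (M₀ M₁ : ℕ) {φ : ℝ → ℝ} (hφ : IsSparsePhase M₀ φ) (h0 : φ 0 = 0)
    (h1 : φ 1 = 1) (hpos : ∀ t, 0 < deriv φ t) {μ B : ℝ} (hμ : 0 < μ) (hB : 0 ≤ B) :
    ∃ η₀ η₁ η₂ : ℝ, 0 < η₀ ∧ 0 < η₁ ∧ 0 < η₂ ∧
      ∀ (θ f₀ f₁ f : ℝ → ℝ) (N : ℕ), IsSparsePhase M₀ θ → normPhase θ = φ →
        IsSparseInPhase M₁ θ f₀ → IsSparseInPhase M₁ θ f₁ →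
        (∀ t, |f₀ t| ≤ B) → (∀ t, μ ≤ f₁ t ∧ f₁ t ≤ B) →
        (∀ t, f t = f₀ t + f₁ t * Real.cos (θ t)) → numPeriods θ = N → η₀ ≤ N →
        ∀ (Ns Nb : ℕ) (ν : ℝ) (t : Fin Ns → ℝ), Even Nb → η₂ * (N + Ns) ≤ Nb →
          ∀ (Θ Θ' : ℝ → ℝ) (S : ℕ), IsSparsePhase M₀ Θ →
            freqError Θ θ ≤ Real.pi * M₀ / 2 → IsStep M₀ Nb ν t f Θ Θ' →
            IsSparsityLevel (Phi Nb ν t Θ) S → η₁ ≤ S →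
            freqError Θ' θ ≤ 1 / 2 * freqError Θ θ := by
  have hpi := Real.pi_pos
  set D₀ : ℝ := Real.pi * M₀ / 2 with hD₀
  have hD₀0 : 0 ≤ D₀ := by positivity
  obtain ⟨κ, L₀, K, ρ, hκ, hL₀, hK, hρ, hκφ, hchange⟩ := exists_phase_change hφ h0 h1 hpos hD₀0
  set K' : ℝ := (2 * M₁ + 1) * (B * (K * Real.exp (ρ * M₁))) with hK'
  have hK'0 : 0 ≤ K' := by positivity
  set Q : ℝ := (2 * M₀ + 1) * (2 + 2 * Real.pi * M₀) with hQ
  have hQ0 : 0 < Q := by positivity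
  -- The first bound makes the new error `2QεD/μ` at most `D/2`; the second gives `εD ≤ μ/2`, so
  -- that the argument stays in a half-plane.
  set ε : ℝ := min (μ / (4 * Q)) (μ / (2 * (D₀ + 1))) with hε
  have hε0 : 0 < ε := by positivity
  obtain ⟨η₀, η₁, η₂, hη₀, hη₁, hη₂, hrec⟩ := exists_l1_recovery M₁ hK'0 hρ
    (by positivity : 0 < ε / 4)
  obtain ⟨R, hR, hexp⟩ := exists_mul_exp_neg_le (3 * K' * expSum (ρ / 4))
    (by positivity : 0 < ρ / 8) (by positivity : 0 < ε / 4)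
  refine ⟨L₀ + η₀ + R + 6 * D₀ + 4 * M₁ + 4 + D₀ / κ, η₁, η₂, by positivity, hη₁, by linarith, ?_⟩
  intro θ f₀ f₁ f N hθ hφθ hf₀ hf₁ hf₀B hf₁B hf hN hηN Ns Nb ν t hNb hNbη Θ Θ' S hΘ hD hstep hS hηS
  have hM₁ : (0 : ℝ) ≤ M₁ := M₁.cast_nonneg
  have hDκ : 0 ≤ D₀ / κ := by positivity
  have hNs : (0 : ℝ) ≤ Ns := Ns.cast_nonneg
  obtain ⟨hLN, hch⟩ := hchange θ Θ N hθ hΘ hφθ hN (by linarith) hD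
  set D := freqError Θ θ with hDdef
  have hD0 : 0 ≤ D := tsum_nonneg fun _ => norm_nonneg _
  have hN0 : (0 : ℝ) < N := by linarith
  -- the expansions of the signal
  have hφC : ContDiff ℝ 1 (normPhase θ) := contDiff_normPhase hθ
  have hφp : ∀ t, normPhase θ (t + 1) = normPhase θ t + 1 := by
    intro t
    rw [hφθ, hφ.add_one, h0, h1, sub_zero]
  have hpos' : ∀ t, 0 < deriv (normPhase θ) t := by rw [hφθ]; exact hpos
  obtain ⟨c₀, hc₀B, hc₀⟩ := hf₀.exists_coeff hφC hpos' hφp hf₀B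
  obtain ⟨c₁, hc₁B, hc₁⟩ := hf₁.exists_coeff hφC hpos' hφp (B := B) (fun t => by
    rw [abs_of_pos (hμ.trans_le (hf₁B t).1)]; exact (hf₁B t).2)
  rw [hφθ] at hc₀ hc₁
  have hθφ : ∀ t, θ t = θ 0 + 2 * Real.pi * N * φ t := by
    intro t
    rw [← hφθ, normPhase, hN]
    field_simp
    ring
  set s : Fin 3 → ℤ := ![0, N, -N] with hs
  set c : Fin 3 → ℤ → ℂ := ![c₀, fun j => 1 / 2 * Complex.exp (θ 0 * Complex.I) * c₁ j,
    fun j => 1 / 2 * Complex.exp (-(θ 0 * Complex.I)) * c₁ j] with hc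
  have hcB : ∀ i j, ‖c i j‖ ≤ B := by
    have hhalf : ∀ (y : ℝ) (j : ℤ), ‖1 / 2 * Complex.exp (y * Complex.I) * c₁ j‖ ≤ B := by
      intro y j
      rw [norm_mul, norm_mul, Complex.norm_exp_ofReal_mul_I]
      have : ‖(1 / 2 : ℂ)‖ = 1 / 2 := by norm_num
      rw [this]
      have := hc₁B j
      have := norm_nonneg (c₁ j)
      linarith
    intro i j
    fin_cases i
    · exact hc₀B j
    · exact hhalf (θ 0) j
    · have := hhalf (-θ 0) j
      rw [Complex.ofReal_neg, neg_mul] at this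
      exact this
  have hsN : ∀ i, |(s i : ℝ)| ≤ N := by
    intro i
    fin_cases i <;> simp [hs]
  have hY : ∀ i, ∃ Y, ExpandsAt (normPhase Θ) (fun t => e (s i * φ t) * trigPoly M₁ (c i) (φ t)) Y
      (s i) M₁ (K' * D) ρ := by
    intro i
    obtain ⟨Y, hY⟩ := exists_expandsAt (φ := φ) (ψ := normPhase Θ) (M := M₁) (hcB i)
      (A := K * D) (by positivity) hρ (s i) (fun n hn => by
        refine hch n ?_
        have h2 : |(n : ℝ) - s i| ≤ M₁ := by exact_mod_cast hn
        have h3 := abs_sub_abs_le_abs_sub (n : ℝ) (s i)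
        have h4 := hsN i
        linarith)
    refine ⟨Y, ?_⟩
    convert hY using 1
    rw [hK']; ring
  choose Y hY using hY
  set G : Fin 3 → ℝ → ℂ := fun i t => e (s i * φ t) * trigPoly M₁ (c i) (φ t) with hG
  have hmul : ∀ (a : ℂ) (y : ℝ), trigPoly M₁ (fun j => a * c₁ j) y = a * trigPoly M₁ c₁ y := by
    intro a y
    simp only [trigPoly, Finset.mul_sum, mul_assoc]
  have hG0 : ∀ t, G 0 t = f₀ t := by
    intro t
    simp only [hG, hs, hc]
    simp [e_zero, hc₀]
  have hG1 : ∀ t, G 1 t = 1 / 2 * f₁ t * Complex.exp (θ t * Complex.I) := by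
    intro t
    have h2 : G 1 t = e (N * φ t) * trigPoly M₁ (fun j => 1 / 2 * Complex.exp (θ 0 * Complex.I) *
      c₁ j) (φ t) := by simp [hG, hs, hc]
    rw [h2, hmul, ← hc₁, hθφ t, Complex.ofReal_add, add_mul, Complex.exp_add, e]
    have h3 : (2 * Real.pi * ((N * φ t : ℝ) : ℂ) * Complex.I : ℂ)
      = ((2 * Real.pi * N * φ t : ℝ) : ℂ) * Complex.I := by push_cast; ring
    rw [h3]
    ring
  have hG2 : ∀ t, G 2 t = 1 / 2 * f₁ t * Complex.exp (-(θ t * Complex.I)) := by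
    intro t
    have h2 : G 2 t = e (-N * φ t) * trigPoly M₁ (fun j => 1 / 2 *
      Complex.exp (-(θ 0 * Complex.I)) * c₁ j) (φ t) := by simp [hG, hs, hc]
    rw [h2, hmul, ← hc₁, hθφ t, Complex.ofReal_add, add_mul, neg_add, Complex.exp_add, e]
    have h3 : (2 * Real.pi * ((-N * φ t : ℝ) : ℂ) * Complex.I : ℂ)
      = -(((2 * Real.pi * N * φ t : ℝ) : ℂ) * Complex.I) := by push_cast; ring
    rw [h3]
    ring
  have hfG : ∀ t, (f t : ℂ) = ∑ i, G i t := by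
    intro t
    rw [Fin.sum_univ_three, hG0, hG1, hG2, hf]
    have := Complex.two_cos (θ t : ℂ)
    push_cast
    rw [← neg_mul]
    linear_combination (f₁ t / 2 : ℂ) * this
  -- the recovered coefficients
  obtain ⟨x, β, hx, hβ, heq⟩ := hstep
  have hL1 := hrec Θ f N Y G s D hsN hD0 hY hfG (by linarith) Ns Nb ν t S x hNb hNbη hS.1 hηS hx
  have hNNb : 8 * (N : ℝ) ≤ Nb := by
    have : 16 * ((N : ℝ) + Ns) ≤ η₂ * (N + Ns) := by gcongr
    linarith
  have hLN' := abs_le.1 hLN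
  have hLpos : 0 < numPeriods Θ := by linarith
  have hsep : ∀ i : Fin 3, ∀ j ≠ i, (N : ℝ) ≤ |(s j : ℝ) - s i| := by
    intro i j hij
    fin_cases i <;> fin_cases j <;>
      first
      | exact absurd rfl hij
      | (refine le_abs.2 (Or.inl ?_); simp [hs]; done)
      | (refine le_abs.2 (Or.inr ?_); simp [hs])
  have hK'D : 0 ≤ K' * D := by positivity
  have hw1 := fun u => norm_shifted_sub_le (N := N) hK'D hρ hY (hsep 1) (S := numPeriods Θ)
    (D₀ := D₀) (by simpa [hs, abs_sub_comm] using hLN) (abs_of_pos hLpos).le hLN (by linarith)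
    (by linarith) hNb hNNb x u
  have hw2 := fun u => norm_shifted_sub_le (N := N) hK'D hρ hY (hsep 2) (S := -numPeriods Θ)
    (D₀ := D₀) (by
      have : ((s 2 : ℤ) : ℝ) - -numPeriods Θ = numPeriods Θ - N := by simp [hs]; ring
      rw [this]; exact hLN) (by rw [abs_neg, abs_of_pos hLpos]) hLN (by linarith)
    (by linarith) hNb hNNb x u
  have hsmall : ∑ k : modes Nb, ‖x k - ∑ i, Y i k‖
      + 3 * (K' * D * Real.exp (-(ρ / 8) * N)) * expSum (ρ / 4) ≤ ε / 2 * D := by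
    have h2 := mul_le_mul_of_nonneg_right (hexp N (by linarith)) hD0
    linarith
  have hphase : ∀ u, 2 * Real.pi * (numPeriods Θ * normPhase Θ u) = Θ u - Θ 0 := by
    intro u
    rw [normPhase]
    field_simp
  have hab : ∀ u, ‖((ampA Θ x u : ℂ) + ampB Θ x u * Complex.I)
      - f₁ u * Complex.exp (((θ u - Θ u + Θ 0 : ℝ) : ℂ) * Complex.I)‖ ≤ ε * D := by
    intro u
    set E := Complex.exp (((θ u - Θ u + Θ 0 : ℝ) : ℂ) * Complex.I) with hE
    -- The component at `N` and the conjugate of the one at `-N`, demodulated by `∓L`, each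
    -- contribute half of `f₁ E`.
    have hT1 : G 1 u * e (-(numPeriods Θ * normPhase Θ u)) = 1 / 2 * f₁ u * E := by
      rw [hG1, mul_assoc, e, ← Complex.exp_add]
      have h2 : (θ u : ℂ) * Complex.I + 2 * Real.pi * ((-(numPeriods Θ * normPhase Θ u) : ℝ) : ℂ) *
          Complex.I = ((θ u - Θ u + Θ 0 : ℝ) : ℂ) * Complex.I := by
        have h3 : (θ u - Θ u + Θ 0 : ℝ) = θ u - 2 * Real.pi * (numPeriods Θ * normPhase Θ u) := by
          rw [hphase]; ring
        rw [h3]; push_cast; ring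
      rw [h2]
    have hT2 : (starRingEnd ℂ) (G 2 u * e (-(-numPeriods Θ * normPhase Θ u)))
        = 1 / 2 * f₁ u * E := by
      rw [hG2, mul_assoc, e, ← Complex.exp_add, map_mul, ← Complex.exp_conj]
      have h2 : (starRingEnd ℂ) (-((θ u : ℂ) * Complex.I) +
          2 * Real.pi * ((-(-numPeriods Θ * normPhase Θ u) : ℝ) : ℂ) * Complex.I)
          = ((θ u - Θ u + Θ 0 : ℝ) : ℂ) * Complex.I := by
        have h3 : (θ u - Θ u + Θ 0 : ℝ) = θ u - 2 * Real.pi * (numPeriods Θ * normPhase Θ u) := by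
          rw [hphase]; ring
        rw [h3]
        simp only [map_add, map_neg, map_mul, Complex.conj_ofReal, Complex.conj_I,
          Complex.conj_ofNat]
        push_cast; ring
      rw [h2, ← hE]
      simp [Complex.conj_ofNat]
    have h4 : ((ampA Θ x u : ℂ) + ampB Θ x u * Complex.I) - f₁ u * E
        = (shifted Θ x (numPeriods Θ) u - G 1 u * e (-(numPeriods Θ * normPhase Θ u)))
        + (starRingEnd ℂ) (shifted Θ x (-numPeriods Θ) u
          - G 2 u * e (-(-numPeriods Θ * normPhase Θ u))) := by
      rw [ampA_add_ampB_mul_I, map_sub, hT1, hT2]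
      ring
    rw [h4]
    refine (norm_add_le _ _).trans ?_
    rw [RCLike.norm_conj]
    have := hw1 u
    have := hw2 u
    linarith
  -- the update
  have hε1 : 4 * Q * ε ≤ μ := by
    have : ε ≤ μ / (4 * Q) := min_le_left _ _
    rw [le_div_iff₀ (by positivity)] at this
    linarith
  have hε2 : ε * D ≤ μ / 2 := by
    have h2 : ε ≤ μ / (2 * (D₀ + 1)) := min_le_right _ _
    rw [le_div_iff₀ (by positivity)] at h2
    have h3 := mul_le_mul_of_nonneg_left hD hε0.le
    linarith
  have hQε : (2 * M₀ + 1) * ((2 + 2 * Real.pi * M₀) * (2 * (ε * D) / μ)) ≤ 1 / 2 * D := by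
    rw [← mul_assoc, ← hQ, mul_div_assoc', div_le_iff₀ hμ]
    have h3 := mul_le_mul_of_nonneg_right hε1 hD0
    linarith
  refine (freqError_step_le hθ hΘ hβ heq hμ hε2 (fun u => (hf₁B u).1) hab fun u => ?_).trans hQε
  refine hQε.trans ?_
  have hdθ : deriv θ u = 2 * Real.pi * N * deriv φ u := by
    have h3 : HasDerivAt θ (2 * Real.pi * N * deriv φ u) u := by
      rw [show θ = fun t => θ 0 + 2 * Real.pi * N * φ t from funext hθφ]
      exact ((hφ.differentiable u).hasDerivAt.const_mul _).const_add _
    exact h3.deriv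
  rw [hdθ]
  -- This gives `D/2 ≤ D₀ ≤ Nκ ≤ θ'`, so the full step is admissible.
  have h5 : D₀ / κ ≤ N := by linarith
  rw [div_le_iff₀ hκ] at h5
  have h6 : (N : ℝ) * κ ≤ 2 * Real.pi * N * deriv φ u := by
    have h7 := hκφ u
    have h8 := Real.pi_gt_three
    have h9 : (N : ℝ) * κ ≤ N * deriv φ u := by gcongr
    have h10 := mul_le_mul_of_nonneg_right (by linarith : 1 ≤ 2 * Real.pi)
      (mul_nonneg hN0.le (hpos u).le)
    linarith
  linarith

theorem isSparsePhase_normPhase {M : ℕ} {θ : ℝ → ℝ} (hθ : IsSparsePhase M θ) :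
    IsSparsePhase M (normPhase θ) := by
  have hd : ∀ t, HasDerivAt (normPhase θ) (deriv θ t / (2 * Real.pi * numPeriods θ)) t := fun t =>
    ((hθ.differentiable t).hasDerivAt.sub_const _).div_const _
  refine ⟨fun t => (hd t).differentiableAt, ?_⟩
  have : cderiv (normPhase θ) = ((2 * Real.pi * numPeriods θ : ℝ) : ℂ)⁻¹ • cderiv θ := by
    funext t
    simp only [cderiv, Pi.smul_apply, smul_eq_mul]
    rw [(hd t).deriv, Complex.ofReal_div, div_eq_inv_mul]
  rw [this]
  exact Submodule.smul_mem _ _ hθ.deriv_mem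

end SparseTF

end

theorem mainTheorem4 (M₀ M₁ : ℕ) (φ : ℝ → ℝ) (μ B : ℝ) (hμ : 0 < μ) :
    ∃ η₀ η₁ η₂ : ℝ, 0 < η₀ ∧ 0 < η₁ ∧ 0 < η₂ ∧
      ∀ θ f₀ f₁ f : ℝ → ℝ,
        SparseTF.IsSparsePhase M₀ θ → (∀ t, 0 < deriv θ t) → SparseTF.normPhase θ = φ →
        SparseTF.IsSparseInPhase M₁ θ f₀ → SparseTF.IsSparseInPhase M₁ θ f₁ →
        (∀ t, |f₀ t| ≤ B) → (∀ t, μ ≤ f₁ t ∧ f₁ t ≤ B) →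
        (∀ t, f t = f₀ t + f₁ t * Real.cos (θ t)) → Function.Periodic f 1 →
        η₀ ≤ SparseTF.numPeriods θ →
        ∀ (Ns Nb : ℕ) (ν : ℝ) (t : Fin Ns → ℝ), Even Nb → 0 < ν →
          (∀ j, t j ∈ Set.Icc (0 : ℝ) 1) →
          η₂ * (SparseTF.numPeriods θ + Ns) ≤ Nb →
          ∀ Θ : ℕ → ℝ → ℝ,
            SparseTF.IsSparsePhase M₀ (Θ 0) →
            SparseTF.freqError (Θ 0) θ ≤ Real.pi * M₀ / 2 →
            ∀ (m : ℕ) (S : ℕ → ℕ),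
              (∀ i ≤ m, SparseTF.IsStep M₀ Nb ν t f (Θ i) (Θ (i + 1))) →
              (∀ i ≤ m, SparseTF.IsSparsityLevel (SparseTF.Phi Nb ν t (Θ i)) (S i) ∧
                η₁ ≤ (S i : ℝ)) →
              SparseTF.freqError (Θ (m + 1)) θ ≤ 1 / 2 * SparseTF.freqError (Θ m) θ := by
  by_cases hφ : SparseTF.IsSparsePhase M₀ φ ∧ φ 0 = 0 ∧ φ 1 = 1 ∧ (∀ t, 0 < deriv φ t) ∧ 0 ≤ B
  · obtain ⟨hφ, h0, h1, hpos, hB⟩ := hφ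
    obtain ⟨η₀, η₁, η₂, hη₀, hη₁, hη₂, H⟩ :=
      SparseTF.exists_contraction M₀ M₁ hφ h0 h1 hpos hμ hB
    -- The maximum with 1 guarantees a full period, from which integrality of the number of periods
    -- follows.
    refine ⟨max η₀ 1, η₁, η₂, lt_max_of_lt_left hη₀, hη₁, hη₂, ?_⟩
    intro θ f₀ f₁ f hθ _ hφθ hf₀ hf₁ hf₀B hf₁B hf hper hL Ns Nb ν t hNb _ _ hNbη Θ hΘ hD m S hstep hS
    obtain ⟨N, hN⟩ := SparseTF.exists_numPeriods_eq_nat hθ ((le_max_right _ _).trans hL)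
      hf₀.periodic hf₁.periodic (fun t => hμ.trans_le (hf₁B t).1) hf hper
    rw [hN] at hL hNbη
    have hone : ∀ i ≤ m, SparseTF.IsSparsePhase M₀ (Θ i) →
        SparseTF.freqError (Θ i) θ ≤ Real.pi * M₀ / 2 →
        SparseTF.freqError (Θ (i + 1)) θ ≤ 1 / 2 * SparseTF.freqError (Θ i) θ :=
      fun i hi hΘi hDi => H θ f₀ f₁ f N hθ hφθ hf₀ hf₁ hf₀B hf₁B hf hN ((le_max_left _ _).trans hL)
        Ns Nb ν t hNb hNbη (Θ i) (Θ (i + 1)) (S i) hΘi hDi (hstep i hi) (hS i hi).1 (hS i hi).2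
    have hall : ∀ i ≤ m, SparseTF.IsSparsePhase M₀ (Θ i) ∧
        SparseTF.freqError (Θ i) θ ≤ Real.pi * M₀ / 2 := by
      intro i
      induction i with
      | zero => exact fun _ => ⟨hΘ, hD⟩
      | succ i ih =>
        intro hi
        obtain ⟨h2, h3⟩ := ih (by omega)
        refine ⟨(hstep i (by omega)).isSparsePhase h2, (hone i (by omega) h2 h3).trans ?_⟩
        have : 0 ≤ SparseTF.freqError (Θ i) θ := tsum_nonneg fun _ => norm_nonneg _
        linarith
    exact hone m le_rfl (hall m le_rfl).1 (hall m le_rfl).2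
  -- Here `φ` and `B` cannot arise from any admissible signal with `L ≥ 1`, so the assertion is
  -- vacuous.
  · refine ⟨1, 1, 1, one_pos, one_pos, one_pos, ?_⟩
    intro θ f₀ f₁ f hθ hpos hφθ _ _ _ hf₁B _ _ hL
    have hLpos : 0 < 2 * Real.pi * SparseTF.numPeriods θ := by
      have := Real.pi_pos
      have := zero_lt_one.trans_le hL
      positivity
    refine absurd ⟨?_, ?_, ?_, ?_, ?_⟩ hφ
    · rw [← hφθ]; exact SparseTF.isSparsePhase_normPhase hθ
    · simp [← hφθ, SparseTF.normPhase]
    · have h2 : 2 * Real.pi * SparseTF.numPeriods θ = θ 1 - θ 0 := by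
        have := Real.pi_ne_zero
        rw [SparseTF.numPeriods]; field_simp
      rw [← hφθ, SparseTF.normPhase, ← h2, div_self hLpos.ne']
    · intro t
      rw [← hφθ]
      have hd : HasDerivAt (SparseTF.normPhase θ)
          (deriv θ t / (2 * Real.pi * SparseTF.numPeriods θ)) t :=
        ((hθ.differentiable t).hasDerivAt.sub_const _).div_const _
      rw [hd.deriv]
      exact div_pos (hpos t) hLpos
    · exact hμ.le.trans ((hf₁B 0).1.trans (hf₁B 0).2)
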